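/- Let $\mathbb K$ be $\mathbb R$ or $\mathbb C$, let $\mathcal H$ be an infinite-dimensional separable Hilbert space over $\mathbb K$ with orthonormal basis $(e_i)_{i\ge 1}$ and dual basis $(e_i^*)_{i\ge1}$ of $\mathcal H^*$, and let $W=\mathcal H\oplus\mathcal H^*$. Let $\mathcal F_{HS}$ be the set of all (Fréchet) smooth functions $F\colon W\to\mathbb K$ such that, for every $r\ge1$, the family of all partial derivatives of order $r$ of $F$ at $w$ in directions $(e_i,0)$ and $(0,e_i^*)$ is square-summable for every $w\in W$ and depends smoothly on $w$ as an element of $\ell^2$ (that is, $D^{(r)}F$ is a smooth map from $W$ to the space of Hilbert–Schmidt $r$-linear forms on $W$). This is an algebra under pointwise multiplication. Let $D_1F(w)\in\mathcal H^*$ and $D_2F(w)\in\mathcal H^{**}\cong\mathcal H$ be the partial derivatives of $F$, and put $$\{F,G\}=\langle D_1F,D_2G\rangle-\langle D_1G,D_2F\rangle,\qquad E_A(F,G)=\langle D_1F,A\,D_2G\rangle+\langle D_1G,A\,D_2F\rangle$$ for a bounded operator $A\in\mathcal B(\mathcal H)$. An $r$-differential operator on $\mathcal F_{HS}$ is an $r$-linear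 map $\mathbf A\colon\mathcal F_{HS}^r\to\mathcal F_{HS}$ of the form $\mathbf A(F_1,\dots,F_r)(w)=\sum a^{(n_1,\dots,n_r)}(w).(D^{(n_1)}F_1(w),\dots,D^{(n_r)}F_r(w))$, a finite sum in which the $a^{(n_1,\dots,n_r)}(w)$ are (not necessarily bounded) $r$-linear forms. A deformation quantization of $(W,\mathcal F_{HS},\{\cdot,\cdot\})$ is an associative $\mathbb K[[\hbar]]$-bilinear product $F\star G=\sum_{r\ge0}\hbar^rC_r(F,G)$ on $\mathcal F_{HS}[[\hbar]]$ with $C_0(F,G)=FG$, $C_1(F,G)-C_1(G,F)=2\{F,G\}$, and $C_r$ a bidifferential operator vanishing on constants for $r\ge1$. Two of them, $\star^1$ and $\star^2$, are equivalent if there is $T=\mathrm{Id}+\sum_{r\ge1}\hbar^rT_r$ with differential operators $T_r$ on $\mathcal F_{HS}$ vanishing on constants such that $T(F)\star^1T(G)=T(F\star^2G)$ for all $F,G\in\mathcal F_{HS}$. Theorem 2. $(W,\mathcal F_{HS},\{\cdot,\cdot\})$ is a Poisson space: $\{\cdot,\cdot\}$ maps $\mathcal F_{HS}\times\mathcal F_{HS}$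 to $\mathcal F_{HS}$, is given at each $w$ by a bilinear form in $DF(w)$ and $DG(w)$, and makes $\mathcal F_{HS}$ a Poisson algebra. For each $A\in\mathcal B(\mathcal H)$, let $C_1^A=\{\cdot,\cdot\}+E_A$, i.e. $C_1^A(F,G)=\langle D_1F,(A+\mathbb I)D_2G\rangle+\langle D_1G,(A-\mathbb I)D_2F\rangle$, and let $C_r^A=(C_1^A)^r$ be its $r$-th power as a bidifferential operator with constant coefficients: writing $C_1^A(F,G)=\sum_k DF(u_k)\,DG(v_k)$, where $(u_k,v_k)$ runs over all pairs $\big(((A+\mathbb I)e_j,0),(0,e_j^*)\big)$ and $\big((0,e_j^*),((A-\mathbb I)e_j,0)\big)$, $$C_r^A(F,G)=\sum_{k_1,\dots,k_r}D^{(r)}F(u_{k_1},\dots,u_{k_r})\;D^{(r)}G(v_{k_1},\dots,v_{k_r}),$$ which converges absolutely for $F,G\in\mathcal F_{HS}$. Then $$F\star^A_\hbar G=FG+\sum_{r\ge1}\frac{\hbar^r}{r!}\,C_r^A(F,G)$$ defines a deformation quantization $(W,\mathcal F_{HS}[[\hbar]],\star^A_\hbar)$ of $(W,\mathcal F_{HS},\{\cdot,\cdot\})$.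 For $A,B\in\mathcal B(\mathcal H)$, the deformation quantizations $(W,\mathcal F_{HS}[[\hbar]],\star^A_\hbar)$ and $(W,\mathcal F_{HS}[[\hbar]],\star^B_\hbar)$ are equivalent if and only if $A-B$ is a Hilbert–Schmidt operator. Consequently, equivalence is an equivalence relation on $\{\star^A_\hbar\mid A\in\mathcal B(\mathcal H)\}$, and $A\mapsto[\star^A_\hbar]$ induces a bijection from $\mathcal B(\mathcal H)/\mathcal B_2(\mathcal H)$ onto the set of its equivalence classes, where $\mathcal B_2(\mathcal H)$ is the space of Hilbert–Schmidt operators. -/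

import Mathlib

open scoped ContDiff PowerSeries

noncomputable section

namespace HilbertStar

/-! ### Deformation quantization on a normed space -/

section General

variable {𝕜 E : Type*} [RCLike 𝕜] [NormedAddCommGroup E] [NormedSpace 𝕜 E]

/-- A linear operator on an algebra `𝓕` of functions is differential: at every point `w` it is a
finite sum of (not necessarily bounded) linear forms `a m w` applied to the derivatives `DᵐF(w)`.
(A linear form defined only on a subspace containing the `DᵐF(w)` extends algebraically to the
space of all bounded `m`-linear forms, so `a m w` is taken to be defined there.) -/
def IsDifferentialOp (𝓕 : Subalgebra 𝕜 (E → 𝕜)) (T : 𝓕 →ₗ[𝕜] 𝓕) : Prop :=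
  ∃ (S : Finset ℕ) (a : ∀ m : ℕ, E → ((E [×m]→L[𝕜] 𝕜) →ₗ[𝕜] 𝕜)),
    ∀ (F : 𝓕) (w : E),
      (T F : E → 𝕜) w = ∑ m ∈ S, a m w (iteratedFDeriv 𝕜 m (F : E → 𝕜) w)

/-- The analogous notion for bilinear operators. -/
def IsBidifferentialOp (𝓕 : Subalgebra 𝕜 (E → 𝕜)) (C : 𝓕 →ₗ[𝕜] 𝓕 →ₗ[𝕜] 𝓕) : Prop :=
  ∃ (S : Finset (ℕ × ℕ))
    (a : ∀ m n : ℕ, E → ((E [×m]→L[𝕜] 𝕜) →ₗ[𝕜] (E [×n]→L[𝕜] 𝕜) →ₗ[𝕜] 𝕜)),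
    ∀ (F G : 𝓕) (w : E),
      (C F G : E → 𝕜) w = ∑ p ∈ S, a p.1 p.2 w
        (iteratedFDeriv 𝕜 p.1 (F : E → 𝕜) w) (iteratedFDeriv 𝕜 p.2 (G : E → 𝕜) w)

/-- `br` is a Poisson bracket on `(E, 𝓕)`, where `𝓕` is a subalgebra of `C^∞(E, 𝕜)`. -/
structure IsPoissonBracket (𝓕 : Subalgebra 𝕜 (E → 𝕜)) (br : 𝓕 →ₗ[𝕜] 𝓕 →ₗ[𝕜] 𝓕) : Prop where
  smooth : ∀ F ∈ 𝓕, ContDiff 𝕜 ∞ F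
  tensor : ∃ P : E → ((E →L[𝕜] 𝕜) →ₗ[𝕜] (E →L[𝕜] 𝕜) →ₗ[𝕜] 𝕜),
    ∀ (F G : 𝓕) (w : E),
      (br F G : E → 𝕜) w = P w (fderiv 𝕜 (F : E → 𝕜) w) (fderiv 𝕜 (G : E → 𝕜) w)
  skew : ∀ F G : 𝓕, br F G = - br G F
  leibniz : ∀ F G K : 𝓕, br F (G * K) = br F G * K + G * br F K
  jacobi : ∀ F G K : 𝓕, br F (br G K) + br G (br K F) + br K (br F G) = 0

/-- The `𝕜[[ℏ]]`-bilinear (`ℏ`-adically continuous) extension to `𝓕[[ℏ]]` of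
`(F, G) ↦ ∑ᵣ ℏʳ Cᵣ(F, G)`. -/
def seriesMul {𝓕 : Subalgebra 𝕜 (E → 𝕜)} (C : ℕ → 𝓕 →ₗ[𝕜] 𝓕 →ₗ[𝕜] 𝓕) (F G : 𝓕⟦X⟧) : 𝓕⟦X⟧ :=
  PowerSeries.mk fun n =>
    ∑ p ∈ Finset.HasAntidiagonal.antidiagonal n, ∑ q ∈ Finset.HasAntidiagonal.antidiagonal p.2,
      C p.1 (PowerSeries.coeff q.1 F) (PowerSeries.coeff q.2 G)

/-- The `𝕜[[ℏ]]`-linear (`ℏ`-adically continuous) extension to `𝓕[[ℏ]]` of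
`F ↦ ∑ᵣ ℏʳ Tᵣ(F)`. -/
def seriesMap {𝓕 : Subalgebra 𝕜 (E → 𝕜)} (T : ℕ → 𝓕 →ₗ[𝕜] 𝓕) (F : 𝓕⟦X⟧) : 𝓕⟦X⟧ :=
  PowerSeries.mk fun n =>
    ∑ p ∈ Finset.HasAntidiagonal.antidiagonal n, T p.1 (PowerSeries.coeff p.2 F)

/-- A star-product `F ⋆ G = ∑ᵣ ℏʳ Cᵣ(F, G)` on `(E, 𝓕, br)`, i.e. a deformation quantization
`(E, 𝓕[[ℏ]], ⋆)` of this Poisson space. -/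
structure StarProduct (𝓕 : Subalgebra 𝕜 (E → 𝕜)) (br : 𝓕 →ₗ[𝕜] 𝓕 →ₗ[𝕜] 𝓕) where
  C : ℕ → 𝓕 →ₗ[𝕜] 𝓕 →ₗ[𝕜] 𝓕
  zeroth : ∀ F G : 𝓕, C 0 F G = F * G
  first : ∀ F G : 𝓕, C 1 F G - C 1 G F = (2 : 𝕜) • br F G
  bidiff : ∀ r, 1 ≤ r → IsBidifferentialOp 𝓕 (C r)
  const : ∀ r, 1 ≤ r → ∀ F : 𝓕, C r F 1 = 0 ∧ C r 1 F = 0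
  assoc : ∀ F G K : 𝓕,
    seriesMul C (PowerSeries.C F) (seriesMul C (PowerSeries.C G) (PowerSeries.C K)) =
      seriesMul C (seriesMul C (PowerSeries.C F) (PowerSeries.C G)) (PowerSeries.C K)

/-- Equivalence of two deformation quantizations of the same Poisson space. -/
def StarProduct.Equivalent {𝓕 : Subalgebra 𝕜 (E → 𝕜)} {br : 𝓕 →ₗ[𝕜] 𝓕 →ₗ[𝕜] 𝓕}
    (s₁ s₂ : StarProduct 𝓕 br) : Prop :=
  ∃ T : ℕ → 𝓕 →ₗ[𝕜] 𝓕, T 0 = LinearMap.id ∧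
    (∀ r, 1 ≤ r → IsDifferentialOp 𝓕 (T r) ∧ T r 1 = 0) ∧
    ∀ F G : 𝓕,
      seriesMul s₁.C (seriesMap T (PowerSeries.C F)) (seriesMap T (PowerSeries.C G)) =
        seriesMap T (seriesMul s₂.C (PowerSeries.C F) (PowerSeries.C G))

/-! ### Square-summable families of functions that depend smoothly on the point -/

/-- The family `u` is square-summable at every point and defines a smooth map into `ℓ²(ι)`. -/
def IsL2Smooth {ι : Type*} (u : ι → E → 𝕜) : Prop :=
  ∃ Φ : E → lp (fun _ : ι => 𝕜) 2, ContDiff 𝕜 ∞ Φ ∧ ∀ w i, Φ w i = u i w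

theorem IsL2Smooth.add {ι : Type*} {u v : ι → E → 𝕜} (hu : IsL2Smooth u) (hv : IsL2Smooth v) :
    IsL2Smooth (fun i w => u i w + v i w) := by
  obtain ⟨Φ, h, h'⟩ := hu
  obtain ⟨Ψ, k, k'⟩ := hv
  exact ⟨fun w => Φ w + Ψ w, h.add k, fun w i => by simp [h', k']⟩

theorem isL2Smooth_zero {ι : Type*} : IsL2Smooth (fun (_ : ι) (_ : E) => (0 : 𝕜)) :=
  ⟨fun _ => 0, contDiff_const, fun w i => by simp⟩

theorem IsL2Smooth.comp_injective {ι κ : Type*} {u : ι → E → 𝕜} (hu : IsL2Smooth u)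
    {σ : κ → ι} (hσ : Function.Injective σ) : IsL2Smooth (fun k => u (σ k)) := by
  obtain ⟨Φ, h, h'⟩ := hu
  have hs : ∀ f : lp (fun _ : ι => 𝕜) 2, Summable fun i => ‖f i‖ ^ (2 : ENNReal).toReal :=
    fun f => (lp.memℓp f).summable (by norm_num)
  have mem : ∀ f : lp (fun _ : ι => 𝕜) 2, Memℓp (fun k => f (σ k)) 2 := fun f =>
    (memℓp_gen_iff (by norm_num)).2 ((hs f).comp_injective hσ)
  let L : lp (fun _ : ι => 𝕜) 2 →ₗ[𝕜] lp (fun _ : κ => 𝕜) 2 :=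
    { toFun := fun f => ⟨fun k => f (σ k), mem f⟩
      map_add' := fun f g => by ext k; rfl
      map_smul' := fun c f => by ext k; rfl }
  have hL : ∀ f, ‖L f‖ ≤ 1 * ‖f‖ := by
    intro f
    rw [one_mul, lp.norm_eq_tsum_rpow (by norm_num), lp.norm_eq_tsum_rpow (by norm_num)]
    refine Real.rpow_le_rpow (tsum_nonneg fun _ => by positivity) ?_ (by norm_num)
    exact (((hs f).comp_injective hσ).tsum_le_tsum_of_inj σ hσ (fun _ _ => by positivity)
      (fun _ => le_rfl) (hs f))
  refine ⟨fun w => L.mkContinuous 1 hL (Φ w), (L.mkContinuous 1 hL).contDiff.comp h, ?_⟩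
  intro w k
  exact h' w (σ k)

theorem summable_sq_lp {α : Type*} (f : lp (fun _ : α => 𝕜) 2) :
    Summable fun i => ‖f i‖ ^ 2 := by
  simpa using (lp.memℓp f).summable (by norm_num)

theorem norm_sq_lp {α : Type*} (f : lp (fun _ : α => 𝕜) 2) : ‖f‖ ^ 2 = ∑' i, ‖f i‖ ^ 2 := by
  simpa using lp.norm_rpow_eq_tsum (p := 2) (by norm_num) f

theorem IsL2Smooth.mul {ι κ : Type*} {u : ι → E → 𝕜} {v : κ → E → 𝕜} (hu : IsL2Smooth u)
    (hv : IsL2Smooth v) : IsL2Smooth (fun (p : ι × κ) w => u p.1 w * v p.2 w) := by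
  obtain ⟨Φ, h, h'⟩ := hu
  obtain ⟨Ψ, k, k'⟩ := hv
  have hsum : ∀ (f : lp (fun _ : ι => 𝕜) 2) (g : lp (fun _ : κ => 𝕜) 2),
      Summable fun p : ι × κ => ‖f p.1‖ ^ 2 * ‖g p.2‖ ^ 2 := fun f g =>
    (summable_sq_lp f).mul_of_nonneg (summable_sq_lp g) (fun _ => by positivity)
      (fun _ => by positivity)
  have mem : ∀ (f : lp (fun _ : ι => 𝕜) 2) (g : lp (fun _ : κ => 𝕜) 2),
      Memℓp (fun p : ι × κ => f p.1 * g p.2) 2 := fun f g =>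
    (memℓp_gen_iff (by norm_num)).2 (by simpa [mul_pow] using hsum f g)
  let B : lp (fun _ : ι => 𝕜) 2 →ₗ[𝕜] lp (fun _ : κ => 𝕜) 2 →ₗ[𝕜] lp (fun _ : ι × κ => 𝕜) 2 :=
    LinearMap.mk₂ 𝕜 (fun f g => ⟨fun p => f p.1 * g p.2, mem f g⟩)
      (fun f f' g => by ext p; exact add_mul _ _ _)
      (fun c f g => by ext p; exact mul_assoc _ _ _)
      (fun f g g' => by ext p; exact mul_add _ _ _)
      (fun c f g => by ext p; exact mul_left_comm _ _ _)
  have hB : ∀ f g, ‖B f g‖ ≤ 1 * ‖f‖ * ‖g‖ := by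
    intro f g
    rw [one_mul]
    refine le_of_sq_le_sq ?_ (by positivity)
    rw [mul_pow, norm_sq_lp, norm_sq_lp, norm_sq_lp,
      (summable_sq_lp f).tsum_mul_tsum (summable_sq_lp g) (hsum f g)]
    refine le_of_eq (tsum_congr fun p => ?_)
    change ‖f p.1 * g p.2‖ ^ 2 = _
    rw [norm_mul, mul_pow]
  refine ⟨fun w => B.mkContinuous₂ 1 hB (Φ w) (Ψ w),
    (B.mkContinuous₂ 1 hB).isBoundedBilinearMap.contDiff.comp (h.prodMk k), ?_⟩
  intro w p
  change Φ w p.1 * Ψ w p.2 = u p.1 w * v p.2 w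
  rw [h', k']

/-- The family of all partial derivatives of order `r` of `F` in the directions `f i`. -/
def partialDerivs {ι : Type*} (f : ι → E) (F : E → 𝕜) (r : ℕ) (I : Fin r → ι) (w : E) : 𝕜 :=
  iteratedFDeriv 𝕜 r F w (fun s => f (I s))

theorem contDiff_partialDerivs {ι : Type*} (f : ι → E) {F : E → 𝕜} (hF : ContDiff 𝕜 ∞ F)
    (r : ℕ) (I : Fin r → ι) : ContDiff 𝕜 ∞ (partialDerivs f F r I) := by
  have h : ContDiff 𝕜 ∞ (iteratedFDeriv 𝕜 r F) :=
    hF.iteratedFDeriv_right (m := ∞) (i := r) (mod_cast le_top)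
  exact (ContinuousMultilinearMap.apply 𝕜 (fun _ : Fin r => E) 𝕜
    (fun s => f (I s))).contDiff.comp h

theorem fderiv_partialDerivs {ι : Type*} (f : ι → E) {F : E → 𝕜} (hF : ContDiff 𝕜 ∞ F)
    (r : ℕ) (I : Fin r → ι) (i : ι) (w : E) :
    fderiv 𝕜 (partialDerivs f F r I) w (f i) = partialDerivs f F (r + 1) (Fin.cons i I) w := by
  have h : ContDiff 𝕜 ∞ (iteratedFDeriv 𝕜 r F) :=
    hF.iteratedFDeriv_right (m := ∞) (i := r) (mod_cast le_top)
  have hd : DifferentiableAt 𝕜 (iteratedFDeriv 𝕜 r F) w := h.differentiable (by simp) w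
  have := ((ContinuousMultilinearMap.apply 𝕜 (fun _ : Fin r => E) 𝕜
    (fun s => f (I s))).hasFDerivAt.comp w hd.hasFDerivAt).fderiv
  unfold partialDerivs
  rw [iteratedFDeriv_succ_apply_left]
  change fderiv 𝕜 ((ContinuousMultilinearMap.apply 𝕜 (fun _ : Fin r => E) 𝕜
    (fun s => f (I s))) ∘ iteratedFDeriv 𝕜 r F) w (f i) = _
  rw [this]
  change (fderiv 𝕜 (iteratedFDeriv 𝕜 r F) w (f i)) (fun s => f (I s)) = _
  congr 1

theorem partialDerivs_succ {ι : Type*} (f : ι → E) {F : E → 𝕜} (hF : ContDiff 𝕜 ∞ F)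
    (r : ℕ) (I : Fin (r + 1) → ι) (w : E) :
    partialDerivs f F (r + 1) I w =
      partialDerivs f (fun x => fderiv 𝕜 F x (f (I (Fin.last r)))) r (fun s => I s.castSucc) w := by
  have h : ContDiff 𝕜 ∞ (fderiv 𝕜 F) := hF.fderiv_right (m := ∞) (by simp)
  unfold partialDerivs
  rw [iteratedFDeriv_succ_apply_right]
  have := (ContinuousLinearMap.apply 𝕜 𝕜 (f (I (Fin.last r)))).iteratedFDeriv_comp_left
    (f := fderiv 𝕜 F) (x := w) (i := r) h.contDiffAt (mod_cast le_top)
  change _ = iteratedFDeriv 𝕜 r ((ContinuousLinearMap.apply 𝕜 𝕜 (f (I (Fin.last r)))) ∘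
    fderiv 𝕜 F) w _
  rw [this]
  rfl

theorem isL2Smooth_of_unique {ι : Type*} [Unique ι] {F : E → 𝕜} (hF : ContDiff 𝕜 ∞ F) :
    IsL2Smooth (fun (_ : ι) w => F w) := by
  classical
  refine ⟨fun w => F w • lp.single 2 (default : ι) (1 : 𝕜), hF.smul contDiff_const, ?_⟩
  intro w i
  rw [Unique.eq_default i]
  simp

theorem isL2Smooth_partialDerivs_mul_aux {ι : Type*} (f : ι → E) {F G : E → 𝕜}
    (hF : ContDiff 𝕜 ∞ F) (hG : ContDiff 𝕜 ∞ G)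
    (hF' : ∀ r, IsL2Smooth (partialDerivs f F r))
    (hG' : ∀ r, IsL2Smooth (partialDerivs f G r)) (r : ℕ) : ∀ p q : ℕ,
    IsL2Smooth (fun (J : (Fin r → ι) × (Fin p → ι) × (Fin q → ι)) w =>
      partialDerivs f (fun x => partialDerivs f F p J.2.1 x * partialDerivs f G q J.2.2 x)
        r J.1 w) := by
  induction r with
  | zero =>
    intro p q
    have h := ((hF' p).mul (hG' q)).comp_injective
      (σ := fun J : (Fin 0 → ι) × (Fin p → ι) × (Fin q → ι) => J.2)
      (fun a b hab => Prod.ext (Subsingleton.elim _ _) hab)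
    simpa [partialDerivs] using h
  | succ r ih =>
    intro p q
    have h1 := (ih (p + 1) q).comp_injective
      (σ := fun J : (Fin (r + 1) → ι) × (Fin p → ι) × (Fin q → ι) =>
        (fun s => J.1 s.castSucc, Fin.cons (J.1 (Fin.last r)) J.2.1, J.2.2)) (by
        rintro ⟨I, K, L⟩ ⟨I', K', L'⟩ hab
        simp only [Prod.mk.injEq, Fin.cons_inj] at hab
        obtain ⟨h1, ⟨h2, h3⟩, h4⟩ := hab
        refine Prod.ext (funext fun s => ?_) (Prod.ext h3 h4)
        refine Fin.lastCases h2 (fun s => congrFun h1 s) s)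
    have h2 := (ih p (q + 1)).comp_injective
      (σ := fun J : (Fin (r + 1) → ι) × (Fin p → ι) × (Fin q → ι) =>
        (fun s => J.1 s.castSucc, J.2.1, Fin.cons (J.1 (Fin.last r)) J.2.2)) (by
        rintro ⟨I, K, L⟩ ⟨I', K', L'⟩ hab
        simp only [Prod.mk.injEq, Fin.cons_inj] at hab
        obtain ⟨h1, h4, ⟨h2, h3⟩⟩ := hab
        refine Prod.ext (funext fun s => ?_) (Prod.ext h4 h3)
        refine Fin.lastCases h2 (fun s => congrFun h1 s) s)
    refine cast (congrArg IsL2Smooth ?_) (h1.add h2)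
    funext J w
    have cF := contDiff_partialDerivs f hF
    have cG := contDiff_partialDerivs f hG
    rw [partialDerivs_succ f ((cF _ _).mul (cG _ _))]
    have e : (fun x => fderiv 𝕜 (fun x => partialDerivs f F p J.2.1 x *
        partialDerivs f G q J.2.2 x) x (f (J.1 (Fin.last r)))) =
        (fun x => partialDerivs f F (p + 1) (Fin.cons (J.1 (Fin.last r)) J.2.1) x *
          partialDerivs f G q J.2.2 x) +
        (fun x => partialDerivs f F p J.2.1 x *
          partialDerivs f G (q + 1) (Fin.cons (J.1 (Fin.last r)) J.2.2) x) := by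
      funext x
      have dF := (cF p J.2.1).differentiable (by simp) x
      have dG := (cG q J.2.2).differentiable (by simp) x
      rw [fderiv_fun_mul dF dG]
      simp only [Pi.add_apply, ← fderiv_partialDerivs f hF, ← fderiv_partialDerivs f hG]
      simp only [add_apply, smul_apply, smul_eq_mul]
      ring
    rw [e]
    unfold partialDerivs
    rw [iteratedFDeriv_add_apply]
    · rfl
    · exact (((cF _ _).mul (cG _ _)).of_le (mod_cast le_top)).contDiffAt
    · exact (((cF _ _).mul (cG _ _)).of_le (mod_cast le_top)).contDiffAt

/-- Functions of Hilbert-Schmidt type with respect to a family `f` of directions: smooth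
functions whose partial derivatives of each order `r ≥ 1` in the directions `f i` are
square-summable at every point and depend smoothly on the point as elements of `ℓ²`, i.e. `DʳF` is
a smooth map into the Hilbert-Schmidt `r`-linear forms. -/
def hsFunctions {ι : Type*} (f : ι → E) : Subalgebra 𝕜 (E → 𝕜) where
  carrier := {F | ContDiff 𝕜 ∞ F ∧ ∀ r, 1 ≤ r → IsL2Smooth (partialDerivs f F r)}
  mul_mem' := by
    rintro F G ⟨hF, hF'⟩ ⟨hG, hG'⟩
    have key : ∀ F : E → 𝕜, ContDiff 𝕜 ∞ F → (∀ r, 1 ≤ r → IsL2Smooth (partialDerivs f F r)) →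
        ∀ r, IsL2Smooth (partialDerivs f F r) := by
      intro F hF h r
      rcases Nat.eq_zero_or_pos r with rfl | hr
      · exact cast (congrArg IsL2Smooth (by funext I w; simp [partialDerivs]))
          (isL2Smooth_of_unique (ι := Fin 0 → ι) hF)
      · exact h r hr
    refine ⟨hF.mul hG, fun r _ => ?_⟩
    have h := (isL2Smooth_partialDerivs_mul_aux f hF hG (key F hF hF') (key G hG hG') r 0 0)
    have h' := h.comp_injective (σ := fun I : Fin r → ι => (I, Fin.elim0, Fin.elim0))
      (fun a b hab => congrArg Prod.fst hab)
    exact cast (congrArg IsL2Smooth (by funext I w; simp [partialDerivs, Pi.mul_def])) h'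
  add_mem' := by
    rintro F G ⟨hF, hF'⟩ ⟨hG, hG'⟩
    refine ⟨hF.add hG, fun r hr => ?_⟩
    refine cast (congrArg IsL2Smooth ?_) ((hF' r hr).add (hG' r hr))
    funext I w
    unfold partialDerivs
    rw [iteratedFDeriv_add_apply (hF.of_le (mod_cast le_top)).contDiffAt
      (hG.of_le (mod_cast le_top)).contDiffAt]
    rfl
  algebraMap_mem' := by
    intro c
    refine ⟨contDiff_const, fun r hr => ?_⟩
    refine cast (congrArg IsL2Smooth ?_) (isL2Smooth_zero (E := E) (𝕜 := 𝕜) (ι := Fin r → ι))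
    funext I w
    have : iteratedFDeriv 𝕜 r (fun _ : E => c) = 0 := iteratedFDeriv_const_of_ne (by omega) c
    change _ = iteratedFDeriv 𝕜 r (fun _ : E => c) w _
    rw [this]
    rfl

end General

/-! ### The phase space `W = H ⊕ H*` -/

section PhaseSpace

variable {𝕜 H : Type*} [RCLike 𝕜] [NormedAddCommGroup H] [InnerProductSpace 𝕜 H]

/-- The phase space `H ⊕ H*`. The maximum norm that it carries here is equivalent to the Hilbert
norm, hence gives the same smooth functions and derivatives. -/
abbrev Phase (𝕜 H : Type*) [RCLike 𝕜] [NormedAddCommGroup H] [InnerProductSpace 𝕜 H] :=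
  H × StrongDual 𝕜 H

/-- The dual basis vector `eᵢ*`. -/
def dualVec (e : HilbertBasis ℕ 𝕜 H) (i : ℕ) : StrongDual 𝕜 H := innerSL 𝕜 (e i)

/-- The basis of `H ⊕ H*` consisting of all `(eᵢ, 0)` and all `(0, eᵢ*)`. -/
def phaseBasis (e : HilbertBasis ℕ 𝕜 H) : ℕ ⊕ ℕ → Phase 𝕜 H :=
  Sum.elim (fun i => (e i, 0)) (fun i => (0, dualVec e i))

/-- The algebra of functions of Hilbert-Schmidt type on `H ⊕ H*`. -/
def FHS (e : HilbertBasis ℕ 𝕜 H) : Subalgebra 𝕜 (Phase 𝕜 H → 𝕜) :=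
  hsFunctions (phaseBasis e)

/-- The partial derivative `D₁F(x, η) ∈ H*`. -/
def D₁ (F : Phase 𝕜 H → 𝕜) (w : Phase 𝕜 H) : StrongDual 𝕜 H :=
  (fderiv 𝕜 F w).comp (ContinuousLinearMap.inl 𝕜 H (StrongDual 𝕜 H))

/-- Every bounded linear form on `H*` is the evaluation at a vector of `H`. -/
theorem exists_eval_eq [CompleteSpace H] (φ : StrongDual 𝕜 (StrongDual 𝕜 H)) :
    ∃ y : H, ∀ ξ : StrongDual 𝕜 H, ξ y = φ ξ := by
  let ψ : StrongDual 𝕜 H := LinearMap.mkContinuous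
    { toFun := fun z => starRingEnd 𝕜 (φ (innerSL 𝕜 z))
      map_add' := fun a b => by simp
      map_smul' := fun c a => by simp } ‖φ‖ (fun z => by
        have h := φ.le_opNorm (innerSL 𝕜 z)
        simpa using h)
  refine ⟨(InnerProductSpace.toDual 𝕜 H).symm ψ, fun ξ => ?_⟩
  obtain ⟨z, rfl⟩ := (InnerProductSpace.toDual 𝕜 H).surjective ξ
  rw [InnerProductSpace.toDual_apply_apply, ← inner_conj_symm,
    InnerProductSpace.toDual_symm_apply]
  exact RCLike.conj_conj _

/-- The identification of `H**` with `H`. -/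
def bidual [CompleteSpace H] (φ : StrongDual 𝕜 (StrongDual 𝕜 H)) : H :=
  (exists_eval_eq φ).choose

/-- The partial derivative `D₂F(x, η)`, as an element of `H`. -/
def D₂ [CompleteSpace H] (F : Phase 𝕜 H → 𝕜) (w : Phase 𝕜 H) : H :=
  bidual ((fderiv 𝕜 F w).comp (ContinuousLinearMap.inr 𝕜 H (StrongDual 𝕜 H)))

/-- The canonical Poisson bracket `⟨D₁F, D₂G⟩ - ⟨D₁G, D₂F⟩`. -/
def canonicalBracket [CompleteSpace H] (F G : Phase 𝕜 H → 𝕜) (w : Phase 𝕜 H) : 𝕜 :=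
  D₁ F w (D₂ G w) - D₁ G w (D₂ F w)

/-- `E_A(F, G) = ⟨D₁F, A D₂G⟩ + ⟨D₁G, A D₂F⟩`. -/
def cocycleE [CompleteSpace H] (A : H →L[𝕜] H) (F G : Phase 𝕜 H → 𝕜) (w : Phase 𝕜 H) : 𝕜 :=
  D₁ F w (A (D₂ G w)) + D₁ G w (A (D₂ F w))

/-- The bidifferential operator `C₁ᴬ(F, G) = ⟨D₁F, (A + 1) D₂G⟩ + ⟨D₁G, (A - 1) D₂F⟩` with constant
coefficients is `∑ₖ DF(uₖ) DG(vₖ)`, where `k = (true, j)` gives `uₖ = ((A + 1)eⱼ, 0)`,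
`vₖ = (0, eⱼ*)` and `k = (false, j)` gives `uₖ = (0, eⱼ*)`, `vₖ = ((A - 1)eⱼ, 0)`. This is `uₖ`. -/
def leftVec (e : HilbertBasis ℕ 𝕜 H) (A : H →L[𝕜] H) : Bool × ℕ → Phase 𝕜 H
  | (true, j) => ((A + 1) (e j), 0)
  | (false, j) => (0, dualVec e j)

/-- The vector `vₖ` in `C₁ᴬ(F, G) = ∑ₖ DF(uₖ) DG(vₖ)`. -/
def rightVec (e : HilbertBasis ℕ 𝕜 H) (A : H →L[𝕜] H) : Bool × ℕ → Phase 𝕜 H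
  | (true, j) => (0, dualVec e j)
  | (false, j) => ((A - 1) (e j), 0)

/-- The terms of the `r`-th power of the bidifferential operator `C₁ᴬ`:
`Cᵣᴬ(F, G)(w) = ∑ DʳF(w).(uₖ₁, …, uₖᵣ) DʳG(w).(vₖ₁, …, vₖᵣ)`, the sum being over all
`k₁, …, kᵣ`. -/
def powerTerm (e : HilbertBasis ℕ 𝕜 H) (A : H →L[𝕜] H) (r : ℕ) (F G : Phase 𝕜 H → 𝕜)
    (w : Phase 𝕜 H) (K : Fin r → Bool × ℕ) : 𝕜 :=
  iteratedFDeriv 𝕜 r F w (fun s => leftVec e A (K s)) *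
    iteratedFDeriv 𝕜 r G w (fun s => rightVec e A (K s))

/-- The star-product `s` is `⋆ᴬ`, the exponential `FG + ∑_{r ≥ 1} (ℏʳ / r!) Cᵣᴬ(F, G)` of
`ℏ C₁ᴬ = ℏ ({·,·} + E_A)`. -/
def IsExponential [CompleteSpace H] (e : HilbertBasis ℕ 𝕜 H) (A : H →L[𝕜] H)
    {br : FHS e →ₗ[𝕜] FHS e →ₗ[𝕜] FHS e} (s : StarProduct (FHS e) br) : Prop :=
  (∀ (F G : FHS e) (w : Phase 𝕜 H), (s.C 1 F G : Phase 𝕜 H → 𝕜) w =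
    canonicalBracket (F : Phase 𝕜 H → 𝕜) G w + cocycleE A (F : Phase 𝕜 H → 𝕜) G w) ∧
  ∀ (r : ℕ) (F G : FHS e) (w : Phase 𝕜 H),
    HasSum (powerTerm e A r F G w) ((r.factorial : 𝕜) * (s.C r F G : Phase 𝕜 H → 𝕜) w)

/-- The Hilbert-Schmidt operators on `H`. -/
def hilbertSchmidt (e : HilbertBasis ℕ 𝕜 H) : Submodule 𝕜 (H →L[𝕜] H) where
  carrier := {A | Summable fun i => ‖A (e i)‖ ^ 2}
  zero_mem' := by simp [summable_zero]
  add_mem' := by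
    intro A B hA hB
    refine Summable.of_nonneg_of_le (fun _ => by positivity) (fun i => ?_)
      ((hA.add hB).mul_left 2)
    have h1 : ‖(A + B) (e i)‖ ≤ ‖A (e i)‖ + ‖B (e i)‖ := norm_add_le _ _
    nlinarith [sq_nonneg (‖A (e i)‖ - ‖B (e i)‖), norm_nonneg ((A + B) (e i))]
  smul_mem' := by
    intro c A hA
    simpa [norm_smul, mul_pow] using Summable.mul_left (‖c‖ ^ 2) hA

end PhaseSpace

end HilbertStar

end

/-!
The star-product `⋆ᴬ` is the exponential of a bidifferential operator `∑ₖ ∂_{uₖ} ⊗ ∂_{vₖ}` with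
constant coefficients. If the sum were finite, its associativity would be the usual formal
computation with commuting derivations (`IsDividedPower.assoc`), and if
`(A - B) eⱼ` were zero for almost all `j`, `exp (ℏ Δ)` with
`Δ = ∑ⱼ ∂_{((A - B) eⱼ, 0)} ∂_{(0, eⱼ*)}` would intertwine `⋆ᴮ` and `⋆ᴬ`
(`IsDividedPower.intertwine`). The analytic part of the proof is the passage from finite to
infinite sums.

To this end, a family of functions is said to be of Hilbert-Schmidt type (`IsHSFamily`) if it and
its iterated derivatives in the directions of the basis are smooth maps to `ℓ²`. This class is
closed under bounded operators on `ℓ²`, under contractions, under derivatives along Bessel families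
of vectors, and under divergences `∑ₖ ∂_{aₖ} uₖ` with `∑ ‖aₖ‖² < ∞`. Hence the coefficients of `⋆ᴬ`
preserve the algebra for every bounded `A`, because `(uₖ)` and `(vₖ)` are Bessel families, and `Δ`
does if `A - B` is Hilbert-Schmidt. All families may depend on a parameter in `ℕ∞` which truncates
the sums, continuously in the `ℓ²`-norm; an identity that holds for all finite truncations then
holds for the full sums (`expC_assoc`, `expT_intertwine`). The Jacobi identity is the alternating
sum of the associativity relation of order two for `⋆⁰`.

Conversely, the first-order part of an equivalence is a differential operator `T` with
`T(FG) - T(F)G - F T(G) = E_S(F, G)`, where `S = A - B`. For `ψⱼ = ⟨S eⱼ, x⟩` and `ηⱼ = ξ(eⱼ)`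
this gives `T(ψⱼ ηⱼ) = ‖S eⱼ‖²` at the common zeros of `ψⱼ` and `ηⱼ`. The quadratic form `τ ∑_{j ∈ J} ψⱼ ηⱼ`
has a Hessian of Hilbert-Schmidt norm of order `τ (∑_J ‖S eⱼ‖²)^{1/2}`, which can be small while
`τ ∑_J ‖S eⱼ‖²` is large if `S` is not Hilbert-Schmidt. A lacunary series of such forms, multiplied
by powers that localize its terms at points converging to zero, is then a function of Hilbert-Schmidt
type whose image under `T` is not continuous (`mem_hilbertSchmidt_of_coboundary`).
-/

open scoped ContDiff PowerSeries

noncomputable section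

namespace HilbertStar

/-! ### Bounded operators between spaces of square-summable families -/

section SquareSummable

variable {𝕜 : Type*} [RCLike 𝕜]

/-- The Hilbert space `ℓ²(κ)` of square-summable families. -/
abbrev L2 (𝕜 κ : Type*) [RCLike 𝕜] : Type _ := lp (fun _ : κ => 𝕜) 2

variable {κ ι lam mu : Type*}

theorem sum_sq_le_norm_sq (x : L2 𝕜 κ) (s : Finset κ) : ∑ k ∈ s, ‖x k‖ ^ 2 ≤ ‖x‖ ^ 2 := by
  rw [norm_sq_lp]
  exact (summable_sq_lp x).sum_le_tsum s fun _ _ => by positivity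

/-- The square-summable family with the given entries. -/
def l2Mk (a : κ → 𝕜) (h : Summable fun k => ‖a k‖ ^ 2) : L2 𝕜 κ :=
  ⟨a, (memℓp_gen_iff (by norm_num)).2 (by simpa using h)⟩

@[simp] theorem l2Mk_apply (a : κ → 𝕜) (h : Summable fun k => ‖a k‖ ^ 2) (k : κ) :
    l2Mk a h k = a k := rfl

/-- A linear map into families is a bounded operator into `ℓ²` as soon as the finite partial sums
of the squares are bounded. -/
theorem exists_clm_l2 {V : Type*} [NormedAddCommGroup V] [NormedSpace 𝕜 V] (T : V → κ → 𝕜)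
    (hadd : ∀ x y k, T (x + y) k = T x k + T y k) (hsmul : ∀ (c : 𝕜) x k, T (c • x) k = c * T x k)
    (C : ℝ) (hC : 0 ≤ C) (hT : ∀ x (s : Finset κ), ∑ k ∈ s, ‖T x k‖ ^ 2 ≤ (C * ‖x‖) ^ 2) :
    ∃ L : V →L[𝕜] L2 𝕜 κ, (∀ x k, L x k = T x k) ∧ ∀ x, ‖L x‖ ≤ C * ‖x‖ := by
  have hs : ∀ x, Summable fun k => ‖T x k‖ ^ 2 := fun x =>
    summable_of_sum_le (fun _ => by positivity) (hT x)
  let L : V →ₗ[𝕜] L2 𝕜 κ :=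
    { toFun := fun x => l2Mk (T x) (hs x)
      map_add' := fun x y => by ext k; exact hadd x y k
      map_smul' := fun c x => by ext k; exact hsmul c x k }
  have hL : ∀ x, ‖L x‖ ≤ C * ‖x‖ := fun x => by
    refine le_of_sq_le_sq ?_ (by positivity)
    rw [norm_sq_lp]
    exact (hs x).tsum_le_of_sum_le (hT x)
  exact ⟨L.mkContinuous C hL, fun x k => rfl, hL⟩

/-- Restriction of a square-summable family along an injection. -/
theorem exists_reindex (σ : κ → ι) (hσ : Function.Injective σ) :
    ∃ L : L2 𝕜 ι →L[𝕜] L2 𝕜 κ, ∀ x k, L x k = x (σ k) := by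
  obtain ⟨L, h, -⟩ := exists_clm_l2 (𝕜 := 𝕜) (V := L2 𝕜 ι) (fun x k => x (σ k))
    (fun x y k => rfl) (fun c x k => rfl) 1 zero_le_one (fun x s => by
      classical
      rw [one_mul, ← Finset.sum_image (f := fun i => ‖x i‖ ^ 2) (fun a _ b _ h => hσ h)]
      exact sum_sq_le_norm_sq x _)
  exact ⟨L, h⟩

/-- The restriction operator along an injection. -/
def reindex (σ : κ → ι) (hσ : Function.Injective σ) : L2 𝕜 ι →L[𝕜] L2 𝕜 κ :=
  (exists_reindex σ hσ).choose

@[simp] theorem reindex_apply (σ : κ → ι) (hσ : Function.Injective σ) (x : L2 𝕜 ι) (k : κ) :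
    reindex σ hσ x k = x (σ k) := (exists_reindex σ hσ).choose_spec x k

/-- The slice `k ↦ x (k, l)`. -/
def colSlice (l : lam) : L2 𝕜 (κ × lam) →L[𝕜] L2 𝕜 κ :=
  reindex (fun k => (k, l)) (fun _ _ h => congrArg Prod.fst h)

/-- The slice `k ↦ x (l, k)`. -/
def rowSlice (l : lam) : L2 𝕜 (lam × κ) →L[𝕜] L2 𝕜 κ :=
  reindex (fun k => (l, k)) (fun _ _ h => congrArg Prod.snd h)

@[simp] theorem colSlice_apply (l : lam) (x : L2 𝕜 (κ × lam)) (k : κ) :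
    colSlice l x k = x (k, l) := reindex_apply _ _ x k

@[simp] theorem rowSlice_apply (l : lam) (x : L2 𝕜 (lam × κ)) (k : κ) :
    rowSlice l x k = x (l, k) := reindex_apply _ _ x k

theorem hasSum_rowSlice (x : L2 𝕜 (lam × κ)) : HasSum (fun l => ‖rowSlice l x‖ ^ 2) (‖x‖ ^ 2) := by
  have h := (summable_sq_lp x)
  have h1 : HasSum (fun p : lam × κ => ‖x p‖ ^ 2) (‖x‖ ^ 2) := by
    rw [norm_sq_lp]; exact h.hasSum
  refine h1.prod_fiberwise fun l => ?_
  rw [norm_sq_lp]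
  simpa using (summable_sq_lp (rowSlice l x)).hasSum

theorem hasSum_colSlice (x : L2 𝕜 (κ × lam)) : HasSum (fun l => ‖colSlice l x‖ ^ 2) (‖x‖ ^ 2) := by
  have h1 : HasSum (fun p : κ × lam => ‖x p‖ ^ 2) (‖x‖ ^ 2) := by
    rw [norm_sq_lp]; exact (summable_sq_lp x).hasSum
  have h2 := (Equiv.prodComm lam κ).hasSum_iff.2 h1
  refine h2.prod_fiberwise fun l => ?_
  rw [norm_sq_lp]
  simpa using (summable_sq_lp (colSlice l x)).hasSum

theorem sum_rowSlice_le (x : L2 𝕜 (lam × κ)) (s : Finset lam) :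
    ∑ l ∈ s, ‖rowSlice l x‖ ^ 2 ≤ ‖x‖ ^ 2 :=
  sum_le_hasSum s (fun _ _ => by positivity) (hasSum_rowSlice x)

theorem sum_colSlice_le (x : L2 𝕜 (κ × lam)) (s : Finset lam) :
    ∑ l ∈ s, ‖colSlice l x‖ ^ 2 ≤ ‖x‖ ^ 2 :=
  sum_le_hasSum s (fun _ _ => by positivity) (hasSum_colSlice x)

theorem sum_prod_le_of_nonneg {a : ι × κ → ℝ} (ha : ∀ p, 0 ≤ a p) (s : Finset (ι × κ)) :
    ∃ (t : Finset ι) (u : Finset κ), ∑ p ∈ s, a p ≤ ∑ i ∈ t, ∑ k ∈ u, a (i, k) := by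
  classical
  refine ⟨s.image Prod.fst, s.image Prod.snd, ?_⟩
  rw [← Finset.sum_product]
  exact Finset.sum_le_sum_of_subset_of_nonneg Finset.subset_product (fun p _ _ => ha p)

/-- The operator `1 ⊗ M` on `ℓ²(ι × κ)`. -/
theorem exists_rowMap (M : L2 𝕜 κ →L[𝕜] L2 𝕜 lam) :
    ∃ L : L2 𝕜 (ι × κ) →L[𝕜] L2 𝕜 (ι × lam), ∀ x i l, L x (i, l) = M (rowSlice i x) l := by
  let T : L2 𝕜 (ι × κ) → ι × lam → 𝕜 := fun x p => M (rowSlice p.1 x) p.2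
  have hadd : ∀ x y p, T (x + y) p = T x p + T y p := fun x y p => by
    simp only [T, map_add]; rfl
  have hsmul : ∀ (c : 𝕜) x p, T (c • x) p = c * T x p := fun c x p => by
    simp only [T, map_smul]; rfl
  have hT : ∀ x (s : Finset (ι × lam)), ∑ p ∈ s, ‖T x p‖ ^ 2 ≤ (‖M‖ * ‖x‖) ^ 2 := by
    intro x s
    obtain ⟨t, u, h⟩ := sum_prod_le_of_nonneg (a := fun p => ‖T x p‖ ^ 2) (fun p => sq_nonneg _) s
    refine h.trans ?_
    calc ∑ i ∈ t, ∑ l ∈ u, ‖T x (i, l)‖ ^ 2 ≤ ∑ i ∈ t, ‖M‖ ^ 2 * ‖rowSlice i x‖ ^ 2 := by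
          refine Finset.sum_le_sum fun i _ => (sum_sq_le_norm_sq (M (rowSlice i x)) u).trans ?_
          rw [← mul_pow]
          gcongr
          exact M.le_opNorm _
      _ ≤ (‖M‖ * ‖x‖) ^ 2 := by
          rw [← Finset.mul_sum, mul_pow]
          gcongr
          exact sum_rowSlice_le x t
  obtain ⟨L, h, -⟩ := exists_clm_l2 T hadd hsmul ‖M‖ (norm_nonneg _) hT
  exact ⟨L, fun x i l => h x (i, l)⟩

/-- The operator `M ⊗ 1` on `ℓ²(κ × ι)`. -/
theorem exists_colMap (M : L2 𝕜 κ →L[𝕜] L2 𝕜 lam) :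
    ∃ L : L2 𝕜 (κ × ι) →L[𝕜] L2 𝕜 (lam × ι), ∀ x i l, L x (l, i) = M (colSlice i x) l := by
  obtain ⟨L, h⟩ := exists_rowMap (ι := ι) M
  refine ⟨(reindex Prod.swap Prod.swap_injective).comp
    (L.comp (reindex Prod.swap Prod.swap_injective)), fun x i l => ?_⟩
  have e : rowSlice i (reindex Prod.swap Prod.swap_injective x) = colSlice i x :=
    lp.ext (funext fun k => by simp)
  calc _ = L (reindex Prod.swap Prod.swap_injective x) (i, l) :=
        reindex_apply Prod.swap Prod.swap_injective (L _) (l, i)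
    _ = _ := by rw [h, e]

theorem hasSum_pairing (x y : L2 𝕜 κ) : HasSum (fun k => x k * y k) (inner 𝕜 (star x) y) := by
  have h := lp.hasSum_inner (𝕜 := 𝕜) (star x) y
  convert h using 2 with k
  simp [RCLike.inner_apply, mul_comm]

theorem norm_tsum_mul_le (x y : L2 𝕜 κ) : ‖∑' k, x k * y k‖ ≤ ‖x‖ * ‖y‖ := by
  rw [(hasSum_pairing x y).tsum_eq]
  refine (norm_inner_le_norm _ _).trans ?_
  rw [norm_star]

/-- The contraction `(l, m) ↦ ∑ₖ x (k, l) y (k, m)`, which is the composition of Hilbert-Schmidt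
operators in terms of their matrices. -/
theorem exists_contraction (κ lam mu : Type*) :
    ∃ B : L2 𝕜 (κ × lam) →L[𝕜] L2 𝕜 (κ × mu) →L[𝕜] L2 𝕜 (lam × mu),
      ∀ x y l m, HasSum (fun k => x (k, l) * y (k, m)) (B x y (l, m)) := by
  have hp : ∀ (x : L2 𝕜 (κ × lam)) (y : L2 𝕜 (κ × mu)) l m,
      HasSum (fun k => x (k, l) * y (k, m)) (∑' k, x (k, l) * y (k, m)) := fun x y l m => by
    have h := (hasSum_pairing (colSlice l x) (colSlice m y)).summable.hasSum
    simpa only [colSlice_apply] using h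
  have key : ∀ x : L2 𝕜 (κ × lam), ∃ L : L2 𝕜 (κ × mu) →L[𝕜] L2 𝕜 (lam × mu),
      (∀ y p, L y p = ∑' k, x (k, p.1) * y (k, p.2)) ∧ ∀ y, ‖L y‖ ≤ ‖x‖ * ‖y‖ := fun x => by
    refine exists_clm_l2 (𝕜 := 𝕜) (V := L2 𝕜 (κ × mu))
      (fun y (p : lam × mu) => ∑' k, x (k, p.1) * y (k, p.2)) ?_ ?_ ‖x‖ (norm_nonneg _) ?_
    · intro y z p
      rw [← (hp x y p.1 p.2).summable.tsum_add (hp x z p.1 p.2).summable]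
      exact tsum_congr fun k => mul_add _ _ _
    · intro c y p
      rw [← tsum_mul_left]
      exact tsum_congr fun k => mul_left_comm _ _ _
    · intro y s
      obtain ⟨t, u, h⟩ := sum_prod_le_of_nonneg
        (a := fun p : lam × mu => ‖∑' k, x (k, p.1) * y (k, p.2)‖ ^ 2) (fun _ => by positivity) s
      refine h.trans ?_
      calc _ ≤ ∑ l ∈ t, ∑ m ∈ u, ‖colSlice l x‖ ^ 2 * ‖colSlice m y‖ ^ 2 := by
            refine Finset.sum_le_sum fun l _ => Finset.sum_le_sum fun m _ => ?_
            rw [← mul_pow]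
            gcongr
            simpa only [colSlice_apply] using norm_tsum_mul_le (colSlice l x) (colSlice m y)
        _ ≤ _ := by
            rw [← Finset.sum_mul_sum, mul_pow]
            gcongr
            · exact sum_colSlice_le x t
            · exact sum_colSlice_le y u
  choose L hL hL' using key
  let B : L2 𝕜 (κ × lam) →ₗ[𝕜] L2 𝕜 (κ × mu) →ₗ[𝕜] L2 𝕜 (lam × mu) :=
    LinearMap.mk₂ 𝕜 (fun x y => L x y)
      (fun x x' y => lp.ext (funext fun p => by
        change L (x + x') y p = L x y p + L x' y p
        simp only [hL]
        rw [← (hp x y p.1 p.2).summable.tsum_add (hp x' y p.1 p.2).summable]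
        exact tsum_congr fun k => add_mul _ _ _))
      (fun c x y => lp.ext (funext fun p => by
        change L (c • x) y p = c * L x y p
        simp only [hL]
        rw [← tsum_mul_left]
        exact tsum_congr fun k => mul_assoc _ _ _))
      (fun x y y' => map_add _ _ _)
      (fun c x y => map_smul _ _ _)
  refine ⟨B.mkContinuous₂ 1 (fun x y => by simpa [B] using hL' x y), fun x y l m => ?_⟩
  change HasSum _ (L x y (l, m))
  rw [hL]
  exact hp x y l m

/-- The diagonal operator with entries of modulus at most one. -/
theorem exists_weight (χ : κ → 𝕜) (hχ : ∀ k, ‖χ k‖ ≤ 1) :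
    ∃ L : L2 𝕜 κ →L[𝕜] L2 𝕜 κ, (∀ x k, L x k = χ k * x k) ∧ ∀ x, ‖L x‖ ≤ 1 * ‖x‖ := by
  refine exists_clm_l2 (V := L2 𝕜 κ) (fun x k => χ k * x k) (fun x y k => mul_add _ _ _)
    (fun c x k => mul_left_comm _ _ _) 1 zero_le_one (fun x s => ?_)
  rw [one_mul]
  refine (Finset.sum_le_sum fun k _ => ?_).trans (sum_sq_le_norm_sq x s)
  rw [norm_mul, mul_pow]
  exact mul_le_of_le_one_left (by positivity) (pow_le_one₀ (norm_nonneg _) (hχ k))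

/-- The diagonal operator with entries `χ k`. -/
def weight (χ : κ → 𝕜) (hχ : ∀ k, ‖χ k‖ ≤ 1) : L2 𝕜 κ →L[𝕜] L2 𝕜 κ :=
  (exists_weight χ hχ).choose

@[simp] theorem weight_apply (χ : κ → 𝕜) (hχ : ∀ k, ‖χ k‖ ≤ 1) (x : L2 𝕜 κ) (k : κ) :
    weight χ hχ x k = χ k * x k := (exists_weight χ hχ).choose_spec.1 x k

theorem norm_weight_le (χ : κ → 𝕜) (hχ : ∀ k, ‖χ k‖ ≤ 1) (x : L2 𝕜 κ) : ‖weight χ hχ x‖ ≤ ‖x‖ :=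
  ((exists_weight χ hχ).choose_spec.2 x).trans_eq (one_mul _)

/-- Diagonal operators are strongly continuous in their entries, by dominated convergence. -/
theorem continuous_weight {P : Type*} [TopologicalSpace P] (χ : P → κ → 𝕜)
    (hχ : ∀ p k, ‖χ p k‖ ≤ 1) (hc : ∀ k, Continuous fun p => χ p k) {Φ : P → L2 𝕜 κ}
    (hΦ : Continuous Φ) : Continuous fun p => weight (χ p) (hχ p) (Φ p) := by
  refine continuous_iff_continuousAt.2 fun q => tendsto_iff_norm_sub_tendsto_zero.2 ?_
  have h1 : Filter.Tendsto (fun p => ‖Φ p - Φ q‖) (nhds q) (nhds 0) :=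
    tendsto_iff_norm_sub_tendsto_zero.1 hΦ.continuousAt
  have h2 : Filter.Tendsto (fun p => ‖weight (χ p) (hχ p) (Φ q) - weight (χ q) (hχ q) (Φ q)‖ ^ 2)
      (nhds q) (nhds 0) := by
    have e : ∀ p, ‖weight (χ p) (hχ p) (Φ q) - weight (χ q) (hχ q) (Φ q)‖ ^ 2 =
        ∑' k, ‖(χ p k - χ q k) * Φ q k‖ ^ 2 := fun p => by
      rw [norm_sq_lp]
      refine tsum_congr fun k => ?_
      rw [lp.coeFn_sub, Pi.sub_apply, weight_apply, weight_apply, sub_mul]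
    simp only [e]
    have z : (0 : ℝ) = ∑' k : κ, 0 := tsum_zero.symm
    rw [z]
    refine tendsto_tsum_of_dominated_convergence (bound := fun k => 4 * ‖Φ q k‖ ^ 2)
      ((summable_sq_lp (Φ q)).mul_left 4) (fun k => ?_) (Filter.Eventually.of_forall fun p k => ?_)
    · have : Continuous fun p => ‖(χ p k - χ q k) * Φ q k‖ ^ 2 := by
        have := hc k
        fun_prop
      have := this.tendsto q
      simpa using this
    · rw [Real.norm_of_nonneg (by positivity), norm_mul, mul_pow]
      gcongr
      have := norm_sub_le (χ p k) (χ q k)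
      nlinarith [hχ p k, hχ q k, norm_nonneg (χ p k - χ q k)]
  have h3 := h2.sqrt
  simp only [Real.sqrt_sq (norm_nonneg _), Real.sqrt_zero] at h3
  have h4 := h1.add h3
  rw [add_zero] at h4
  refine squeeze_zero (fun _ => norm_nonneg _) (fun p => ?_) h4
  have e : weight (χ p) (hχ p) (Φ p) - weight (χ q) (hχ q) (Φ q) =
      weight (χ p) (hχ p) (Φ p - Φ q) +
        (weight (χ p) (hχ p) (Φ q) - weight (χ q) (hχ q) (Φ q)) := by
    rw [map_sub]; abel
  rw [e]
  exact (norm_add_le _ _).trans (add_le_add_left (norm_weight_le _ _ _) _)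

end SquareSummable

/-! ### Families of functions with square-summable derivatives of all orders -/

section Families

variable {𝕜 E : Type*} [RCLike 𝕜] [NormedAddCommGroup E] [NormedSpace 𝕜 E]
variable {P : Type*} [TopologicalSpace P] {ι κ lam mu : Type}

theorem fderiv_coord {Φ : E → L2 𝕜 κ} {w : E} (h : DifferentiableAt 𝕜 Φ w) (k : κ) (d : E) :
    fderiv 𝕜 (fun x => Φ x k) w d = fderiv 𝕜 Φ w d k := by
  have := ((lp.evalCLM 𝕜 (fun _ : κ => 𝕜) 2 k).hasFDerivAt.comp w h.hasFDerivAt).fderiv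
  exact congrArg (fun L => L d) this

/-- The family `u p` of functions on `E`, depending on a parameter `p`, is square-summable at every
point, is smooth as a map into `ℓ²(κ)`, and is at every point continuous in `p`. -/
def IsL2Family (u : P → κ → E → 𝕜) : Prop :=
  ∃ Φ : P → E → L2 𝕜 κ, (∀ p, ContDiff 𝕜 ∞ (Φ p)) ∧ (∀ w, Continuous fun p => Φ p w) ∧
    ∀ p w k, Φ p w k = u p k w

/-- The family of all derivatives of the members of `u` in the directions `f i`. -/
def derivFam (f : ι → E) (u : P → κ → E → 𝕜) : P → ι × κ → E → 𝕜 :=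
  fun p q w => fderiv 𝕜 (u p q.2) w (f q.1)

/-- The family `u` and the families of its derivatives up to order `r` in the directions `f i` are
square-summable, smooth, and pointwise continuous in the parameter. The parameter serves to pass to
the limit in truncated sums; without need of it, it ranges over a one-point space. -/
def IsHSFamily (f : ι → E) : ℕ → ∀ {κ : Type}, (P → κ → E → 𝕜) → Prop
  | 0, _, u => IsL2Family u
  | r + 1, _, u => IsL2Family u ∧ IsHSFamily f r (derivFam f u)

variable {f : ι → E} {u : P → κ → E → 𝕜} {r : ℕ}

theorem IsL2Family.contDiff (h : IsL2Family u) (p : P) (k : κ) : ContDiff 𝕜 ∞ (u p k) := by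
  obtain ⟨Φ, h1, -, h3⟩ := h
  have : u p k = fun w => lp.evalCLM 𝕜 (fun _ : κ => 𝕜) 2 k (Φ p w) :=
    funext fun w => (h3 p w k).symm
  rw [this]
  exact (lp.evalCLM 𝕜 (fun _ : κ => 𝕜) 2 k).contDiff.comp (h1 p)

theorem IsL2Family.continuous_param (h : IsL2Family u) (k : κ) (w : E) :
    Continuous fun p => u p k w := by
  obtain ⟨Φ, -, h2, h3⟩ := h
  simp only [← h3]
  exact (lp.evalCLM 𝕜 (fun _ : κ => 𝕜) 2 k).continuous.comp (h2 w)

theorem IsL2Family.exists_l2 (h : IsL2Family u) (p : P) (w : E) :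
    ∃ x : L2 𝕜 κ, ∀ k, x k = u p k w := by
  obtain ⟨Φ, -, -, h3⟩ := h
  exact ⟨Φ p w, h3 p w⟩

theorem IsHSFamily.isL2Family (h : IsHSFamily f r u) : IsL2Family u := by
  cases r with
  | zero => exact h
  | succ r => exact h.1

theorem IsHSFamily.derivFam (h : IsHSFamily f (r + 1) u) : IsHSFamily f r (derivFam f u) := h.2

theorem IsHSFamily.pred (h : IsHSFamily f (r + 1) u) : IsHSFamily f r u := by
  induction r generalizing κ with
  | zero => exact h.1
  | succ r ih => exact ⟨h.1, ih h.2⟩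

theorem IsHSFamily.congr {v : P → κ → E → 𝕜} (h : IsHSFamily f r u)
    (e : ∀ p k w, u p k w = v p k w) : IsHSFamily f r v := by
  have : u = v := by funext p k w; exact e p k w
  exact this ▸ h

/-- A bounded operator `M` from `ℓ²(κ)` to `ℓ²(lam)` maps families to families, because `1 ⊗ M` is
bounded and maps the derivatives to the derivatives. -/
theorem IsHSFamily.map (M : L2 𝕜 κ →L[𝕜] L2 𝕜 lam) {v : P → lam → E → 𝕜}
    (h : IsHSFamily f r u)
    (hv : ∀ p w (x : L2 𝕜 κ), (∀ k, x k = u p k w) → ∀ l, v p l w = M x l) :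
    IsHSFamily f r v := by
  have base : ∀ {κ lam : Type} (M : L2 𝕜 κ →L[𝕜] L2 𝕜 lam) {u : P → κ → E → 𝕜}
      {v : P → lam → E → 𝕜}, IsL2Family u →
      (∀ p w (x : L2 𝕜 κ), (∀ k, x k = u p k w) → ∀ l, v p l w = M x l) → IsL2Family v := by
    intro κ lam M u v ⟨Φ, h1, h2, h3⟩ hv
    exact ⟨fun p w => M (Φ p w), fun p => M.contDiff.comp (h1 p),
      fun w => M.continuous.comp (h2 w), fun p w l => (hv p w _ (h3 p w) l).symm⟩
  induction r generalizing κ lam with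
  | zero => exact base M h hv
  | succ r ih =>
    refine ⟨base M h.1 hv, ?_⟩
    obtain ⟨L, hL⟩ := exists_rowMap (ι := ι) M
    refine ih L h.2 fun p w x hx l => ?_
    obtain ⟨Φ, h1, h2, h3⟩ := h.1
    have e : v p l.2 = fun w => M (Φ p w) l.2 := funext fun w => hv p w _ (h3 p w) _
    have hd : DifferentiableAt 𝕜 (Φ p) w := (h1 p).differentiable (by simp) w
    have hd' : DifferentiableAt 𝕜 (fun w => M (Φ p w)) w := M.differentiableAt.comp w hd
    have e2 : fderiv 𝕜 (Φ p) w (f l.1) = rowSlice l.1 x := by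
      refine lp.ext (funext fun k => ?_)
      rw [← fderiv_coord hd, rowSlice_apply, hx]
      exact congrArg (fun g => fderiv 𝕜 g w (f l.1)) (funext fun w => h3 p w k)
    change fderiv 𝕜 (v p l.2) w (f l.1) = L x (l.1, l.2)
    rw [e, fderiv_coord hd', hL, ← e2]
    have := (M.hasFDerivAt.comp w hd.hasFDerivAt).fderiv
    change fderiv 𝕜 (M ∘ Φ p) w (f l.1) l.2 = _
    rw [this]
    rfl

theorem IsHSFamily.reindex (h : IsHSFamily f r u) {σ : lam → κ} (hσ : Function.Injective σ) :
    IsHSFamily f r (fun p l w => u p (σ l) w) :=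
  h.map (HilbertStar.reindex σ hσ) fun p w x hx l => by rw [reindex_apply, hx]

theorem IsHSFamily.add {v : P → κ → E → 𝕜} (hu : IsHSFamily f r u) (hv : IsHSFamily f r v) :
    IsHSFamily f r (fun p k w => u p k w + v p k w) := by
  have base : ∀ {κ : Type} {u v : P → κ → E → 𝕜}, IsL2Family u → IsL2Family v →
      IsL2Family (fun p k w => u p k w + v p k w) := by
    intro κ u v ⟨Φ, h1, h2, h3⟩ ⟨Ψ, k1, k2, k3⟩
    exact ⟨fun p w => Φ p w + Ψ p w, fun p => (h1 p).add (k1 p), fun w => (h2 w).add (k2 w),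
      fun p w k => by rw [lp.coeFn_add, Pi.add_apply, h3, k3]⟩
  induction r generalizing κ with
  | zero => exact base hu hv
  | succ r ih =>
    refine ⟨base hu.1 hv.1, (ih hu.2 hv.2).congr fun p q w => ?_⟩
    have d1 := (hu.1.contDiff p q.2).differentiable (by simp) w
    have d2 := (hv.1.contDiff p q.2).differentiable (by simp) w
    simp only [HilbertStar.derivFam]
    rw [fderiv_fun_add d1 d2]
    rfl

/-- Contractions `∑ₖ uₖₗ vₖₘ` of two families of Hilbert-Schmidt type are of this type again: by the
Leibniz rule, their derivatives are sums of such contractions. -/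
theorem IsHSFamily.contract {u : P → κ × lam → E → 𝕜} {v : P → κ × mu → E → 𝕜}
    (hu : IsHSFamily f r u) (hv : IsHSFamily f r v) :
    IsHSFamily f r (fun p (q : lam × mu) w => ∑' k, u p (k, q.1) w * v p (k, q.2) w) := by
  have base : ∀ {lam mu : Type} {u : P → κ × lam → E → 𝕜} {v : P → κ × mu → E → 𝕜},
      IsL2Family u → IsL2Family v →
      IsL2Family (fun p (q : lam × mu) w => ∑' k, u p (k, q.1) w * v p (k, q.2) w) := by
    intro lam mu u v ⟨Φ, h1, h2, h3⟩ ⟨Ψ, k1, k2, k3⟩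
    obtain ⟨B, hB⟩ := exists_contraction (𝕜 := 𝕜) κ lam mu
    refine ⟨fun p w => B (Φ p w) (Ψ p w), fun p => ?_, fun w => ?_, fun p w q => ?_⟩
    · exact B.isBoundedBilinearMap.contDiff.comp ((h1 p).prodMk (k1 p))
    · exact (B.continuous.comp (h2 w)).clm_apply (k2 w)
    · rw [← (hB (Φ p w) (Ψ p w) q.1 q.2).tsum_eq]
      exact tsum_congr fun k => by rw [h3, k3]
  induction r generalizing lam mu with
  | zero => exact base hu hv
  | succ r ih =>
    refine ⟨base hu.1 hv.1, ?_⟩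
    have a1 := ih
      (u := fun p (q : κ × (ι × lam)) w => HilbertStar.derivFam f u p (q.2.1, q.1, q.2.2) w)
      (hu.2.reindex (σ := fun q : κ × (ι × lam) => (q.2.1, q.1, q.2.2))
        (by rintro ⟨a, b, c⟩ ⟨a', b', c'⟩ h; simp_all)) hv.pred
    have a2 := ih
      (v := fun p (q : κ × (ι × mu)) w => HilbertStar.derivFam f v p (q.2.1, q.1, q.2.2) w)
      hu.pred (hv.2.reindex (σ := fun q : κ × (ι × mu) => (q.2.1, q.1, q.2.2))
        (by rintro ⟨a, b, c⟩ ⟨a', b', c'⟩ h; simp_all))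
    have b1 := a1.reindex (σ := fun q : ι × (lam × mu) => ((q.1, q.2.1), q.2.2))
      (by rintro ⟨a, b, c⟩ ⟨a', b', c'⟩ h; simp_all)
    have b2 := a2.reindex (σ := fun q : ι × (lam × mu) => (q.2.1, (q.1, q.2.2)))
      (by rintro ⟨a, b, c⟩ ⟨a', b', c'⟩ h; simp_all)
    refine (b1.add b2).congr fun p q w => ?_
    obtain ⟨i, l, m⟩ := q
    obtain ⟨Φ, h1, h2, h3⟩ := hu.1
    obtain ⟨Ψ, k1, k2, k3⟩ := hv.1
    obtain ⟨B, hB⟩ := exists_contraction (𝕜 := 𝕜) κ lam mu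
    have e : (fun w => ∑' k, u p (k, l) w * v p (k, m) w) =
        fun w => B (Φ p w) (Ψ p w) (l, m) := funext fun w => by
      rw [← (hB (Φ p w) (Ψ p w) l m).tsum_eq]
      exact tsum_congr fun k => by rw [h3, k3]
    have hd : DifferentiableAt 𝕜 (Φ p) w := (h1 p).differentiable (by simp) w
    have kd : DifferentiableAt 𝕜 (Ψ p) w := (k1 p).differentiable (by simp) w
    have D := B.hasFDerivAt_of_bilinear hd.hasFDerivAt kd.hasFDerivAt
    have hc : ∀ q, fderiv 𝕜 (Φ p) w (f i) q = fderiv 𝕜 (u p q) w (f i) := fun q => by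
      rw [← fderiv_coord hd]
      exact congrArg (fun g => fderiv 𝕜 g w (f i)) (funext fun w => h3 p w q)
    have kc : ∀ q, fderiv 𝕜 (Ψ p) w (f i) q = fderiv 𝕜 (v p q) w (f i) := fun q => by
      rw [← fderiv_coord kd]
      exact congrArg (fun g => fderiv 𝕜 g w (f i)) (funext fun w => k3 p w q)
    change _ = fderiv 𝕜 (fun w => ∑' k, u p (k, l) w * v p (k, m) w) w (f i)
    rw [e, fderiv_coord D.differentiableAt, D.fderiv]
    change _ = B (Φ p w) (fderiv 𝕜 (Ψ p) w (f i)) (l, m) + B (fderiv 𝕜 (Φ p) w (f i)) (Ψ p w) (l, m)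
    rw [← (hB _ _ l m).tsum_eq, ← (hB _ _ l m).tsum_eq, add_comm]
    congr 1
    · exact tsum_congr fun k => by rw [h3, kc]; rfl
    · exact tsum_congr fun k => by rw [k3, hc]; rfl

/-- Multiplication of the members of a family by constants of modulus at most one that depend
continuously on the parameter. -/
theorem IsHSFamily.weight {χ : P → κ → 𝕜} (hχ : ∀ p k, ‖χ p k‖ ≤ 1)
    (hc : ∀ k, Continuous fun p => χ p k) (h : IsHSFamily f r u) :
    IsHSFamily f r (fun p k w => χ p k * u p k w) := by
  have base : ∀ {κ : Type} {χ : P → κ → 𝕜} (_ : ∀ p k, ‖χ p k‖ ≤ 1)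
      (_ : ∀ k, Continuous fun p => χ p k) {u : P → κ → E → 𝕜}, IsL2Family u →
      IsL2Family (fun p k w => χ p k * u p k w) := by
    intro κ χ hχ hc u ⟨Φ, h1, h2, h3⟩
    exact ⟨fun p w => HilbertStar.weight (χ p) (hχ p) (Φ p w),
      fun p => (HilbertStar.weight (χ p) (hχ p)).contDiff.comp (h1 p),
      fun w => continuous_weight χ hχ hc (h2 w),
      fun p w k => by rw [weight_apply, h3]⟩
  induction r generalizing κ with
  | zero => exact base hχ hc h
  | succ r ih =>
    refine ⟨base hχ hc h.1, (ih (χ := fun p (q : ι × κ) => χ p q.2) (fun p q => hχ p q.2)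
      (fun q => hc q.2) h.2).congr fun p q w => ?_⟩
    have d := (h.1.contDiff p q.2).differentiable (by simp) w
    simp only [HilbertStar.derivFam]
    rw [fderiv_const_mul d]
    rfl

end Families

/-! ### Derivatives in other families of directions -/

section Directions

variable {𝕜 E : Type*} [RCLike 𝕜] [NormedAddCommGroup E] [NormedSpace 𝕜 E]
variable {P : Type*} [TopologicalSpace P] {ι κ lam mu : Type}

/-- A Bessel family of vectors: evaluation on it maps bounded linear forms boundedly to
square-summable families. -/
def IsBessel (𝕜 : Type*) {E : Type*} [RCLike 𝕜] [NormedAddCommGroup E] [NormedSpace 𝕜 E]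
    {κ : Type} (d : κ → E) : Prop :=
  ∃ N : (E →L[𝕜] 𝕜) →L[𝕜] L2 𝕜 κ, ∀ φ k, N φ k = φ (d k)

/-- Bounded linear forms can be recovered boundedly from their values on the family `f`. -/
def IsFrame (𝕜 : Type*) {E : Type*} [RCLike 𝕜] [NormedAddCommGroup E] [NormedSpace 𝕜 E]
    {ι : Type} (f : ι → E) : Prop :=
  ∃ R : L2 𝕜 ι →L[𝕜] (E →L[𝕜] 𝕜), ∀ (φ : E →L[𝕜] 𝕜) (c : L2 𝕜 ι), (∀ i, c i = φ (f i)) → R c = φ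

theorem isBessel_of_bound {d : κ → E} (C : ℝ) (hC : 0 ≤ C)
    (h : ∀ (φ : E →L[𝕜] 𝕜) (s : Finset κ), ∑ k ∈ s, ‖φ (d k)‖ ^ 2 ≤ (C * ‖φ‖) ^ 2) :
    IsBessel 𝕜 d := by
  obtain ⟨N, hN, -⟩ := exists_clm_l2 (𝕜 := 𝕜) (V := E →L[𝕜] 𝕜) (fun φ k => φ (d k))
    (fun _ _ _ => rfl) (fun _ _ _ => rfl) C hC h
  exact ⟨N, hN⟩

theorem IsBessel.weight {d : κ → E} (hd : IsBessel 𝕜 d) {χ : κ → 𝕜} (hχ : ∀ k, ‖χ k‖ ≤ 1) :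
    IsBessel 𝕜 (fun k => χ k • d k) := by
  obtain ⟨N, hN⟩ := hd
  exact ⟨(HilbertStar.weight χ hχ).comp N, fun φ k => by
    rw [ContinuousLinearMap.comp_apply, weight_apply, hN, map_smul, smul_eq_mul]⟩

theorem isBessel_const [Finite κ] (d : κ → E) : IsBessel 𝕜 d := by
  have := Fintype.ofFinite κ
  refine isBessel_of_bound (∑ k, ‖d k‖) (by positivity) fun φ s => ?_
  calc ∑ k ∈ s, ‖φ (d k)‖ ^ 2 ≤ ∑ k, ‖φ (d k)‖ ^ 2 :=
        Finset.sum_le_sum_of_subset_of_nonneg (Finset.subset_univ _) (fun _ _ _ => by positivity)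
    _ ≤ (∑ k, ‖φ (d k)‖) ^ 2 := Finset.sum_sq_le_sq_sum_of_nonneg (fun _ _ => norm_nonneg _)
    _ ≤ _ := by
        rw [Finset.sum_mul]
        gcongr with k
        rw [mul_comm]
        exact φ.le_opNorm _

variable {f : ι → E} {u : P → κ → E → 𝕜} {r : ℕ}

/-- The frame `f` may be replaced by any Bessel family `d`: the operator that maps the values of a
linear form on `f` to its values on `d` is bounded on `ℓ²`. -/
theorem IsHSFamily.dirDeriv (hf : IsFrame 𝕜 f) {d : lam → E} (hd : IsBessel 𝕜 d)
    (h : IsHSFamily f (r + 1) u) : IsHSFamily f r (HilbertStar.derivFam d u) := by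
  obtain ⟨R, hR⟩ := hf
  obtain ⟨N, hN⟩ := hd
  obtain ⟨L, hL⟩ := exists_colMap (ι := κ) (N.comp R)
  refine h.2.map L fun p w x hx l => ?_
  have e : R (colSlice l.2 x) = fderiv 𝕜 (u p l.2) w := hR _ _ fun i => by
    rw [colSlice_apply, hx]; rfl
  rw [show l = (l.1, l.2) from rfl, hL, ContinuousLinearMap.comp_apply, e, hN]
  rfl

/-- Iterating the derivatives in the directions `d` gives all partial derivatives of order `s`. -/
theorem isHSFamily_partialDerivs {d : lam → E}
    (hd : ∀ {κ : Type} (r : ℕ) (u : P → κ → E → 𝕜), IsHSFamily f (r + 1) u →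
      IsHSFamily f r (derivFam d u)) (s : ℕ) (h : IsHSFamily f (r + s) u) :
    IsHSFamily f r (fun p (q : (Fin s → lam) × κ) w => partialDerivs d (u p q.2) s q.1 w) := by
  induction s generalizing κ with
  | zero =>
    have := h.reindex (σ := fun q : (Fin 0 → lam) × κ => q.2)
      (fun a b hab => Prod.ext (Subsingleton.elim _ _) hab)
    exact this.congr fun p q w => by simp [partialDerivs]
  | succ s ih =>
    have := (ih (hd (r + s) u h)).reindex
      (σ := fun q : (Fin (s + 1) → lam) × κ =>
        (fun t => q.1 (Fin.castSucc t), (q.1 (Fin.last s), q.2)))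
      (by
        rintro ⟨I, k⟩ ⟨I', k'⟩ hab
        simp only [Prod.mk.injEq] at hab
        refine Prod.ext (funext fun t => ?_) hab.2.2
        exact Fin.lastCases hab.2.1 (fun t => congrFun hab.1 t) t)
    exact this.congr fun p q w => (partialDerivs_succ d (h.isL2Family.contDiff p q.2) s q.1 w).symm

/-- A family of vectors with square-summable norms, and a family `u` of functions: the sum over `k`
of the derivatives of `u k` in the direction `a k`. -/
theorem IsHSFamily.divergence (hf : IsFrame 𝕜 f) {a : κ → E} (ha : Summable fun k => ‖a k‖ ^ 2)
    (h : IsHSFamily f (r + 1) u) :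
    IsHSFamily f r (fun p (_ : Unit) w => ∑' k, fderiv 𝕜 (u p k) w (a k)) := by
  obtain ⟨R, hR⟩ := hf
  -- After normalization of the vectors, the derivatives form an `ℓ²`-family, which is then paired
  -- with the `ℓ²`-family of the norms.
  let a' : κ → E := fun k => ((‖a k‖⁻¹ : ℝ) : 𝕜) • a k
  have ha' : ∀ k, ‖a' k‖ ≤ 1 := fun k => by
    simp only [a', norm_smul, RCLike.norm_ofReal, abs_inv, abs_norm]
    exact inv_mul_le_one
  have haa : ∀ k, a k = ((‖a k‖ : ℝ) : 𝕜) • a' k := fun k => by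
    by_cases h0 : a k = 0
    · simp [h0]
    · have : ((‖a k‖ : ℝ) : 𝕜) ≠ 0 := by simpa using h0
      simp only [a', smul_smul, RCLike.ofReal_inv]
      rw [mul_inv_cancel₀ this, one_smul]
  obtain ⟨M, hM, -⟩ := exists_clm_l2 (𝕜 := 𝕜) (V := L2 𝕜 (ι × κ))
    (fun c k => R (colSlice k c) (a' k)) (fun c c' k => by rw [map_add, map_add]; rfl)
    (fun t c k => by rw [map_smul (colSlice k), map_smul R]; rfl) ‖R‖ (norm_nonneg R) (fun c s => by
      calc ∑ k ∈ s, ‖R (colSlice k c) (a' k)‖ ^ 2 ≤ ∑ k ∈ s, ‖R‖ ^ 2 * ‖colSlice k c‖ ^ 2 := by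
            refine Finset.sum_le_sum fun k _ => ?_
            rw [← mul_pow]
            gcongr
            calc _ ≤ ‖R (colSlice k c)‖ * ‖a' k‖ := (R (colSlice k c)).le_opNorm _
              _ ≤ ‖R (colSlice k c)‖ * 1 := by gcongr; exact ha' k
              _ ≤ _ := by rw [mul_one]; exact R.le_opNorm _
        _ ≤ _ := by
            rw [← Finset.mul_sum, mul_pow]
            gcongr
            exact sum_colSlice_le c s)
  have hM' : IsHSFamily f r (fun p (q : κ × Unit) w => fderiv 𝕜 (u p q.1) w (a' q.1)) := by
    refine (h.2.map M (v := fun p k w => fderiv 𝕜 (u p k) w (a' k)) fun p w x hx l => ?_).reindex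
      (σ := fun q : κ × Unit => q.1) (fun a b hab => Prod.ext hab rfl)
    rw [hM, hR (fderiv 𝕜 (u p l) w) _ fun i => by rw [colSlice_apply, hx]; rfl]
  obtain ⟨B, hB⟩ := exists_contraction (𝕜 := 𝕜) κ Unit Unit
  obtain ⟨ρ, hρ⟩ : ∃ ρ : L2 𝕜 (κ × Unit), ∀ q, ρ q = ((‖a q.1‖ : ℝ) : 𝕜) :=
    ⟨HilbertStar.reindex (fun q : κ × Unit => q.1) (fun a b hab => Prod.ext hab rfl)
      (l2Mk (fun k => ((‖a k‖ : ℝ) : 𝕜)) (by simpa using ha)), fun q => reindex_apply _ _ _ q⟩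
  refine (hM'.map (B ρ) (v := fun p q w => ∑' k, fderiv 𝕜 (u p k) w (a k))
    fun p w x hx l => ?_).reindex (σ := fun _ : Unit => ((), ())) (fun _ _ _ => rfl)
  refine ((tsum_congr fun k => ?_).trans (hB ρ x l.1 l.2).tsum_eq)
  rw [hx, hρ]
  rw [← smul_eq_mul, ← map_smul, ← haa]

end Directions

/-! ### Functions of Hilbert-Schmidt type -/

section Functions

variable {𝕜 E : Type*} [RCLike 𝕜] [NormedAddCommGroup E] [NormedSpace 𝕜 E]
variable {P : Type*} [TopologicalSpace P] {ι κ lam mu : Type} {f : ι → E}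

/-- A function of Hilbert-Schmidt type that depends on a parameter, all derivatives being
continuous in the parameter for the `ℓ²`-norm. -/
def IsHSFun (f : ι → E) (F : P → E → 𝕜) : Prop :=
  ∀ r, IsHSFamily f r (fun p (_ : Unit) => F p)

theorem IsHSFun.contDiff {F : P → E → 𝕜} (h : IsHSFun f F) (p : P) : ContDiff 𝕜 ∞ (F p) :=
  (h 0).isL2Family.contDiff p ()

theorem IsHSFun.continuous {F : P → E → 𝕜} (h : IsHSFun f F) (w : E) : Continuous fun p => F p w :=
  (h 0).isL2Family.continuous_param () w

/-- For functions that do not depend on the parameter, being of Hilbert-Schmidt type is membership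
in `hsFunctions f`: the recursive condition `IsHSFamily` unfolds to the one on partial derivatives.
-/
theorem isHSFun_of_mem {F : E → 𝕜} (hF : F ∈ hsFunctions (𝕜 := 𝕜) f) :
    IsHSFun f (fun _ : P => F) := by
  have key : ∀ (r : ℕ) {κ : Type} (u : κ → E → 𝕜), (∀ k, ContDiff 𝕜 ∞ (u k)) →
      (∀ s, IsL2Smooth (fun (q : (Fin s → ι) × κ) w => partialDerivs f (u q.2) s q.1 w)) →
      IsHSFamily f r (fun _ : P => u) := by
    intro r
    induction r with
    | zero =>
      intro κ u _ h
      obtain ⟨Φ, h1, h2⟩ := (h 0).comp_injective (σ := fun k : κ => (Fin.elim0, k))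
        (fun a b hab => congrArg Prod.snd hab)
      exact ⟨fun _ => Φ, fun _ => h1, fun _ => continuous_const,
        fun _ w k => by rw [h2]; simp [partialDerivs]⟩
    | succ r ih =>
      intro κ u hu h
      refine ⟨?_, ?_⟩
      · obtain ⟨Φ, h1, h2⟩ := (h 0).comp_injective (σ := fun k : κ => (Fin.elim0, k))
          (fun a b hab => congrArg Prod.snd hab)
        exact ⟨fun _ => Φ, fun _ => h1, fun _ => continuous_const,
          fun _ w k => by rw [h2]; simp [partialDerivs]⟩
      · refine ih (fun (q : ι × κ) w => fderiv 𝕜 (u q.2) w (f q.1)) (fun q => ?_) fun s => ?_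
        · exact ((hu q.2).fderiv_right (m := ∞) (by simp)).clm_apply contDiff_const
        · have := (h (s + 1)).comp_injective
            (σ := fun q : (Fin s → ι) × (ι × κ) =>
              (Fin.snoc (α := fun _ => ι) q.1 q.2.1, q.2.2)) (by
              rintro ⟨I, i, k⟩ ⟨I', i', k'⟩ hab
              simp only [Prod.mk.injEq, Fin.snoc_inj] at hab
              obtain ⟨⟨rfl, rfl⟩, rfl⟩ := hab
              rfl)
          refine cast (congrArg IsL2Smooth ?_) this
          funext q w
          rw [partialDerivs_succ f (hu _)]
          simp
  intro r
  refine key r (fun _ : Unit => F) (fun _ => hF.1) fun s => ?_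
  rcases Nat.eq_zero_or_pos s with rfl | hs
  · exact cast (congrArg IsL2Smooth (by funext q w; simp [partialDerivs]))
      ((isL2Smooth_of_unique (ι := Unit) hF.1).comp_injective
        (σ := fun _ : (Fin 0 → ι) × Unit => ()) (fun _ _ _ => Subsingleton.elim _ _))
  · exact (hF.2 s hs).comp_injective (σ := fun q : (Fin s → ι) × Unit => q.1)
      (fun a b hab => Prod.ext hab rfl)

theorem IsHSFun.mem {F : P → E → 𝕜} (h : IsHSFun f F) (p : P) : F p ∈ hsFunctions (𝕜 := 𝕜) f := by
  refine ⟨h.contDiff p, fun r _ => ?_⟩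
  have := isHSFamily_partialDerivs (f := f) (d := f) (r := 0) (fun r u hu => hu.derivFam) r
    (h (0 + r))
  obtain ⟨Φ, h1, -, h3⟩ := this.reindex (σ := fun I : Fin r → ι => (I, ()))
    (fun a b hab => congrArg Prod.fst hab)
  exact ⟨Φ p, h1 p, h3 p⟩

theorem IsHSFun.partialDerivs (hf : IsFrame 𝕜 f) {d : κ → E} (hd : IsBessel 𝕜 d)
    {F : P → E → 𝕜} (h : IsHSFun f F) (s r : ℕ) :
    IsHSFamily f r (fun p (K : Fin s → κ) w => partialDerivs d (F p) s K w) :=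
  (isHSFamily_partialDerivs (fun _ _ hu => hu.dirDeriv hf hd) s (h (r + s))).reindex
    (σ := fun I : Fin s → κ => (I, ())) (fun _ _ hab => congrArg Prod.fst hab)

theorem partialDerivs_smul (χ : κ → 𝕜) (d : κ → E) (F : E → 𝕜) (r : ℕ) (K : Fin r → κ) (w : E) :
    partialDerivs (fun k => χ k • d k) F r K w = (∏ s, χ (K s)) * partialDerivs d F r K w :=
  (iteratedFDeriv 𝕜 r F w).map_smul_univ (fun s => χ (K s)) (fun s => d (K s))

/-- The bilinear operator `∑_K D^rF(d_K) D^rG(d'_K)`, the `r`-th power of the bidifferential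
operator `∑ₖ DF(dₖ) DG(d'ₖ)` with constant coefficients. -/
def powerOp (d d' : κ → E) (r : ℕ) (F G : E → 𝕜) (w : E) : 𝕜 :=
  ∑' K : Fin r → κ, partialDerivs d F r K w * partialDerivs d' G r K w

theorem IsHSFun.powerOp (hf : IsFrame 𝕜 f) {d d' : κ → E} (hd : IsBessel 𝕜 d)
    (hd' : IsBessel 𝕜 d') {χ : P → κ → 𝕜} (hχ : ∀ p k, ‖χ p k‖ ≤ 1)
    (hc : ∀ k, Continuous fun p => χ p k) {F G : P → E → 𝕜} (hF : IsHSFun f F)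
    (hG : IsHSFun f G) (r : ℕ) :
    IsHSFun f (fun p => powerOp (fun k => χ p k • d k) d' r (F p) (G p)) := by
  intro s
  have h1 := (hF.partialDerivs hf hd r s).weight (χ := fun p K => ∏ t, χ p (K t))
    (fun p K => by
      rw [norm_prod]
      exact Finset.prod_le_one (fun _ _ => norm_nonneg _) (fun _ _ => hχ p _))
    (fun K => continuous_finsetProd _ fun t _ => hc _)
  have h1' := h1.reindex (σ := fun q : (Fin r → κ) × Unit => q.1) (fun a b hab => Prod.ext hab rfl)
  have h2 := (hG.partialDerivs hf hd' r s).reindex (σ := fun q : (Fin r → κ) × Unit => q.1)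
    (fun a b hab => Prod.ext hab rfl)
  refine ((h1'.contract h2).reindex (σ := fun _ : Unit => ((), ())) (fun _ _ _ => rfl)).congr
    fun p _ w => ?_
  exact tsum_congr fun K => by rw [partialDerivs_smul]

theorem hasSum_powerOp (hf : IsFrame 𝕜 f) {d d' : κ → E} (hd : IsBessel 𝕜 d)
    (hd' : IsBessel 𝕜 d') {F G : E → 𝕜} (hF : F ∈ hsFunctions (𝕜 := 𝕜) f)
    (hG : G ∈ hsFunctions (𝕜 := 𝕜) f) (r : ℕ) (w : E) :
    HasSum (fun K : Fin r → κ => partialDerivs d F r K w * partialDerivs d' G r K w)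
      (powerOp d d' r F G w) := by
  obtain ⟨x, hx⟩ := ((isHSFun_of_mem (P := Unit) hF).partialDerivs hf hd r
    0).isL2Family.exists_l2 () w
  obtain ⟨y, hy⟩ := ((isHSFun_of_mem (P := Unit) hG).partialDerivs hf hd' r
    0).isL2Family.exists_l2 () w
  have := (hasSum_pairing x y).summable.hasSum
  unfold powerOp
  simpa only [hx, hy] using this

/-- The differential operator `∑ₖ ∂_{aₖ} ∂_{bₖ}` of order two. -/
def secondOrderOp (a b : κ → E) (F : E → 𝕜) (w : E) : 𝕜 :=
  ∑' k, fderiv 𝕜 (fun x => fderiv 𝕜 F x (b k)) w (a k)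

theorem IsHSFun.secondOrderOp (hf : IsFrame 𝕜 f) {a b : κ → E} (ha : Summable fun k => ‖a k‖ ^ 2)
    (hb : IsBessel 𝕜 b) {χ : P → κ → 𝕜} (hχ : ∀ p k, ‖χ p k‖ ≤ 1)
    (hc : ∀ k, Continuous fun p => χ p k) {F : P → E → 𝕜} (hF : IsHSFun f F) :
    IsHSFun f (fun p => secondOrderOp a (fun k => χ p k • b k) (F p)) := by
  intro s
  have h1 := (((hF (s + 1 + 1)).dirDeriv hf hb).reindex (σ := fun k : κ => (k, ()))
    (fun _ _ hab => congrArg Prod.fst hab)).weight hχ hc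
  refine (h1.divergence hf ha).congr fun p _ w => tsum_congr fun k => ?_
  simp only [map_smul, derivFam, smul_eq_mul]

/-- The directional derivative of functions of Hilbert-Schmidt type. -/
theorem dirDeriv_mem (hf : IsFrame 𝕜 f) {F : E → 𝕜} (hF : F ∈ hsFunctions (𝕜 := 𝕜) f) (d : E) :
    (fun w => fderiv 𝕜 F w d) ∈ hsFunctions (𝕜 := 𝕜) f :=
  IsHSFun.mem (P := Unit) (F := fun _ w => fderiv 𝕜 F w d) (fun r =>
    ((isHSFun_of_mem (P := Unit) hF (r + 1)).dirDeriv hf (isBessel_const fun _ : Unit => d)).reindex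
      (σ := fun _ : Unit => ((), ())) (fun _ _ _ => rfl)) ()

end Functions

/-! ### Exponentials of bidifferential operators given by finitely many commuting derivations -/

section Algebra

open Finset Finset.HasAntidiagonal

variable {𝕜 : Type*} [Field 𝕜] [CharZero 𝕜]

theorem succ_smul_sum_antidiagonal {M : Type*} [AddCommGroup M] [Module 𝕜 M] (n : ℕ)
    (x : ℕ → ℕ → M) :
    ((n + 1 : ℕ) : 𝕜) • ∑ p ∈ antidiagonal (n + 1), x p.1 p.2 =
      ∑ p ∈ antidiagonal n, (((p.1 + 1 : ℕ) : 𝕜) • x (p.1 + 1) p.2 +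
        ((p.2 + 1 : ℕ) : 𝕜) • x p.1 (p.2 + 1)) := by
  have h : ((n + 1 : ℕ) : 𝕜) • ∑ p ∈ antidiagonal (n + 1), x p.1 p.2 =
      ∑ p ∈ antidiagonal (n + 1), (p.1 : 𝕜) • x p.1 p.2 +
        ∑ p ∈ antidiagonal (n + 1), (p.2 : 𝕜) • x p.1 p.2 := by
    rw [smul_sum, ← sum_add_distrib]
    refine sum_congr rfl fun p hp => ?_
    rw [← mem_antidiagonal.1 hp, Nat.cast_add, add_smul]
  rw [h, sum_add_distrib]
  congr 1
  · rw [Nat.sum_antidiagonal_succ]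
    simp
  · rw [Nat.sum_antidiagonal_succ']
    simp

theorem eq_of_succ_smul_eq {M : Type*} [AddCommGroup M] [Module 𝕜 M] {n : ℕ} {x y : M}
    (h : ((n + 1 : ℕ) : 𝕜) • x = ((n + 1 : ℕ) : 𝕜) • y) : x = y :=
  smul_right_injective M (Nat.cast_ne_zero.2 n.succ_ne_zero) h

variable {𝓐 κ J : Type*} [CommRing 𝓐] [Algebra 𝕜 𝓐] {c : ℕ → 𝓐 →ₗ[𝕜] 𝓐 →ₗ[𝕜] 𝓐}
  {s : Finset κ} {U V : κ → 𝓐 →ₗ[𝕜] 𝓐}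

/-- The operators `c r` are the divided powers of the bidifferential operator
`∑_{k ∈ s} Uₖ ⊗ Vₖ`. -/
structure IsDividedPower (c : ℕ → 𝓐 →ₗ[𝕜] 𝓐 →ₗ[𝕜] 𝓐) (s : Finset κ) (U V : κ → 𝓐 →ₗ[𝕜] 𝓐) :
    Prop where
  zero : ∀ F G, c 0 F G = F * G
  succ : ∀ r F G, ((r + 1 : ℕ) : 𝕜) • c (r + 1) F G = ∑ k ∈ s, c r (U k F) (V k G)

theorem IsDividedPower.leibniz (hc : IsDividedPower c s U V) {D : 𝓐 →ₗ[𝕜] 𝓐}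
    (hD : ∀ F G, D (F * G) = D F * G + F * D G) (hU : ∀ k F, D (U k F) = U k (D F))
    (hV : ∀ k F, D (V k F) = V k (D F)) (r : ℕ) (F G : 𝓐) :
    D (c r F G) = c r (D F) G + c r F (D G) := by
  induction r generalizing F G with
  | zero => simp only [hc.zero, hD]
  | succ r ih =>
    refine eq_of_succ_smul_eq (𝕜 := 𝕜) (n := r) ?_
    rw [← map_smul, hc.succ, map_sum, smul_add, hc.succ, hc.succ, ← sum_add_distrib]
    exact sum_congr rfl fun k _ => by rw [ih, hU, hV]

/-- The exponential of a bidifferential operator built from commuting derivations is associative. -/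
theorem IsDividedPower.assoc (hc : IsDividedPower c s U V)
    (hU : ∀ k F G, U k (F * G) = U k F * G + F * U k G)
    (hV : ∀ k F G, V k (F * G) = V k F * G + F * V k G)
    (hUU : ∀ k l F, U k (U l F) = U l (U k F)) (hVV : ∀ k l F, V k (V l F) = V l (V k F))
    (hUV : ∀ k l F, U k (V l F) = V l (U k F)) (n : ℕ) (F G K : 𝓐) :
    ∑ p ∈ antidiagonal n, c p.1 F (c p.2 G K) = ∑ p ∈ antidiagonal n, c p.1 (c p.2 F G) K := by
  induction n generalizing F G K with
  | zero => simp [hc.zero, mul_assoc]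
  | succ n ih =>
    -- Both sides satisfy the recursion `(n + 1) Xₙ₊₁(F, G, K) =
    -- ∑ₖ (Xₙ(UₖF, VₖG, K) + Xₙ(UₖF, G, VₖK) + Xₙ(F, UₖG, VₖK))`.
    refine eq_of_succ_smul_eq (𝕜 := 𝕜) (n := n) ?_
    rw [succ_smul_sum_antidiagonal n (fun a b => c a F (c b G K)),
      succ_smul_sum_antidiagonal n (fun a b => c a (c b F G) K)]
    have hL : ∀ p : ℕ × ℕ, ((p.1 + 1 : ℕ) : 𝕜) • c (p.1 + 1) F (c p.2 G K) +
        ((p.2 + 1 : ℕ) : 𝕜) • c p.1 F (c (p.2 + 1) G K) =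
        ∑ k ∈ s, (c p.1 (U k F) (c p.2 (V k G) K) + c p.1 (U k F) (c p.2 G (V k K)) +
          c p.1 F (c p.2 (U k G) (V k K))) := fun p => by
      rw [hc.succ, ← map_smul, hc.succ, map_sum, ← sum_add_distrib]
      refine sum_congr rfl fun k _ => ?_
      rw [hc.leibniz (hV k) (fun l F => (hUV l k F).symm) (hVV k), map_add]
    have hR : ∀ p : ℕ × ℕ, ((p.1 + 1 : ℕ) : 𝕜) • c (p.1 + 1) (c p.2 F G) K +
        ((p.2 + 1 : ℕ) : 𝕜) • c p.1 (c (p.2 + 1) F G) K =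
        ∑ k ∈ s, (c p.1 (c p.2 (U k F) (V k G)) K + c p.1 (c p.2 (U k F) G) (V k K) +
          c p.1 (c p.2 F (U k G)) (V k K)) := fun p => by
      rw [hc.succ, ← LinearMap.smul_apply, ← map_smul, hc.succ, map_sum, LinearMap.sum_apply,
        ← sum_add_distrib]
      refine sum_congr rfl fun k _ => ?_
      rw [hc.leibniz (hU k) (hUU k) (hUV k), map_add, LinearMap.add_apply]
      abel
    rw [sum_congr rfl fun p _ => hL p, sum_congr rfl fun p _ => hR p, sum_comm, sum_comm (t := s)]
    exact sum_congr rfl fun k _ => by simp only [sum_add_distrib, ih]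

/-- If the exponents of two star-products differ by the polarization of the second-order operator
`Δ = ∑ⱼ Aⱼ Bⱼ`, then `exp Δ` intertwines them. -/
theorem IsDividedPower.intertwine {c' : ℕ → 𝓐 →ₗ[𝕜] 𝓐 →ₗ[𝕜] 𝓐} {U' V' : κ → 𝓐 →ₗ[𝕜] 𝓐}
    {t : Finset J} {A B : J → 𝓐 →ₗ[𝕜] 𝓐} {Δ : 𝓐 →ₗ[𝕜] 𝓐} {T : ℕ → 𝓐 →ₗ[𝕜] 𝓐}
    (hc : IsDividedPower c s U V) (hc' : IsDividedPower c' s U' V')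
    (hΔ : ∀ F, Δ F = ∑ j ∈ t, A j (B j F))
    (hT0 : ∀ F, T 0 F = F) (hT : ∀ r F, ((r + 1 : ℕ) : 𝕜) • T (r + 1) F = T r (Δ F))
    (hU : ∀ k F, Δ (U k F) = U k (Δ F)) (hV : ∀ k F, Δ (V k F) = V k (Δ F))
    (hA : ∀ j F G, A j (F * G) = A j F * G + F * A j G)
    (hB : ∀ j F G, B j (F * G) = B j F * G + F * B j G)
    (hAU : ∀ j k F, A j (U' k F) = U' k (A j F)) (hAV : ∀ j k F, A j (V' k F) = V' k (A j F))
    (hBU : ∀ j k F, B j (U' k F) = U' k (B j F)) (hBV : ∀ j k F, B j (V' k F) = V' k (B j F))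
    (H : ∀ (L : 𝓐 →ₗ[𝕜] 𝓐 →ₗ[𝕜] 𝓐) F G, ∑ k ∈ s, L (U k F) (V k G) =
      ∑ k ∈ s, L (U' k F) (V' k G) + ∑ j ∈ t, (L (A j F) (B j G) + L (B j F) (A j G)))
    (n : ℕ) (F G : 𝓐) :
    ∑ p ∈ antidiagonal n, ∑ q ∈ antidiagonal p.2, c p.1 (T q.1 F) (T q.2 G) =
      ∑ p ∈ antidiagonal n, T p.1 (c' p.2 F G) := by
  have hTcomm : ∀ (D : 𝓐 →ₗ[𝕜] 𝓐), (∀ F, Δ (D F) = D (Δ F)) → ∀ r F, T r (D F) = D (T r F) := by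
    intro D hD r
    induction r with
    | zero => intro F; rw [hT0, hT0]
    | succ r ih =>
      intro F
      refine eq_of_succ_smul_eq (𝕜 := 𝕜) (n := r) ?_
      rw [hT, hD, ih, ← map_smul, hT]
  have hΔc : ∀ r F G, Δ (c' r F G) = c' r (Δ F) G + c' r F (Δ G) +
      ∑ j ∈ t, (c' r (A j F) (B j G) + c' r (B j F) (A j G)) := by
    intro r F G
    rw [hΔ, hΔ F, hΔ G]
    simp only [map_sum, LinearMap.sum_apply, ← sum_add_distrib]
    refine sum_congr rfl fun j _ => ?_
    rw [hc'.leibniz (hB j) (hBU j) (hBV j), map_add, hc'.leibniz (hA j) (hAU j) (hAV j),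
      hc'.leibniz (hA j) (hAU j) (hAV j)]
    abel
  induction n generalizing F G with
  | zero => simp [hc.zero, hc'.zero, hT0]
  | succ n ih =>
    -- Both sides satisfy the recursion
    -- `(n + 1) Xₙ₊₁(F, G) = Xₙ(ΔF, G) + Xₙ(F, ΔG) + ∑ₖ Xₙ(UₖF, VₖG)`.
    refine eq_of_succ_smul_eq (𝕜 := 𝕜) (n := n) ?_
    rw [succ_smul_sum_antidiagonal n
        (fun a b => ∑ q ∈ antidiagonal b, c a (T q.1 F) (T q.2 G)),
      succ_smul_sum_antidiagonal n (fun a b => T a (c' b F G))]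
    have hL : ∀ p : ℕ × ℕ,
        ((p.1 + 1 : ℕ) : 𝕜) • ∑ q ∈ antidiagonal p.2, c (p.1 + 1) (T q.1 F) (T q.2 G) +
        ((p.2 + 1 : ℕ) : 𝕜) • ∑ q ∈ antidiagonal (p.2 + 1), c p.1 (T q.1 F) (T q.2 G) =
        ∑ q ∈ antidiagonal p.2, c p.1 (T q.1 (Δ F)) (T q.2 G) +
        ∑ q ∈ antidiagonal p.2, c p.1 (T q.1 F) (T q.2 (Δ G)) +
        ∑ k ∈ s, ∑ q ∈ antidiagonal p.2, c p.1 (T q.1 (U k F)) (T q.2 (V k G)) := fun p => by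
      rw [succ_smul_sum_antidiagonal p.2 (fun a b => c p.1 (T a F) (T b G)), smul_sum, sum_comm,
        sum_congr rfl fun q _ => hc.succ p.1 (T q.1 F) (T q.2 G), ← sum_add_distrib,
        ← sum_add_distrib, ← sum_add_distrib]
      refine sum_congr rfl fun q _ => ?_
      rw [← LinearMap.smul_apply, ← map_smul, hT, ← map_smul, hT]
      simp only [hTcomm _ (hU _), hTcomm _ (hV _)]
      abel
    have hR : ∀ p : ℕ × ℕ, ((p.1 + 1 : ℕ) : 𝕜) • T (p.1 + 1) (c' p.2 F G) +
        ((p.2 + 1 : ℕ) : 𝕜) • T p.1 (c' (p.2 + 1) F G) =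
        T p.1 (c' p.2 (Δ F) G) + T p.1 (c' p.2 F (Δ G)) +
        ∑ k ∈ s, T p.1 (c' p.2 (U k F) (V k G)) := fun p => by
      have h := H ((c' p.2).compr₂ (T p.1)) F G
      simp only [LinearMap.compr₂_apply] at h
      rw [hT, hΔc, ← map_smul, hc'.succ, h]
      simp only [map_add, map_sum]
      abel
    rw [sum_congr rfl fun p _ => hL p, sum_congr rfl fun p _ => hR p]
    simp only [sum_add_distrib]
    rw [ih, ih, sum_comm (t := s), sum_comm (t := s)]
    congr 1
    exact sum_congr rfl fun k _ => ih _ _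

end Algebra

/-! ### Differential operators on functions of Hilbert-Schmidt type -/

section Operators

variable {𝕜 E : Type*} [RCLike 𝕜] [NormedAddCommGroup E] [NormedSpace 𝕜 E]
variable {P : Type*} [TopologicalSpace P] {ι κ : Type} {f : ι → E}

theorem differentiableAt_of_mem {F : E → 𝕜} (hF : F ∈ hsFunctions (𝕜 := 𝕜) f) (w : E) :
    DifferentiableAt 𝕜 F w := hF.1.differentiable (by simp) w

/-- The directional derivative as an operator on functions of Hilbert-Schmidt type. -/
def dirD (hf : IsFrame 𝕜 f) (d : E) : hsFunctions (𝕜 := 𝕜) f →ₗ[𝕜] hsFunctions (𝕜 := 𝕜) f where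
  toFun F := ⟨fun w => fderiv 𝕜 (F : E → 𝕜) w d, dirDeriv_mem hf F.2 d⟩
  map_add' F G := Subtype.ext <| funext fun w => by
    change fderiv 𝕜 ((F : E → 𝕜) + (G : E → 𝕜)) w d = _
    rw [fderiv_add (differentiableAt_of_mem F.2 w) (differentiableAt_of_mem G.2 w)]
    rfl
  map_smul' c F := Subtype.ext <| funext fun w => by
    change fderiv 𝕜 (c • (F : E → 𝕜)) w d = _
    rw [fderiv_const_smul (differentiableAt_of_mem F.2 w)]
    rfl

variable (hf : IsFrame 𝕜 f)

theorem dirD_mul (d : E) (F G : hsFunctions (𝕜 := 𝕜) f) :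
    dirD hf d (F * G) = dirD hf d F * G + F * dirD hf d G :=
  Subtype.ext <| funext fun w => by
    change fderiv 𝕜 ((F : E → 𝕜) * (G : E → 𝕜)) w d =
      fderiv 𝕜 (F : E → 𝕜) w d * (G : E → 𝕜) w + (F : E → 𝕜) w * fderiv 𝕜 (G : E → 𝕜) w d
    rw [fderiv_mul (differentiableAt_of_mem F.2 w) (differentiableAt_of_mem G.2 w)]
    simp only [add_apply, smul_apply, smul_eq_mul]
    ring

theorem dirD_dirD_apply (a b : E) (F : hsFunctions (𝕜 := 𝕜) f) (w : E) :
    (dirD hf a (dirD hf b F) : E → 𝕜) w = fderiv 𝕜 (fderiv 𝕜 (F : E → 𝕜)) w a b := by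
  have hd : DifferentiableAt 𝕜 (fderiv 𝕜 (F : E → 𝕜)) w :=
    (F.2.1.fderiv_right (m := ∞) (by simp)).differentiable (by simp) w
  have := ((ContinuousLinearMap.apply 𝕜 𝕜 b).hasFDerivAt.comp w hd.hasFDerivAt).fderiv
  exact congrArg (fun L => L a) this

theorem dirD_comm (a b : E) (F : hsFunctions (𝕜 := 𝕜) f) :
    dirD hf a (dirD hf b F) = dirD hf b (dirD hf a F) :=
  Subtype.ext <| funext fun w => by
    rw [dirD_dirD_apply, dirD_dirD_apply]
    have h : IsSymmSndFDerivAt 𝕜 (F : E → 𝕜) w :=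
      (F.2.1.contDiffAt (x := w)).isSymmSndFDerivAt (by
        rw [minSmoothness_of_isRCLikeNormedField]
        exact WithTop.coe_le_coe.2 (le_top : (2 : ℕ∞) ≤ ⊤))
    exact h.eq a b

theorem dirD_add (a b : E) (F : hsFunctions (𝕜 := 𝕜) f) :
    dirD hf (a + b) F = dirD hf a F + dirD hf b F :=
  Subtype.ext <| funext fun _ => map_add _ _ _

variable {d d' : κ → E}

theorem powerOp_mem (hf : IsFrame 𝕜 f) (hd : IsBessel 𝕜 d) (hd' : IsBessel 𝕜 d') {F G : E → 𝕜}
    (hF : F ∈ hsFunctions (𝕜 := 𝕜) f) (hG : G ∈ hsFunctions (𝕜 := 𝕜) f) (r : ℕ) :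
    powerOp d d' r F G ∈ hsFunctions (𝕜 := 𝕜) f := by
  have := ((isHSFun_of_mem (P := Unit) hF).powerOp hf hd hd' (χ := fun _ _ => 1)
    (fun _ _ => by simp) (fun _ => continuous_const) (isHSFun_of_mem hG) r).mem ()
  simpa using this

theorem partialDerivs_add {F G : E → 𝕜} (hF : ContDiff 𝕜 ∞ F) (hG : ContDiff 𝕜 ∞ G) (r : ℕ)
    (K : Fin r → κ) (w : E) :
    partialDerivs d (F + G) r K w = partialDerivs d F r K w + partialDerivs d G r K w := by
  unfold partialDerivs
  rw [iteratedFDeriv_add_apply (hF.of_le (mod_cast le_top)).contDiffAt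
      (hG.of_le (mod_cast le_top)).contDiffAt]
  rfl

theorem partialDerivs_const_smul (c : 𝕜) {F : E → 𝕜} (hF : ContDiff 𝕜 ∞ F) (r : ℕ)
    (K : Fin r → κ) (w : E) :
    partialDerivs d (c • F) r K w = c * partialDerivs d F r K w := by
  unfold partialDerivs
  rw [iteratedFDeriv_const_smul_apply (hF.of_le (mod_cast le_top)).contDiffAt]
  rfl

/-- The `r`-th power of a bidifferential operator with constant coefficients, as an operator on
functions of Hilbert-Schmidt type. -/
def powD (hd : IsBessel 𝕜 d) (hd' : IsBessel 𝕜 d') (r : ℕ) :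
    hsFunctions (𝕜 := 𝕜) f →ₗ[𝕜] hsFunctions (𝕜 := 𝕜) f →ₗ[𝕜] hsFunctions (𝕜 := 𝕜) f :=
  LinearMap.mk₂ 𝕜 (fun F G => ⟨powerOp d d' r F G, powerOp_mem hf hd hd' F.2 G.2 r⟩)
    (fun F F' G => Subtype.ext <| funext fun w => by
      change powerOp d d' r ((F : E → 𝕜) + (F' : E → 𝕜)) G w = powerOp d d' r F G w +
        powerOp d d' r F' G w
      unfold powerOp
      rw [← (hasSum_powerOp hf hd hd' F.2 G.2 r w).summable.tsum_add
        (hasSum_powerOp hf hd hd' F'.2 G.2 r w).summable]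
      exact tsum_congr fun K => by rw [partialDerivs_add F.2.1 F'.2.1, add_mul])
    (fun c F G => Subtype.ext <| funext fun w => by
      change powerOp d d' r (c • (F : E → 𝕜)) G w = c * powerOp d d' r F G w
      unfold powerOp
      rw [← tsum_mul_left]
      exact tsum_congr fun K => by rw [partialDerivs_const_smul c F.2.1, mul_assoc])
    (fun F G G' => Subtype.ext <| funext fun w => by
      change powerOp d d' r F ((G : E → 𝕜) + (G' : E → 𝕜)) w = powerOp d d' r F G w +
        powerOp d d' r F G' w
      unfold powerOp
      rw [← (hasSum_powerOp hf hd hd' F.2 G.2 r w).summable.tsum_add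
        (hasSum_powerOp hf hd hd' F.2 G'.2 r w).summable]
      exact tsum_congr fun K => by rw [partialDerivs_add G.2.1 G'.2.1, mul_add])
    (fun c F G => Subtype.ext <| funext fun w => by
      change powerOp d d' r F (c • (G : E → 𝕜)) w = c * powerOp d d' r F G w
      unfold powerOp
      rw [← tsum_mul_left]
      exact tsum_congr fun K => by rw [partialDerivs_const_smul c G.2.1, mul_left_comm])

theorem powD_apply (hd : IsBessel 𝕜 d) (hd' : IsBessel 𝕜 d') (r : ℕ)
    (F G : hsFunctions (𝕜 := 𝕜) f) : (powD hf hd hd' r F G : E → 𝕜) = powerOp d d' r F G := rfl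

theorem powD_zero (hd : IsBessel 𝕜 d) (hd' : IsBessel 𝕜 d') (F G : hsFunctions (𝕜 := 𝕜) f) :
    powD hf hd hd' 0 F G = F * G :=
  Subtype.ext <| funext fun w => by
    change powerOp d d' 0 F G w = (F : E → 𝕜) w * (G : E → 𝕜) w
    simp [powerOp, partialDerivs]

/-- The `(r + 1)`-st power as the sum of the `r`-th powers applied to the first derivatives. -/
theorem hasSum_powD_succ (hd : IsBessel 𝕜 d) (hd' : IsBessel 𝕜 d') (r : ℕ)
    (F G : hsFunctions (𝕜 := 𝕜) f) (w : E) :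
    HasSum (fun k => (powD hf hd hd' r (dirD hf (d k) F) (dirD hf (d' k) G) : E → 𝕜) w)
      ((powD hf hd hd' (r + 1) F G : E → 𝕜) w) := by
  have h := (Fin.snocEquiv fun _ : Fin (r + 1) => κ).hasSum_iff.2
    (hasSum_powerOp hf hd hd' F.2 G.2 (r + 1) w)
  refine h.prod_fiberwise fun k => ?_
  rw [powD_apply]
  have h2 := hasSum_powerOp hf hd hd' (dirD hf (d k) F).2 (dirD hf (d' k) G).2 r w
  convert h2 using 1
  funext K
  simp only [Function.comp_apply, Fin.snocEquiv, Equiv.coe_fn_mk]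
  rw [partialDerivs_succ d F.2.1, partialDerivs_succ d' G.2.1]
  simp only [Fin.snoc_last, Fin.snoc_castSucc]
  rfl

theorem secondOrderOp_mem (hf : IsFrame 𝕜 f) {a b : κ → E} (ha : Summable fun k => ‖a k‖ ^ 2)
    (hb : IsBessel 𝕜 b) {F : E → 𝕜} (hF : F ∈ hsFunctions (𝕜 := 𝕜) f) :
    secondOrderOp a b F ∈ hsFunctions (𝕜 := 𝕜) f := by
  have := ((isHSFun_of_mem (P := Unit) hF).secondOrderOp hf ha hb (χ := fun _ _ => 1)
    (fun _ _ => by simp) (fun _ => continuous_const)).mem ()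
  simpa using this

theorem summable_secondOrderOp {a b : κ → E} (ha : Summable fun k => ‖a k‖ ^ 2)
    (hb : IsBessel 𝕜 b) (F : hsFunctions (𝕜 := 𝕜) f) (w : E) :
    Summable fun k => (dirD hf (a k) (dirD hf (b k) F) : E → 𝕜) w := by
  have h := (((isHSFun_of_mem (P := Unit) F.2) 2).dirDeriv hf hb).reindex
    (σ := fun k : κ => (k, ())) (fun _ _ hab => congrArg Prod.fst hab)
  obtain ⟨c, hc⟩ := h.2.isL2Family.exists_l2 () w
  obtain ⟨R, hR⟩ := hf
  have e : ∀ k, R (colSlice k c) = fderiv 𝕜 (fun x => fderiv 𝕜 (F : E → 𝕜) x (b k)) w :=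
    fun k => hR _ _ fun i => by rw [colSlice_apply, hc]; rfl
  have hs : Summable fun k => ‖R‖ * (‖colSlice k c‖ ^ 2 + ‖a k‖ ^ 2) :=
    ((hasSum_colSlice c).summable.add ha).mul_left _
  refine Summable.of_norm_bounded hs fun k => ?_
  change ‖fderiv 𝕜 (fun x => fderiv 𝕜 (F : E → 𝕜) x (b k)) w (a k)‖ ≤ _
  rw [← e]
  calc _ ≤ ‖R (colSlice k c)‖ * ‖a k‖ := (R (colSlice k c)).le_opNorm _
    _ ≤ ‖R‖ * ‖colSlice k c‖ * ‖a k‖ := by gcongr; exact R.le_opNorm _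
    _ ≤ _ := by
      rw [mul_assoc]
      have := norm_nonneg R
      gcongr
      nlinarith [sq_nonneg (‖colSlice k c‖ - ‖a k‖), sq_nonneg ‖colSlice k c‖, sq_nonneg ‖a k‖]

/-- The operator `∑ₖ ∂_{aₖ} ∂_{bₖ}` on functions of Hilbert-Schmidt type; it exists when the `aₖ`
are square-summable. -/
def secD {a b : κ → E} (ha : Summable fun k => ‖a k‖ ^ 2) (hb : IsBessel 𝕜 b) :
    hsFunctions (𝕜 := 𝕜) f →ₗ[𝕜] hsFunctions (𝕜 := 𝕜) f where
  toFun F := ⟨secondOrderOp a b F, secondOrderOp_mem hf ha hb F.2⟩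
  map_add' F G := Subtype.ext <| funext fun w => by
    change ∑' k, (dirD hf (a k) (dirD hf (b k) (F + G)) : E → 𝕜) w =
      ∑' k, (dirD hf (a k) (dirD hf (b k) F) : E → 𝕜) w +
      ∑' k, (dirD hf (a k) (dirD hf (b k) G) : E → 𝕜) w
    rw [← (summable_secondOrderOp hf ha hb F w).tsum_add (summable_secondOrderOp hf ha hb G w)]
    exact tsum_congr fun k => by rw [map_add, map_add]; rfl
  map_smul' c F := Subtype.ext <| funext fun w => by
    change ∑' k, (dirD hf (a k) (dirD hf (b k) (c • F)) : E → 𝕜) w =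
      c * ∑' k, (dirD hf (a k) (dirD hf (b k) F) : E → 𝕜) w
    rw [← tsum_mul_left]
    exact tsum_congr fun k => by rw [map_smul, map_smul]; rfl

theorem secD_apply {a b : κ → E} (ha : Summable fun k => ‖a k‖ ^ 2) (hb : IsBessel 𝕜 b)
    (F : hsFunctions (𝕜 := 𝕜) f) (w : E) : (secD hf ha hb F : E → 𝕜) w =
      ∑' k, (dirD hf (a k) (dirD hf (b k) F) : E → 𝕜) w := rfl

/-! ### Dependence on the parameter -/

theorem IsHSFun.const_smul {F : P → E → 𝕜} (c : 𝕜) (hF : IsHSFun f F) :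
    IsHSFun f (fun p => c • F p) := fun r =>
  (hF r).map (c • ContinuousLinearMap.id 𝕜 (L2 𝕜 Unit)) fun p w x hx l => by
    change c * F p w = c * x l
    rw [hx]

theorem IsHSFun.dirD {F : P → hsFunctions (𝕜 := 𝕜) f} (hF : IsHSFun f (fun p => (F p : E → 𝕜)))
    (d : E) : IsHSFun f (fun p => (dirD hf d (F p) : E → 𝕜)) := fun r =>
  ((hF (r + 1)).dirDeriv hf (isBessel_const fun _ : Unit => d)).reindex
      (σ := fun _ : Unit => ((), ())) (fun _ _ _ => rfl)

end Operators

/-! ### Truncation of sums, and the passage to the limit -/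

section Truncation

variable {𝕜 E : Type*} [RCLike 𝕜] [NormedAddCommGroup E] [NormedSpace 𝕜 E]
variable {ι κ : Type} {f : ι → E}

/-- The indicator function of the indices `k` with `i k < p`. -/
def cut (𝕜 : Type*) [RCLike 𝕜] (i : κ → ℕ) (p : ℕ∞) (k : κ) : 𝕜 := if (i k : ℕ∞) < p then 1 else 0

theorem norm_cut_le (i : κ → ℕ) (p : ℕ∞) (k : κ) : ‖cut 𝕜 i p k‖ ≤ 1 := by
  unfold cut; split_ifs <;> simp

theorem cut_top (i : κ → ℕ) (k : κ) : cut 𝕜 i ⊤ k = 1 := by simp [cut]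

theorem continuous_cut (i : κ → ℕ) (k : κ) : Continuous fun p => cut 𝕜 i p k := by
  refine continuous_const.if (fun p hp => ?_) continuous_const
  have : IsClopen {p : ℕ∞ | (i k : ℕ∞) < p} := by
    refine ⟨?_, isOpen_Ioi⟩
    have e : {p : ℕ∞ | (i k : ℕ∞) < p} = Set.Ici ((i k + 1 : ℕ) : ℕ∞) := by
      ext p
      simp [ENat.add_one_le_iff]
    rw [e]
    exact isClosed_Ici
  rw [this.frontier_eq] at hp
  exact hp.elim

theorem eq_top_of_eq_natCast {X : Type*} [TopologicalSpace X] [T2Space X] {g h : ℕ∞ → X}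
    (hg : Continuous g) (hh : Continuous h) (e : ∀ n : ℕ, g n = h n) : g ⊤ = h ⊤ := by
  have h1 := (hg.tendsto ⊤).comp ENat.tendsto_natCast_nhds_top
  have h2 := (hh.tendsto ⊤).comp ENat.tendsto_natCast_nhds_top
  exact tendsto_nhds_unique h1 (h2.congr fun n => (e n).symm)

end Truncation

/-! ### Exponentials of bidifferential operators with constant coefficients -/

section Exponential

open Finset Finset.HasAntidiagonal

variable {𝕜 E : Type*} [RCLike 𝕜] [NormedAddCommGroup E] [NormedSpace 𝕜 E]
variable {P : Type*} [TopologicalSpace P] {ι κ J : Type} {f : ι → E} (hf : IsFrame 𝕜 f)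
variable {d d' : κ → E}

/-- The coefficient `C^r / r!` of the exponential of the bidifferential operator
`C = ∑ₖ DF(dₖ) DG(d'ₖ)`. -/
def expC (hd : IsBessel 𝕜 d) (hd' : IsBessel 𝕜 d') (r : ℕ) :
    hsFunctions (𝕜 := 𝕜) f →ₗ[𝕜] hsFunctions (𝕜 := 𝕜) f →ₗ[𝕜] hsFunctions (𝕜 := 𝕜) f :=
  (r.factorial : 𝕜)⁻¹ • powD hf hd hd' r

/-- The coefficient `Δ^r / r!` of the exponential of a linear operator. -/
def expT (Δ : hsFunctions (𝕜 := 𝕜) f →ₗ[𝕜] hsFunctions (𝕜 := 𝕜) f) (r : ℕ) :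
    hsFunctions (𝕜 := 𝕜) f →ₗ[𝕜] hsFunctions (𝕜 := 𝕜) f :=
  (r.factorial : 𝕜)⁻¹ • Δ ^ r

theorem expC_apply (hd : IsBessel 𝕜 d) (hd' : IsBessel 𝕜 d') (r : ℕ)
    (F G : hsFunctions (𝕜 := 𝕜) f) (w : E) : (expC hf hd hd' r F G : E → 𝕜) w =
      (r.factorial : 𝕜)⁻¹ * powerOp d d' r F G w := rfl

theorem succ_mul_inv_factorial (r : ℕ) :
    ((r + 1 : ℕ) : 𝕜) * ((r + 1).factorial : 𝕜)⁻¹ = (r.factorial : 𝕜)⁻¹ := by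
  rw [Nat.factorial_succ, Nat.cast_mul, mul_inv, ← mul_assoc,
    mul_inv_cancel₀ (Nat.cast_ne_zero.2 r.succ_ne_zero), one_mul]

theorem succ_smul_expT (Δ : hsFunctions (𝕜 := 𝕜) f →ₗ[𝕜] hsFunctions (𝕜 := 𝕜) f) (r : ℕ)
    (F : hsFunctions (𝕜 := 𝕜) f) : ((r + 1 : ℕ) : 𝕜) • expT Δ (r + 1) F = expT Δ r (Δ F) := by
  simp only [expT, LinearMap.smul_apply, smul_smul, succ_mul_inv_factorial, pow_succ]
  rfl

variable {i : κ → ℕ} {j : J → ℕ}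

/-- The truncated operators are divided powers of a finite sum of products of derivations. -/
theorem isDividedPower_cut (hd : IsBessel 𝕜 d) (hd' : IsBessel 𝕜 d')
    (hi : ∀ n, {k | i k < n}.Finite) (n : ℕ) :
    IsDividedPower (fun r => expC hf (hd.weight (norm_cut_le i n)) hd' r) (hi n).toFinset
      (fun k => dirD hf (d k)) (fun k => dirD hf (d' k)) where
  zero F G := by
    simp only [expC, LinearMap.smul_apply, powD_zero]
    simp
  succ r F G := by
    simp only [expC, LinearMap.smul_apply, smul_smul, succ_mul_inv_factorial]
    rw [← smul_sum]
    congr 1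
    refine Subtype.ext <| funext fun w => ?_
    have h := hasSum_powD_succ hf (hd.weight (norm_cut_le i n)) hd' r F G w
    have e : ∀ k, (powD hf (hd.weight (norm_cut_le i n)) hd' r (dirD hf (cut 𝕜 i n k • d k) F)
        (dirD hf (d' k) G) : E → 𝕜) w = cut 𝕜 i n k *
        (powD hf (hd.weight (norm_cut_le i n)) hd' r (dirD hf (d k) F)
        (dirD hf (d' k) G) : E → 𝕜) w := fun k => by
      have : dirD hf (cut 𝕜 i n k • d k) F = cut 𝕜 i n k • dirD hf (d k) F :=
        Subtype.ext <| funext fun w => map_smul _ _ _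
      rw [this, map_smul]
      rfl
    simp only [e] at h
    have h' : HasSum (fun k => cut 𝕜 i n k *
        (powD hf (hd.weight (norm_cut_le i n)) hd' r (dirD hf (d k) F)
        (dirD hf (d' k) G) : E → 𝕜) w) (∑ k ∈ (hi n).toFinset, cut 𝕜 i n k *
        (powD hf (hd.weight (norm_cut_le i n)) hd' r (dirD hf (d k) F)
        (dirD hf (d' k) G) : E → 𝕜) w) := hasSum_sum_of_ne_finset_zero fun k hk => by
          have : ¬ i k < n := by simpa using hk
          simp [cut, this]
    refine (h.unique h').trans ?_
    have ev : ∀ (s : Finset κ) (X : κ → hsFunctions (𝕜 := 𝕜) f),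
        ((∑ k ∈ s, X k : hsFunctions (𝕜 := 𝕜) f) : E → 𝕜) w = ∑ k ∈ s, (X k : E → 𝕜) w := by
      intro s X
      rw [AddSubmonoidClass.coe_finsetSum, Finset.sum_apply]
    rw [ev]
    refine sum_congr rfl fun k hk => ?_
    have : i k < n := by simpa using hk
    simp [cut, this]

theorem secD_cut {a b : J → E} (ha : Summable fun k => ‖a k‖ ^ 2) (hb : IsBessel 𝕜 b)
    (hj : ∀ n, {k | j k < n}.Finite) (n : ℕ) (F : hsFunctions (𝕜 := 𝕜) f) :
    secD hf ha (hb.weight (norm_cut_le j n)) F =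
      ∑ k ∈ (hj n).toFinset, dirD hf (a k) (dirD hf (b k) F) := by
  refine Subtype.ext <| funext fun w => ?_
  rw [secD_apply, AddSubmonoidClass.coe_finsetSum, Finset.sum_apply]
  have e : ∀ k, (dirD hf (a k) (dirD hf (cut 𝕜 j n k • b k) F) : E → 𝕜) w =
      cut 𝕜 j n k * (dirD hf (a k) (dirD hf (b k) F) : E → 𝕜) w := fun k => by
    have : dirD hf (cut 𝕜 j n k • b k) F = cut 𝕜 j n k • dirD hf (b k) F :=
      Subtype.ext <| funext fun w => map_smul _ _ _
    rw [this, map_smul]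
    rfl
  simp only [e]
  rw [tsum_eq_sum (s := (hj n).toFinset)]
  · refine sum_congr rfl fun k hk => ?_
    have : j k < n := by simpa using hk
    simp [cut, this]
  · intro k hk
    have : ¬ j k < n := by simpa using hk
    simp [cut, this]

theorem expC_cut_top (hd : IsBessel 𝕜 d) (hd' : IsBessel 𝕜 d') (r : ℕ) :
    expC hf (hd.weight (norm_cut_le i ⊤)) hd' r = expC hf hd hd' r := by
  refine LinearMap.ext₂ fun F G => Subtype.ext <| funext fun w => ?_
  simp only [expC_apply, cut_top, one_smul]

theorem secD_cut_top {a b : J → E} (ha : Summable fun k => ‖a k‖ ^ 2) (hb : IsBessel 𝕜 b) :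
    secD hf ha (hb.weight (norm_cut_le j ⊤)) = secD hf ha hb := by
  refine LinearMap.ext fun F => Subtype.ext <| funext fun w => ?_
  simp only [secD_apply, cut_top, one_smul]

theorem IsHSFun.expC_cut (hd : IsBessel 𝕜 d) (hd' : IsBessel 𝕜 d') (i : κ → ℕ)
    {X Y : ℕ∞ → hsFunctions (𝕜 := 𝕜) f} (hX : IsHSFun f (fun p => (X p : E → 𝕜)))
    (hY : IsHSFun f (fun p => (Y p : E → 𝕜))) (r : ℕ) :
    IsHSFun f (fun p => (expC hf (hd.weight (norm_cut_le i p)) hd' r (X p) (Y p) : E → 𝕜)) :=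
  (hX.powerOp hf hd hd' (norm_cut_le i) (continuous_cut i) hY r).const_smul _

theorem IsHSFun.secD_cut {a b : J → E} (ha : Summable fun k => ‖a k‖ ^ 2) (hb : IsBessel 𝕜 b)
    (j : J → ℕ) {X : ℕ∞ → hsFunctions (𝕜 := 𝕜) f} (hX : IsHSFun f (fun p => (X p : E → 𝕜))) :
    IsHSFun f (fun p => (secD hf ha (hb.weight (norm_cut_le j p)) (X p) : E → 𝕜)) :=
  hX.secondOrderOp hf ha hb (norm_cut_le j) (continuous_cut j)

theorem IsHSFun.expT_cut {a b : J → E} (ha : Summable fun k => ‖a k‖ ^ 2) (hb : IsBessel 𝕜 b)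
    (j : J → ℕ) {X : ℕ∞ → hsFunctions (𝕜 := 𝕜) f} (hX : IsHSFun f (fun p => (X p : E → 𝕜)))
    (r : ℕ) :
    IsHSFun f (fun p => (expT (secD hf ha (hb.weight (norm_cut_le j p))) r (X p) : E → 𝕜)) := by
  refine IsHSFun.const_smul (F := fun p =>
    (((secD hf ha (hb.weight (norm_cut_le j p))) ^ r) (X p) : E → 𝕜)) _ ?_
  induction r with
  | zero => exact hX
  | succ r ih =>
    simp only [pow_succ']
    exact ih.secD_cut hf ha hb j

theorem IsHSFun.const (F : hsFunctions (𝕜 := 𝕜) f) : IsHSFun f (fun _ : P => (F : E → 𝕜)) :=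
  isHSFun_of_mem F.2

/-- An identity between elements that depend continuously on a truncation parameter holds for the
untruncated operators if it holds for the truncated ones. -/
theorem eq_top_of_forall_natCast {X Y : ℕ∞ → hsFunctions (𝕜 := 𝕜) f}
    (hX : ∀ w, Continuous fun p => (X p : E → 𝕜) w) (hY : ∀ w, Continuous fun p => (Y p : E → 𝕜) w)
    (h : ∀ n : ℕ, X n = Y n) : X ⊤ = Y ⊤ :=
  Subtype.ext <| funext fun w => eq_top_of_eq_natCast (hX w) (hY w) fun n => by rw [h]

theorem continuous_coe_sum {s : Finset J} {X : J → ℕ∞ → hsFunctions (𝕜 := 𝕜) f} {w : E}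
    (h : ∀ j ∈ s, Continuous fun p => (X j p : E → 𝕜) w) :
    Continuous fun p => ((∑ j ∈ s, X j p : hsFunctions (𝕜 := 𝕜) f) : E → 𝕜) w := by
  simp only [AddSubmonoidClass.coe_finsetSum, Finset.sum_apply]
  exact continuous_finsetSum _ h

/-- Associativity of the exponential star-product, order by order. -/
theorem expC_assoc (hd : IsBessel 𝕜 d) (hd' : IsBessel 𝕜 d') (hi : ∀ n, {k | i k < n}.Finite)
    (n : ℕ) (F G K : hsFunctions (𝕜 := 𝕜) f) :
    ∑ p ∈ antidiagonal n, expC hf hd hd' p.1 F (expC hf hd hd' p.2 G K) =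
      ∑ p ∈ antidiagonal n, expC hf hd hd' p.1 (expC hf hd hd' p.2 F G) K := by
  let c : ℕ∞ → ℕ → _ := fun p r => expC hf (hd.weight (norm_cut_le i p)) hd' r
  have h := eq_top_of_forall_natCast
    (X := fun t => ∑ p ∈ antidiagonal n, c t p.1 F (c t p.2 G K))
    (Y := fun t => ∑ p ∈ antidiagonal n, c t p.1 (c t p.2 F G) K)
    (fun w => continuous_coe_sum fun p _ => IsHSFun.continuous
      ((IsHSFun.const F).expC_cut hf hd hd' i
        ((IsHSFun.const G).expC_cut hf hd hd' i (IsHSFun.const K) p.2) p.1) w)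
    (fun w => continuous_coe_sum fun p _ => IsHSFun.continuous
      (((IsHSFun.const F).expC_cut hf hd hd' i (IsHSFun.const G) p.2).expC_cut hf hd hd' i
        (IsHSFun.const K) p.1) w)
    (fun m => (isDividedPower_cut hf hd hd' hi m).assoc (fun k => dirD_mul hf (d k))
      (fun k => dirD_mul hf (d' k)) (fun k l => dirD_comm hf _ _) (fun k l => dirD_comm hf _ _)
      (fun k l => dirD_comm hf _ _) n F G K)
  simpa only [c, expC_cut_top hf hd hd'] using h

/-- The exponential of `Δ = ∑ⱼ ∂_{aⱼ} ∂_{bⱼ}` intertwines two exponential star-products whose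
exponents differ by the polarization of `Δ`. -/
theorem expT_intertwine {e e' : κ → E} {a b : J → E} (hd : IsBessel 𝕜 d) (hd' : IsBessel 𝕜 d')
    (he : IsBessel 𝕜 e) (he' : IsBessel 𝕜 e') (ha : Summable fun k => ‖a k‖ ^ 2)
    (hb : IsBessel 𝕜 b) (hi : ∀ n, {k | i k < n}.Finite) (hj : ∀ n, {k | j k < n}.Finite)
    (H : ∀ (m : ℕ) (L : hsFunctions (𝕜 := 𝕜) f →ₗ[𝕜] hsFunctions (𝕜 := 𝕜) f →ₗ[𝕜]
        hsFunctions (𝕜 := 𝕜) f) F G,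
      ∑ k ∈ (hi m).toFinset, L (dirD hf (d k) F) (dirD hf (d' k) G) =
      ∑ k ∈ (hi m).toFinset, L (dirD hf (e k) F) (dirD hf (e' k) G) +
      ∑ k ∈ (hj m).toFinset, (L (dirD hf (a k) F) (dirD hf (b k) G) +
        L (dirD hf (b k) F) (dirD hf (a k) G)))
    (n : ℕ) (F G : hsFunctions (𝕜 := 𝕜) f) :
    ∑ p ∈ antidiagonal n, ∑ q ∈ antidiagonal p.2,
        expC hf hd hd' p.1 (expT (secD hf ha hb) q.1 F) (expT (secD hf ha hb) q.2 G) =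
      ∑ p ∈ antidiagonal n, expT (secD hf ha hb) p.1 (expC hf he he' p.2 F G) := by
  let c : ℕ∞ → ℕ → _ := fun p r => expC hf (hd.weight (norm_cut_le i p)) hd' r
  let c' : ℕ∞ → ℕ → _ := fun p r => expC hf (he.weight (norm_cut_le i p)) he' r
  let T : ℕ∞ → ℕ → _ := fun p r => expT (secD hf ha (hb.weight (norm_cut_le j p))) r
  have h := eq_top_of_forall_natCast
    (X := fun t => ∑ p ∈ antidiagonal n, ∑ q ∈ antidiagonal p.2, c t p.1 (T t q.1 F) (T t q.2 G))
    (Y := fun t => ∑ p ∈ antidiagonal n, T t p.1 (c' t p.2 F G))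
    (fun w => continuous_coe_sum fun p _ => continuous_coe_sum fun q _ => IsHSFun.continuous
      (((IsHSFun.const F).expT_cut hf ha hb j q.1).expC_cut hf hd hd' i
        ((IsHSFun.const G).expT_cut hf ha hb j q.2) p.1) w)
    (fun w => continuous_coe_sum fun p _ => IsHSFun.continuous
      (((IsHSFun.const F).expC_cut hf he he' i (IsHSFun.const G) p.2).expT_cut hf ha hb j p.1) w)
    (fun m => by
      have hΔ := secD_cut hf ha hb hj m
      have hcomm : ∀ v F, secD hf ha (hb.weight (norm_cut_le j m)) (dirD hf v F) =
          dirD hf v (secD hf ha (hb.weight (norm_cut_le j m)) F) := fun v F => by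
        rw [hΔ, hΔ, map_sum]
        exact sum_congr rfl fun k _ => by
          rw [dirD_comm hf (b k) v, dirD_comm hf (a k) v]
      exact (isDividedPower_cut hf hd hd' hi m).intertwine (isDividedPower_cut hf he he' hi m) hΔ
        (fun F => by simp [expT]) (succ_smul_expT _) (fun k => hcomm _) (fun k => hcomm _)
        (fun k => dirD_mul hf (a k)) (fun k => dirD_mul hf (b k)) (fun k l => dirD_comm hf _ _)
        (fun k l => dirD_comm hf _ _) (fun k l => dirD_comm hf _ _) (fun k l => dirD_comm hf _ _)
        (H m) n F G)
  simpa only [c, c', T, expC_cut_top hf hd hd', expC_cut_top hf he he', secD_cut_top hf ha hb]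
    using h

theorem secD_dirD {a b : J → E} (ha : Summable fun k => ‖a k‖ ^ 2) (hb : IsBessel 𝕜 b)
    (hj : ∀ n, {k | j k < n}.Finite) (v : E) (F : hsFunctions (𝕜 := 𝕜) f) :
    secD hf ha hb (dirD hf v F) = dirD hf v (secD hf ha hb F) := by
  have h := eq_top_of_forall_natCast
    (X := fun t => secD hf ha (hb.weight (norm_cut_le j t)) (dirD hf v F))
    (Y := fun t => dirD hf v (secD hf ha (hb.weight (norm_cut_le j t)) F))
    (fun w => IsHSFun.continuous ((IsHSFun.const (dirD hf v F)).secD_cut hf ha hb j) w)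
    (fun w => IsHSFun.continuous (((IsHSFun.const F).secD_cut hf ha hb j).dirD hf v) w)
    (fun m => by
      simp only [secD_cut hf ha hb hj m, map_sum]
      exact sum_congr rfl fun k _ => by rw [dirD_comm hf (b k) v, dirD_comm hf (a k) v])
  simpa only [secD_cut_top hf ha hb] using h

/-! ### Differential operators in terms of jets -/

/-- A linear form that vanishes on the kernel of `J` factors linearly through `J`, as its
composition with the map `s` given here. -/
theorem exists_section {V M : Type*} [AddCommGroup V] [Module 𝕜 V] [AddCommGroup M] [Module 𝕜 M]
    (J : V →ₗ[𝕜] M) : ∃ s : M →ₗ[𝕜] V, ∀ x, J (s (J x)) = J x := by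
  obtain ⟨s, hs⟩ := J.rangeRestrict.exists_rightInverse_of_surjective J.range_rangeRestrict
  obtain ⟨p, hp⟩ := J.range.subtype.exists_leftInverse_of_injective J.range.ker_subtype
  refine ⟨s.comp p, fun x => ?_⟩
  have h1 : p (J x) = J.rangeRestrict x := by
    have := LinearMap.congr_fun hp (J.rangeRestrict x)
    simpa using this
  have h2 := LinearMap.congr_fun hs (J.rangeRestrict x)
  have h3 := congrArg Subtype.val h2
  simpa [h1] using h3

/-- The `m`-th derivative at a point as a linear map. -/
def jet (f : ι → E) (m : ℕ) (w : E) : hsFunctions (𝕜 := 𝕜) f →ₗ[𝕜] (E [×m]→L[𝕜] 𝕜) where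
  toFun F := iteratedFDeriv 𝕜 m (F : E → 𝕜) w
  map_add' F G := iteratedFDeriv_add_apply (F.2.1.of_le (mod_cast le_top)).contDiffAt
    (G.2.1.of_le (mod_cast le_top)).contDiffAt
  map_smul' _ F := iteratedFDeriv_const_smul_apply (F.2.1.of_le (mod_cast le_top)).contDiffAt

/-- An operator whose value at a point depends only on the `m`-th derivative there is differential:
the coefficients need not be bounded, so a linear section of the jet map suffices. -/
theorem isDifferentialOp_of_jet (T : hsFunctions (𝕜 := 𝕜) f →ₗ[𝕜] hsFunctions (𝕜 := 𝕜) f) (m : ℕ)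
    (h : ∀ F w, jet f m w F = 0 → (T F : E → 𝕜) w = 0) : IsDifferentialOp _ T := by
  choose s hs using fun (m : ℕ) (w : E) => exists_section (jet (𝕜 := 𝕜) f m w)
  let ev : E → hsFunctions (𝕜 := 𝕜) f →ₗ[𝕜] 𝕜 := fun w =>
    { toFun := fun F => (T F : E → 𝕜) w
      map_add' := fun F G => by rw [map_add]; rfl
      map_smul' := fun _ F => by rw [map_smul]; rfl }
  refine ⟨{m}, fun m' w => (ev w).comp (s m' w), fun F w => ?_⟩
  rw [Finset.sum_singleton]
  have := h (F - s m w (jet f m w F)) w (by rw [map_sub, hs, sub_self])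
  rw [map_sub] at this
  exact sub_eq_zero.1 this

theorem isBidifferentialOp_of_jet
    (C : hsFunctions (𝕜 := 𝕜) f →ₗ[𝕜] hsFunctions (𝕜 := 𝕜) f →ₗ[𝕜] hsFunctions (𝕜 := 𝕜) f) (m : ℕ)
    (h : ∀ F G w, jet f m w F = 0 ∨ jet f m w G = 0 → (C F G : E → 𝕜) w = 0) :
    IsBidifferentialOp _ C := by
  choose s hs using fun (m : ℕ) (w : E) => exists_section (jet (𝕜 := 𝕜) f m w)
  let ev : E → hsFunctions (𝕜 := 𝕜) f →ₗ[𝕜] hsFunctions (𝕜 := 𝕜) f →ₗ[𝕜] 𝕜 := fun w =>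
    LinearMap.mk₂ 𝕜 (fun F G => (C F G : E → 𝕜) w)
      (fun F G K => by rw [map_add]; rfl) (fun _ F G => by rw [map_smul]; rfl)
      (fun F G K => by rw [map_add]; rfl) (fun _ F G => by rw [map_smul]; rfl)
  refine ⟨{(m, m)}, fun m₁ m₂ w => (ev w).compl₁₂ (s m₁ w) (s m₂ w), fun F G w => ?_⟩
  rw [Finset.sum_singleton]
  have h1 := h (F - s m w (jet f m w F)) G w (Or.inl (by rw [map_sub, hs, sub_self]))
  have h2 := h (s m w (jet f m w F)) (G - s m w (jet f m w G)) w
    (Or.inr (by rw [map_sub, hs, sub_self]))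
  rw [map_sub] at h1 h2
  exact (sub_eq_zero.1 h1).trans (sub_eq_zero.1 h2)

theorem isBidifferentialOp_expC (hd : IsBessel 𝕜 d) (hd' : IsBessel 𝕜 d') (r : ℕ) :
    IsBidifferentialOp _ (expC hf hd hd' r) := by
  refine isBidifferentialOp_of_jet _ r fun F G w h => ?_
  rw [expC_apply, powerOp]
  refine mul_eq_zero_of_right _ ?_
  have e : ∀ (F : hsFunctions (𝕜 := 𝕜) f) (d : κ → E) K, partialDerivs d F r K w =
      jet f r w F (fun s => d (K s)) := fun F d K => rfl
  simp only [e]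
  rcases h with h | h <;> simp [h]

/-- `Δ` raises the order of differentiation by two, as it commutes with directional derivatives. -/
theorem jet_secD {a b : J → E} (ha : Summable fun k => ‖a k‖ ^ 2) (hb : IsBessel 𝕜 b)
    (hj : ∀ n, {k | j k < n}.Finite) (m : ℕ) (w : E) (F : hsFunctions (𝕜 := 𝕜) f)
    (h : jet f (m + 2) w F = 0) : jet f m w (secD hf ha hb F) = 0 := by
  have hp : ∀ (n : ℕ) (G : hsFunctions (𝕜 := 𝕜) f) (v : Fin (n + 1) → E),
      jet f (n + 1) w G v = jet f n w (dirD hf (v (Fin.last n)) G) (fun s => v s.castSucc) :=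
    fun n G v => partialDerivs_succ id G.2.1 n v w
  have hz : ∀ (n : ℕ) (G : hsFunctions (𝕜 := 𝕜) f), jet f (n + 1) w G = 0 →
      ∀ v, jet f n w (dirD hf v G) = 0 := fun n G hG v => by
    ext x
    have := hp n G (Fin.snoc x v)
    simp only [Fin.snoc_last, Fin.snoc_castSucc, hG] at this
    exact this.symm
  induction m generalizing F with
  | zero =>
    ext x
    change (secD hf ha hb F : E → 𝕜) w = 0
    rw [secD_apply]
    refine (tsum_congr fun k => ?_).trans tsum_zero
    have := hz 0 _ (hz 1 F h (b k)) (a k)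
    exact congrArg (fun L => L Fin.elim0) this
  | succ m ih =>
    ext v
    rw [hp, ← secD_dirD hf ha hb hj, ih _ (hz _ F h _)]
    rfl

theorem isDifferentialOp_expT {a b : J → E} (ha : Summable fun k => ‖a k‖ ^ 2) (hb : IsBessel 𝕜 b)
    (hj : ∀ n, {k | j k < n}.Finite) (r : ℕ) :
    IsDifferentialOp _ (expT (secD hf ha hb) r) := by
  refine isDifferentialOp_of_jet _ (2 * r) fun F w h => ?_
  change (r.factorial : 𝕜)⁻¹ * ((secD hf ha hb ^ r) F : E → 𝕜) w = 0
  refine mul_eq_zero_of_right _ ?_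
  induction r generalizing F with
  | zero => exact congrArg (fun L => L Fin.elim0) h
  | succ r ih =>
    rw [pow_succ]
    exact ih _ (jet_secD hf ha hb hj _ w F h)

end Exponential

/-! ### Algebraic consequences of associativity -/

section Jacobi

variable {𝕜 𝓐 : Type*} [Field 𝕜] [CharZero 𝕜] [CommRing 𝓐] [Algebra 𝕜 𝓐]

/-- The skew first-order term of an associative deformation of a commutative product satisfies the
Jacobi identity: this is the alternating sum of the associativity relation of order two. -/
theorem jacobi_of_assoc {c₁ c₂ : 𝓐 →ₗ[𝕜] 𝓐 →ₗ[𝕜] 𝓐} (hskew : ∀ F G, c₁ F G = -c₁ G F)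
    (h : ∀ F G K, F * c₂ G K + c₁ F (c₁ G K) + c₂ F (G * K) =
      c₂ F G * K + c₁ (c₁ F G) K + c₂ (F * G) K) (F G K : 𝓐) :
    c₁ F (c₁ G K) + c₁ G (c₁ K F) + c₁ K (c₁ F G) = 0 := by
  have s : ∀ X Y Z, c₁ X (c₁ Y Z) = -c₁ X (c₁ Z Y) := fun X Y Z => by rw [hskew Y Z, map_neg]
  have t : ∀ X Y Z, c₁ (c₁ X Y) Z = -c₁ Z (c₁ X Y) := fun X Y Z => hskew _ _
  have h1 := h F G K
  have h2 := h G K F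
  have h3 := h K F G
  have h4 := h F K G
  have h5 := h G F K
  have h6 := h K G F
  rw [t] at h1 h2 h3 h4 h5 h6
  rw [s F K G, mul_comm K G] at h4
  rw [s G F K, mul_comm G F] at h5
  rw [s K G F] at h6
  rw [s G F K] at h4
  rw [s K G F] at h5
  rw [s F K G, mul_comm K G, mul_comm G F] at h6
  rw [mul_comm K F] at h2 h3
  have h7 : (4 : 𝕜) • (c₁ F (c₁ G K) + c₁ G (c₁ K F) + c₁ K (c₁ F G)) = 0 := by
    rw [Algebra.smul_def, map_ofNat]
    linear_combination h1 + h2 + h3 - h4 - h5 - h6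
  exact (smul_eq_zero.1 h7).resolve_left (by norm_num)

end Jacobi

section SeriesCoeff

open Finset.HasAntidiagonal

variable {𝕜 E : Type*} [RCLike 𝕜] {𝓕 : Subalgebra 𝕜 (E → 𝕜)}
  (C : ℕ → 𝓕 →ₗ[𝕜] 𝓕 →ₗ[𝕜] 𝓕) (T : ℕ → 𝓕 →ₗ[𝕜] 𝓕)

theorem coeff_seriesMap_C (F : 𝓕) (n : ℕ) :
    PowerSeries.coeff n (seriesMap T (PowerSeries.C F)) = T n F := by
  rw [seriesMap, PowerSeries.coeff_mk, Finset.sum_eq_single (n, 0)]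
  · simp
  · rintro ⟨a, b⟩ hab hne
    have hb : b ≠ 0 := fun hb => hne (by simp_all)
    simp [PowerSeries.coeff_C, hb]
  · simp

theorem coeff_seriesMul_C_left (F : 𝓕) (X : 𝓕⟦X⟧) (n : ℕ) :
    PowerSeries.coeff n (seriesMul C (PowerSeries.C F) X) =
      ∑ p ∈ antidiagonal n, C p.1 F (PowerSeries.coeff p.2 X) := by
  rw [seriesMul, PowerSeries.coeff_mk]
  refine Finset.sum_congr rfl fun p _ => ?_
  rw [Finset.sum_eq_single (0, p.2)]
  · simp
  · rintro ⟨a, b⟩ hab hne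
    have hb : a ≠ 0 := fun hb => hne (by simp_all)
    simp [PowerSeries.coeff_C, hb]
  · simp

theorem coeff_seriesMul_C_right (F : 𝓕) (X : 𝓕⟦X⟧) (n : ℕ) :
    PowerSeries.coeff n (seriesMul C X (PowerSeries.C F)) =
      ∑ p ∈ antidiagonal n, C p.1 (PowerSeries.coeff p.2 X) F := by
  rw [seriesMul, PowerSeries.coeff_mk]
  refine Finset.sum_congr rfl fun p _ => ?_
  rw [Finset.sum_eq_single (p.2, 0)]
  · simp
  · rintro ⟨a, b⟩ hab hne
    have hb : b ≠ 0 := fun hb => hne (by simp_all)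
    simp [PowerSeries.coeff_C, hb]
  · simp

theorem coeff_seriesMul_C_C (F G : 𝓕) (n : ℕ) :
    PowerSeries.coeff n (seriesMul C (PowerSeries.C F) (PowerSeries.C G)) = C n F G := by
  rw [coeff_seriesMul_C_left, Finset.sum_eq_single (n, 0)]
  · simp
  · rintro ⟨a, b⟩ hab hne
    have hb : b ≠ 0 := fun hb => hne (by simp_all)
    simp [PowerSeries.coeff_C, hb]
  · simp

theorem seriesMul_assoc_of (h : ∀ (n : ℕ) (F G K : 𝓕), ∑ p ∈ antidiagonal n, C p.1 F (C p.2 G K) =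
      ∑ p ∈ antidiagonal n, C p.1 (C p.2 F G) K) (F G K : 𝓕) :
    seriesMul C (PowerSeries.C F) (seriesMul C (PowerSeries.C G) (PowerSeries.C K)) =
      seriesMul C (seriesMul C (PowerSeries.C F) (PowerSeries.C G)) (PowerSeries.C K) := by
  ext1 n
  rw [coeff_seriesMul_C_left, coeff_seriesMul_C_right]
  simp only [coeff_seriesMul_C_C]
  exact h n F G K

variable (C' : ℕ → 𝓕 →ₗ[𝕜] 𝓕 →ₗ[𝕜] 𝓕)

theorem intertwine_iff (F G : 𝓕) :
    seriesMul C (seriesMap T (PowerSeries.C F)) (seriesMap T (PowerSeries.C G)) =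
        seriesMap T (seriesMul C' (PowerSeries.C F) (PowerSeries.C G)) ↔
      ∀ n, ∑ p ∈ antidiagonal n, ∑ q ∈ antidiagonal p.2, C p.1 (T q.1 F) (T q.2 G) =
        ∑ p ∈ antidiagonal n, T p.1 (C' p.2 F G) := by
  rw [PowerSeries.ext_iff]
  refine forall_congr' fun n => ?_
  rw [seriesMul, PowerSeries.coeff_mk, seriesMap.eq_1 T (seriesMul C' _ _), PowerSeries.coeff_mk]
  simp only [coeff_seriesMap_C, coeff_seriesMul_C_C]

end SeriesCoeff

/-! ### The phase space -/

section Pairing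

variable {𝕜 : Type*} [RCLike 𝕜]

theorem exists_pairing (κ : Type*) : ∃ β : L2 𝕜 κ →L[𝕜] L2 𝕜 κ →L[𝕜] 𝕜,
    ∀ x y, HasSum (fun k => x k * y k) (β x y) := by
  let B : L2 𝕜 κ →ₗ[𝕜] L2 𝕜 κ →ₗ[𝕜] 𝕜 := LinearMap.mk₂ 𝕜 (fun x y => inner 𝕜 (star x) y)
    (fun x x' y => by rw [star_add, inner_add_left])
    (fun c x y => by rw [star_smul, inner_smul_left]; simp)
    (fun x y y' => inner_add_right _ _ _)
    (fun c x y => inner_smul_right _ _ _)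
  refine ⟨B.mkContinuous₂ 1 fun x y => ?_, fun x y => hasSum_pairing x y⟩
  change ‖inner 𝕜 (star x) y‖ ≤ _
  rw [one_mul]
  refine (norm_inner_le_norm _ _).trans ?_
  rw [norm_star]

end Pairing

section PhaseSpace

variable {𝕜 H : Type*} [RCLike 𝕜] [NormedAddCommGroup H] [InnerProductSpace 𝕜 H]
  [CompleteSpace H] (e : HilbertBasis ℕ 𝕜 H)

theorem apply_bidual (φ : StrongDual 𝕜 (StrongDual 𝕜 H)) (ξ : StrongDual 𝕜 H) :
    ξ (bidual φ) = φ ξ := (exists_eval_eq φ).choose_spec ξ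

theorem inner_bidual (φ : StrongDual 𝕜 (StrongDual 𝕜 H)) (y : H) :
    inner 𝕜 y (bidual φ) = φ (innerSL 𝕜 y) := by
  rw [← apply_bidual φ]
  rfl

theorem bidual_eq {φ : StrongDual 𝕜 (StrongDual 𝕜 H)} {y : H}
    (h : ∀ ξ : StrongDual 𝕜 H, ξ y = φ ξ) : bidual φ = y :=
  ext_inner_left 𝕜 fun z => by rw [inner_bidual, ← h]; rfl

theorem norm_bidual_le (φ : StrongDual 𝕜 (StrongDual 𝕜 H)) : ‖bidual φ‖ ≤ ‖φ‖ := by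
  have h : ‖bidual φ‖ * ‖bidual φ‖ ≤ ‖φ‖ * ‖bidual φ‖ := by
    rw [← sq, ← inner_self_eq_norm_sq (𝕜 := 𝕜)]
    refine (RCLike.re_le_norm _).trans ?_
    rw [inner_bidual]
    exact (φ.le_opNorm (innerSL 𝕜 (bidual φ))).trans_eq (by rw [innerSL_apply_norm])
  rcases (norm_nonneg (bidual φ)).eq_or_lt' with h0 | h0
  · rw [h0]; exact norm_nonneg φ
  · exact le_of_mul_le_mul_right h h0

theorem sum_sq_apply_basis_le (ψ : StrongDual 𝕜 H) (s : Finset ℕ) :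
    ∑ j ∈ s, ‖ψ (e j)‖ ^ 2 ≤ ‖ψ‖ ^ 2 := by
  obtain ⟨z, rfl⟩ := (InnerProductSpace.toDual 𝕜 H).surjective ψ
  rw [LinearIsometryEquiv.norm_map]
  refine (Finset.sum_le_sum fun j _ => ?_).trans (e.orthonormal.sum_inner_products_le z)
  rw [InnerProductSpace.toDual_apply_apply, norm_inner_symm]

theorem isBessel_fst (M : H →L[𝕜] H) : IsBessel 𝕜 (fun j => ((M (e j), 0) : Phase 𝕜 H)) := by
  refine isBessel_of_bound (‖(ContinuousLinearMap.inl 𝕜 H (StrongDual 𝕜 H)).comp M‖)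
    (ContinuousLinearMap.opNorm_nonneg _) fun φ s => ?_
  refine (sum_sq_apply_basis_le e
    (φ.comp ((ContinuousLinearMap.inl 𝕜 H (StrongDual 𝕜 H)).comp M)) s).trans ?_
  gcongr
  rw [mul_comm]
  exact φ.opNorm_comp_le _

theorem isBessel_snd : IsBessel 𝕜 (fun j => ((0, dualVec e j) : Phase 𝕜 H)) := by
  refine isBessel_of_bound (‖ContinuousLinearMap.inr 𝕜 H (StrongDual 𝕜 H)‖)
    (ContinuousLinearMap.opNorm_nonneg _) fun φ s => ?_
  set χ := φ.comp (ContinuousLinearMap.inr 𝕜 H (StrongDual 𝕜 H)) with hχ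
  have hb : ∀ j, φ (0, dualVec e j) = inner 𝕜 (e j) (bidual χ) := fun j => by
    rw [inner_bidual]; rfl
  simp only [hb]
  refine (e.orthonormal.sum_inner_products_le (bidual χ)).trans ?_
  gcongr
  refine (norm_bidual_le χ).trans ?_
  rw [mul_comm]
  exact φ.opNorm_comp_le _

theorem IsBessel.bool {E : Type*} [NormedAddCommGroup E] [NormedSpace 𝕜 E] {d : Bool × ℕ → E}
    (h : ∀ b, IsBessel 𝕜 (fun j => d (b, j))) : IsBessel 𝕜 d := by
  choose N hN using h
  refine isBessel_of_bound (‖N true‖ + ‖N false‖) (by positivity) fun φ s => ?_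
  obtain ⟨t, u, h⟩ := sum_prod_le_of_nonneg (a := fun p : Bool × ℕ => ‖φ (d p)‖ ^ 2)
    (fun _ => by positivity) s
  have hb : ∀ b, ∑ j ∈ u, ‖φ (d (b, j))‖ ^ 2 ≤ (‖N b‖ * ‖φ‖) ^ 2 := fun b => by
    simp only [← hN]
    refine (sum_sq_le_norm_sq _ u).trans ?_
    gcongr
    exact (N b).le_opNorm φ
  calc _ ≤ ∑ b ∈ t, ∑ j ∈ u, ‖φ (d (b, j))‖ ^ 2 := h
    _ ≤ ∑ b, ∑ j ∈ u, ‖φ (d (b, j))‖ ^ 2 := Finset.sum_le_sum_of_subset_of_nonneg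
        (Finset.subset_univ t) (fun _ _ _ => Finset.sum_nonneg fun _ _ => by positivity)
    _ ≤ (‖N true‖ * ‖φ‖) ^ 2 + (‖N false‖ * ‖φ‖) ^ 2 := by
        rw [Fintype.sum_bool]; exact add_le_add (hb _) (hb _)
    _ ≤ _ := by
        rw [add_mul]
        have : 0 ≤ (‖N true‖ * ‖φ‖) * (‖N false‖ * ‖φ‖) := by positivity
        nlinarith

theorem isBessel_leftVec (A : H →L[𝕜] H) : IsBessel 𝕜 (leftVec e A) :=
  IsBessel.bool (Bool.rec (isBessel_snd e) (isBessel_fst e (A + 1)))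

theorem isBessel_rightVec (A : H →L[𝕜] H) : IsBessel 𝕜 (rightVec e A) :=
  IsBessel.bool (Bool.rec (isBessel_fst e (A - 1)) (isBessel_snd e))

theorem isBessel_phaseBasis : IsBessel 𝕜 (phaseBasis e) := by
  obtain ⟨N, hN⟩ := isBessel_leftVec e 0
  have hσ : Function.Injective (Sum.elim (fun i => (true, i)) (fun i => (false, i)) :
      ℕ ⊕ ℕ → Bool × ℕ) := by
    rintro (a | a) (b | b) h <;> simp_all
  refine ⟨(reindex _ hσ).comp N, fun φ k => ?_⟩
  rw [ContinuousLinearMap.comp_apply, reindex_apply, hN]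
  rcases k with i | i <;> simp [phaseBasis, leftVec]

/-- The coordinates `⟨eᵢ, x⟩` and `ξ(eᵢ)` of a point `(x, ξ)`. -/
def coord : ℕ ⊕ ℕ → Phase 𝕜 H →L[𝕜] 𝕜 :=
  Sum.elim (fun i => (innerSL 𝕜 (e i)).comp (ContinuousLinearMap.fst 𝕜 H (StrongDual 𝕜 H)))
    (fun i => (ContinuousLinearMap.apply 𝕜 𝕜 (e i)).comp
      (ContinuousLinearMap.snd 𝕜 H (StrongDual 𝕜 H)))

theorem hasSum_coord (φ : Phase 𝕜 H →L[𝕜] 𝕜) (w : Phase 𝕜 H) :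
    HasSum (fun i => φ (phaseBasis e i) * coord e i w) (φ w) := by
  obtain ⟨x, ξ⟩ := w
  have hw : φ (x, ξ) = φ (x, 0) + φ (0, ξ) := by rw [← map_add]; simp
  rw [hw]
  refine HasSum.sum ?_ ?_
  · have h := (e.hasSum_repr x).mapL (φ.comp (ContinuousLinearMap.inl 𝕜 H (StrongDual 𝕜 H)))
    change HasSum _ (φ (x, 0)) at h
    convert h using 1
    funext i
    rw [map_smul, e.repr_apply_apply, smul_eq_mul, mul_comm]
    rfl
  · set χ := φ.comp (ContinuousLinearMap.inr 𝕜 H (StrongDual 𝕜 H))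
    have h := (e.hasSum_repr (bidual χ)).mapL ξ
    rw [apply_bidual] at h
    change HasSum _ (φ (0, ξ)) at h
    convert h using 1
    funext i
    change χ (innerSL 𝕜 (e i)) * ξ (e i) = _
    rw [map_smul, e.repr_apply_apply, smul_eq_mul, inner_bidual]

theorem isFrame_phaseBasis : IsFrame 𝕜 (phaseBasis e) := by
  obtain ⟨β, hβ⟩ := exists_pairing (𝕜 := 𝕜) (ℕ ⊕ ℕ)
  obtain ⟨G, hG, -⟩ := exists_clm_l2 (𝕜 := 𝕜) (V := Phase 𝕜 H) (fun w i => coord e i w)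
    (fun _ _ _ => map_add _ _ _) (fun _ _ _ => map_smul _ _ _) 2 (by norm_num) (fun w s => by
      have h1 : ∀ t : Finset ℕ, ∑ i ∈ t, ‖coord e (Sum.inl i) w‖ ^ 2 ≤ ‖w‖ ^ 2 := fun t =>
        (e.orthonormal.sum_inner_products_le w.1).trans (by gcongr; exact norm_fst_le w)
      have h2 : ∀ t : Finset ℕ, ∑ i ∈ t, ‖coord e (Sum.inr i) w‖ ^ 2 ≤ ‖w‖ ^ 2 := fun t =>
        (sum_sq_apply_basis_le e w.2 t).trans (by gcongr; exact norm_snd_le w)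
      rw [← Finset.toLeft_disjSum_toRight (u := s), Finset.sum_disjSum]
      nlinarith [h1 s.toLeft, h2 s.toRight, sq_nonneg ‖w‖])
  refine ⟨((ContinuousLinearMap.compL 𝕜 (Phase 𝕜 H) (L2 𝕜 (ℕ ⊕ ℕ)) 𝕜).flip G).comp β,
    fun φ c hc => ?_⟩
  refine ContinuousLinearMap.ext fun w => ?_
  change β c (G w) = φ w
  refine (hβ c (G w)).unique ?_
  simp only [hc, hG]
  exact hasSum_coord e φ w

end PhaseSpace

/-! ### The exponential star-products on the phase space -/

section Star

open Finset.HasAntidiagonal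

variable {𝕜 H : Type*} [RCLike 𝕜] [NormedAddCommGroup H] [InnerProductSpace 𝕜 H]
  [CompleteSpace H] (e : HilbertBasis ℕ 𝕜 H) (A B : H →L[𝕜] H)

/-- The coefficients of the star-product `⋆ᴬ`. -/
def starCoeff (r : ℕ) : FHS e →ₗ[𝕜] FHS e →ₗ[𝕜] FHS e :=
  expC (isFrame_phaseBasis e) (isBessel_leftVec e A) (isBessel_rightVec e A) r

theorem finite_snd_lt (n : ℕ) : {k : Bool × ℕ | k.2 < n}.Finite :=
  (Set.finite_univ.prod (Set.finite_lt_nat n)).subset fun _ hk => ⟨Set.mem_univ _, hk⟩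

theorem fderiv_dualVec (F : Phase 𝕜 H → 𝕜) (w : Phase 𝕜 H) (j : ℕ) :
    fderiv 𝕜 F w (0, dualVec e j) = inner 𝕜 (e j) (D₂ F w) := by
  rw [D₂, inner_bidual]
  rfl

theorem hasSum_D₁_D₂ (F G : Phase 𝕜 H → 𝕜) (w : Phase 𝕜 H) (M : H →L[𝕜] H) :
    HasSum (fun j => fderiv 𝕜 F w (M (e j), 0) * fderiv 𝕜 G w (0, dualVec e j))
      (D₁ F w (M (D₂ G w))) := by
  have h := (e.hasSum_repr (D₂ G w)).mapL ((D₁ F w).comp M)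
  change HasSum _ (D₁ F w (M (D₂ G w))) at h
  convert h using 1
  funext j
  rw [map_smul, e.repr_apply_apply, smul_eq_mul, fderiv_dualVec, mul_comm]
  rfl

theorem hasSum_starCoeff_one (F G : FHS e) (w : Phase 𝕜 H) :
    HasSum (fun k => fderiv 𝕜 (F : Phase 𝕜 H → 𝕜) w (leftVec e A k) *
      fderiv 𝕜 (G : Phase 𝕜 H → 𝕜) w (rightVec e A k))
      ((starCoeff e A 1 F G : Phase 𝕜 H → 𝕜) w) := by
  have h := hasSum_powD_succ (isFrame_phaseBasis e) (isBessel_leftVec e A)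
    (isBessel_rightVec e A) 0 F G w
  have e1 : (starCoeff e A 1 F G : Phase 𝕜 H → 𝕜) w =
      (powD (isFrame_phaseBasis e) (isBessel_leftVec e A)
        (isBessel_rightVec e A) (0 + 1) F G : Phase 𝕜 H → 𝕜) w := by
    change ((Nat.factorial 1 : ℕ) : 𝕜)⁻¹ * powerOp (leftVec e A) (rightVec e A) 1 F G w =
      powerOp (leftVec e A) (rightVec e A) 1 F G w
    simp
  rw [e1]
  simp only [powD_zero] at h
  exact h

theorem starCoeff_one_apply (F G : FHS e) (w : Phase 𝕜 H) :
    (starCoeff e A 1 F G : Phase 𝕜 H → 𝕜) w =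
      D₁ (F : Phase 𝕜 H → 𝕜) w ((A + 1) (D₂ (G : Phase 𝕜 H → 𝕜) w)) +
      D₁ (G : Phase 𝕜 H → 𝕜) w ((A - 1) (D₂ (F : Phase 𝕜 H → 𝕜) w)) := by
  have h := (hasSum_starCoeff_one e A F G w).prod_fiberwise
    (g := fun b => if b then D₁ (F : Phase 𝕜 H → 𝕜) w ((A + 1) (D₂ (G : Phase 𝕜 H → 𝕜) w)) else
      D₁ (G : Phase 𝕜 H → 𝕜) w ((A - 1) (D₂ (F : Phase 𝕜 H → 𝕜) w)))
    (by
      rintro (_ | _)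
      · have := hasSum_D₁_D₂ e (G : Phase 𝕜 H → 𝕜) F w (A - 1)
        simp only [mul_comm (fderiv 𝕜 (G : Phase 𝕜 H → 𝕜) w _)] at this
        exact this
      · exact hasSum_D₁_D₂ e (F : Phase 𝕜 H → 𝕜) G w (A + 1))
  refine (h.unique (hasSum_fintype _)).trans ?_
  rw [Fintype.sum_bool]
  simp

theorem starCoeff_one_eq (F G : FHS e) (w : Phase 𝕜 H) :
    (starCoeff e A 1 F G : Phase 𝕜 H → 𝕜) w =
      canonicalBracket (F : Phase 𝕜 H → 𝕜) G w + cocycleE A (F : Phase 𝕜 H → 𝕜) G w := by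
  rw [starCoeff_one_apply]
  simp only [canonicalBracket, cocycleE, add_apply,
    sub_apply, one_apply_eq_self, map_add, map_sub]
  ring

/-- The canonical Poisson bracket, as the first coefficient of the star-product for `A = 0`. -/
def bracket : FHS e →ₗ[𝕜] FHS e →ₗ[𝕜] FHS e := starCoeff e 0 1

theorem bracket_apply (F G : FHS e) (w : Phase 𝕜 H) :
    (bracket e F G : Phase 𝕜 H → 𝕜) w = canonicalBracket (F : Phase 𝕜 H → 𝕜) G w := by
  rw [bracket, starCoeff_one_eq]
  simp [cocycleE]

theorem starCoeff_zero (F G : FHS e) : starCoeff e A 0 F G = F * G := by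
  refine Subtype.ext <| funext fun w => ?_
  change ((Nat.factorial 0 : ℕ) : 𝕜)⁻¹ * powerOp (leftVec e A) (rightVec e A) 0 F G w =
    (F : Phase 𝕜 H → 𝕜) w * (G : Phase 𝕜 H → 𝕜) w
  simp [powerOp, partialDerivs]

theorem starCoeff_assoc (n : ℕ) (F G K : FHS e) :
    ∑ p ∈ antidiagonal n, starCoeff e A p.1 F (starCoeff e A p.2 G K) =
      ∑ p ∈ antidiagonal n, starCoeff e A p.1 (starCoeff e A p.2 F G) K :=
  expC_assoc (isFrame_phaseBasis e) (isBessel_leftVec e A) (isBessel_rightVec e A)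
    finite_snd_lt n F G K

theorem isPoissonBracket_bracket : IsPoissonBracket (FHS e) (bracket e) := by
  have hskew : ∀ F G : FHS e, bracket e F G = -bracket e G F := fun F G =>
    Subtype.ext <| funext fun w => by
      change _ = -(bracket e G F : Phase 𝕜 H → 𝕜) w
      rw [bracket_apply, bracket_apply, canonicalBracket, canonicalBracket, neg_sub]
  refine ⟨fun F hF => hF.1, ?_, hskew, fun F G K => ?_, fun F G K => ?_⟩
  · have hadd : ∀ φ ψ : Phase 𝕜 H →L[𝕜] 𝕜,
        bidual ((φ + ψ).comp (ContinuousLinearMap.inr 𝕜 H (StrongDual 𝕜 H))) =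
        bidual (φ.comp (ContinuousLinearMap.inr 𝕜 H (StrongDual 𝕜 H))) +
        bidual (ψ.comp (ContinuousLinearMap.inr 𝕜 H (StrongDual 𝕜 H))) := fun φ ψ =>
      bidual_eq fun ξ => by rw [map_add, apply_bidual, apply_bidual]; rfl
    have hsmul : ∀ (c : 𝕜) (φ : Phase 𝕜 H →L[𝕜] 𝕜),
        bidual ((c • φ).comp (ContinuousLinearMap.inr 𝕜 H (StrongDual 𝕜 H))) =
        c • bidual (φ.comp (ContinuousLinearMap.inr 𝕜 H (StrongDual 𝕜 H))) := fun c φ =>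
      bidual_eq fun ξ => by rw [map_smul, apply_bidual]; rfl
    let b : (Phase 𝕜 H →L[𝕜] 𝕜) → H := fun φ =>
      bidual (φ.comp (ContinuousLinearMap.inr 𝕜 H (StrongDual 𝕜 H)))
    let a : (Phase 𝕜 H →L[𝕜] 𝕜) → StrongDual 𝕜 H := fun φ =>
      φ.comp (ContinuousLinearMap.inl 𝕜 H (StrongDual 𝕜 H))
    have ha : ∀ φ ψ x, a (φ + ψ) x = a φ x + a ψ x := fun _ _ _ => rfl
    have ha' : ∀ (c : 𝕜) φ x, a (c • φ) x = c * a φ x := fun _ _ _ => rfl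
    have hb : ∀ φ ψ, b (φ + ψ) = b φ + b ψ := hadd
    have hb' : ∀ (c : 𝕜) φ, b (c • φ) = c • b φ := hsmul
    refine ⟨fun _ => LinearMap.mk₂ 𝕜 (fun φ ψ => a φ (b ψ) - a ψ (b φ)) ?_ ?_ ?_ ?_,
      fun F G w => bracket_apply e F G w⟩
    all_goals
      intros
      simp only [ha, ha', hb, hb', map_add, map_smul, smul_eq_mul]
      ring
  · refine Subtype.ext <| funext fun w => ?_
    have h1 := hasSum_starCoeff_one e 0 F (G * K) w
    have h2 := ((hasSum_starCoeff_one e 0 F G w).mul_right ((K : Phase 𝕜 H → 𝕜) w)).add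
      ((hasSum_starCoeff_one e 0 F K w).mul_left ((G : Phase 𝕜 H → 𝕜) w))
    refine h1.unique ?_
    refine cast (congrArg (fun t => HasSum t _) (funext fun k => ?_)) h2
    symm
    change _ * fderiv 𝕜 ((G : Phase 𝕜 H → 𝕜) * (K : Phase 𝕜 H → 𝕜)) w _ = _
    rw [fderiv_mul (differentiableAt_of_mem G.2 w) (differentiableAt_of_mem K.2 w)]
    simp only [add_apply, smul_apply, smul_eq_mul]
    ring
  · refine jacobi_of_assoc (𝕜 := 𝕜) (c₂ := starCoeff e 0 2) hskew (fun F G K => ?_) F G K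
    have h := starCoeff_assoc e 0 2 F G K
    simp only [Finset.Nat.antidiagonal_succ, Finset.Nat.antidiagonal_zero, Finset.sum_cons,
      Finset.map_singleton, Finset.sum_singleton, Finset.map_cons,
      starCoeff_zero, Function.Embedding.prodMap, Function.Embedding.coeFn_mk, Prod.map] at h
    simpa [bracket, starCoeff_zero, add_assoc] using h

/-- The star-product `⋆ᴬ`. -/
def starProduct : StarProduct (FHS e) (bracket e) where
  C := starCoeff e A
  zeroth := starCoeff_zero e A
  first F G := Subtype.ext <| funext fun w => by
    change (starCoeff e A 1 F G : Phase 𝕜 H → 𝕜) w - (starCoeff e A 1 G F : Phase 𝕜 H → 𝕜) w =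
      2 * (bracket e F G : Phase 𝕜 H → 𝕜) w
    rw [starCoeff_one_eq, starCoeff_one_eq, bracket_apply]
    simp only [canonicalBracket, cocycleE]
    ring
  bidiff r _ := isBidifferentialOp_expC _ _ _ r
  const r hr F := by
    have h : ∀ w, iteratedFDeriv 𝕜 r ((1 : FHS e) : Phase 𝕜 H → 𝕜) w = 0 := fun w =>
      congrFun (iteratedFDeriv_const_of_ne (𝕜 := 𝕜) (by omega) (1 : 𝕜)) w
    constructor <;> refine Subtype.ext <| funext fun w => ?_ <;>
    · change (r.factorial : 𝕜)⁻¹ * powerOp (leftVec e A) (rightVec e A) r _ _ w = 0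
      simp only [powerOp, partialDerivs, h]
      simp
  assoc := seriesMul_assoc_of _ (starCoeff_assoc e A)

theorem isExponential_starProduct : IsExponential e A (starProduct e A) := by
  refine ⟨starCoeff_one_eq e A, fun r F G w => ?_⟩
  have h := hasSum_powerOp (isFrame_phaseBasis e) (isBessel_leftVec e A) (isBessel_rightVec e A)
    F.2 G.2 r w
  have h0 : (r.factorial : 𝕜) ≠ 0 := Nat.cast_ne_zero.2 r.factorial_ne_zero
  change HasSum _ ((r.factorial : 𝕜) *
    ((r.factorial : 𝕜)⁻¹ * powerOp (leftVec e A) (rightVec e A) r F G w))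
  rw [mul_inv_cancel_left₀ h0]
  exact h

/-- If `A - B` is a Hilbert-Schmidt operator, then `exp (ℏ Δ)` is an equivalence, where
`Δ = ∑ⱼ ∂_{((A - B)eⱼ, 0)} ∂_{(0, eⱼ*)}`. -/
theorem equivalent_of_mem (h : A - B ∈ hilbertSchmidt e) :
    (starProduct e A).Equivalent (starProduct e B) := by
  have hf := isFrame_phaseBasis e
  have ha : Summable fun j => ‖(((A - B) (e j), 0) : Phase 𝕜 H)‖ ^ 2 := by
    have h' : Summable fun j => ‖(A - B) (e j)‖ ^ 2 := h
    simpa [Prod.norm_def] using h'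
  have hb := isBessel_snd e
  have hj : ∀ n, {k : ℕ | id k < n}.Finite := fun n => Set.finite_lt_nat n
  refine ⟨expT (secD hf ha hb), ?_, fun r hr => ⟨isDifferentialOp_expT hf ha hb hj r, ?_⟩,
    fun F G => ?_⟩
  · simp [expT]
    rfl
  · obtain ⟨s, rfl⟩ : ∃ s, r = s + 1 := ⟨r - 1, by omega⟩
    have h1 : secD hf ha hb (1 : hsFunctions (phaseBasis e)) = 0 :=
        Subtype.ext <| funext fun w => by
      rw [secD_apply]
      refine (tsum_congr fun k => ?_).trans tsum_zero
      have : dirD hf (0, dualVec e k) (1 : hsFunctions (phaseBasis e)) = 0 :=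
          Subtype.ext <| funext fun w => by
        change fderiv 𝕜 (fun _ => (1 : 𝕜)) w _ = 0
        simp
      rw [this, map_zero]
      rfl
    change (((s + 1).factorial : ℕ) : 𝕜)⁻¹ • ((secD hf ha hb) ^ (s + 1))
      (1 : hsFunctions (phaseBasis e)) = 0
    rw [pow_succ, Module.End.mul_apply, h1, map_zero, smul_zero]
  · refine (intertwine_iff _ _ _ F G).2 fun n => ?_
    refine expT_intertwine hf (isBessel_leftVec e A) (isBessel_rightVec e A) (isBessel_leftVec e B)
      (isBessel_rightVec e B) ha hb finite_snd_lt hj (fun m L F G => ?_) n F G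
    have hs : (finite_snd_lt m).toFinset = Finset.univ ×ˢ Finset.range m := by ext k; simp
    have hs' : (hj m).toFinset = Finset.range m := by ext k; simp
    rw [hs, hs', Finset.sum_product, Finset.sum_product, Fintype.sum_bool, Fintype.sum_bool,
      ← Finset.sum_add_distrib, ← Finset.sum_add_distrib, ← Finset.sum_add_distrib]
    refine Finset.sum_congr rfl fun j _ => ?_
    have e1 : leftVec e A (true, j) = leftVec e B (true, j) + ((A - B) (e j), 0) := by
      simp [leftVec]; abel
    have e2 : rightVec e A (false, j) = rightVec e B (false, j) + ((A - B) (e j), 0) := by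
      simp [rightVec]
    rw [e1, e2, dirD_add, dirD_add, map_add, map_add, LinearMap.add_apply]
    change L (dirD hf _ F) (dirD hf (0, dualVec e j) G) +
      L (dirD hf _ F) (dirD hf (0, dualVec e j) G) + (L (dirD hf (0, dualVec e j) F) _ + L (dirD hf (0, dualVec e j) F) _) =
      L (dirD hf _ F) (dirD hf (0, dualVec e j) G) + L (dirD hf (0, dualVec e j) F) _ + _
    abel

end Star

/-! ### Linear families and their powers -/

section Linear

variable {𝕜 E : Type*} [RCLike 𝕜] [NormedAddCommGroup E] [NormedSpace 𝕜 E]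
variable {P : Type*} [TopologicalSpace P] {ι κ : Type} {f : ι → E}

theorem isL2Family_clm (L : E →L[𝕜] L2 𝕜 κ) : IsL2Family (fun (_ : P) k w => L w k) :=
  ⟨fun _ => L, fun _ => L.contDiff, fun _ => continuous_const, fun _ _ _ => rfl⟩

theorem isHSFamily_const (c : L2 𝕜 κ) (r : ℕ) :
    IsHSFamily f r (fun (_ : P) k (_ : E) => c k) := by
  have base : ∀ {κ : Type} (c : L2 𝕜 κ), IsL2Family (fun (_ : P) k (_ : E) => c k) := fun c =>
    ⟨fun _ _ => c, fun _ => contDiff_const, fun _ => continuous_const, fun _ _ _ => rfl⟩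
  induction r generalizing κ with
  | zero => exact base c
  | succ r ih => exact ⟨base c, (ih 0).congr fun p q w => by simp [derivFam]⟩

theorem exists_clm_of_summable {φ : κ → E →L[𝕜] 𝕜} (hφ : Summable fun k => ‖φ k‖ ^ 2) :
    ∃ L : E →L[𝕜] L2 𝕜 κ, ∀ w k, L w k = φ k w := by
  obtain ⟨L, hL, -⟩ := exists_clm_l2 (𝕜 := 𝕜) (fun w k => φ k w) (fun _ _ _ => map_add _ _ _)
    (fun _ _ _ => map_smul _ _ _) (Real.sqrt (∑' k, ‖φ k‖ ^ 2)) (Real.sqrt_nonneg _) fun w s => by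
      rw [mul_pow, Real.sq_sqrt (tsum_nonneg fun _ => by positivity)]
      refine le_trans ?_ (mul_le_mul_of_nonneg_right (hφ.sum_le_tsum s fun _ _ => by positivity)
        (by positivity))
      rw [Finset.sum_mul]
      refine Finset.sum_le_sum fun k _ => ?_
      rw [← mul_pow]
      gcongr
      exact (φ k).le_opNorm w
  exact ⟨L, hL⟩

theorem summable_of_sum_prod_le {α β : Type*} {a : α × β → ℝ} (ha : ∀ p, 0 ≤ a p) {b : β → ℝ}
    (hb : Summable b) (h : ∀ (s : Finset α) l, ∑ i ∈ s, a (i, l) ≤ b l) : Summable a := by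
  have hb0 : ∀ l, 0 ≤ b l := fun l => by simpa using h ∅ l
  refine summable_of_sum_le ha (c := ∑' l, b l) fun s => ?_
  obtain ⟨t, u, hs⟩ := sum_prod_le_of_nonneg ha s
  refine hs.trans ?_
  rw [Finset.sum_comm]
  exact (Finset.sum_le_sum fun l _ => h t l).trans (hb.sum_le_tsum u fun l _ => hb0 l)

/-- Bounded linear forms with square-summable norms form a family of Hilbert-Schmidt type: its
derivatives are constant, and square-summable because `f` is a Bessel family. -/
theorem isHSFamily_linear (hf : IsBessel 𝕜 f) {φ : κ → E →L[𝕜] 𝕜}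
    (hφ : Summable fun k => ‖φ k‖ ^ 2) (r : ℕ) : IsHSFamily f r (fun (_ : P) k w => φ k w) := by
  obtain ⟨L, hL⟩ := exists_clm_of_summable hφ
  have h0 : IsL2Family (fun (_ : P) k w => φ k w) := by
    simpa only [hL] using isL2Family_clm (P := P) L
  cases r with
  | zero => exact h0
  | succ r =>
    obtain ⟨N, hN⟩ := hf
    have hs : Summable fun q : ι × κ => ‖φ q.2 (f q.1)‖ ^ 2 := by
      refine summable_of_sum_prod_le (fun _ => by positivity) (hφ.mul_left (‖N‖ ^ 2))
        fun s k => ?_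
      simp only [← hN]
      refine (sum_sq_le_norm_sq _ s).trans ?_
      rw [← mul_pow]
      gcongr
      exact N.le_opNorm _
    refine ⟨h0, (isHSFamily_const (l2Mk _ hs) r).congr fun p q w => ?_⟩
    simp [derivFam]

/-- Bounded linear forms are functions of Hilbert-Schmidt type. -/
theorem linear_mem (hf : IsBessel 𝕜 f) (φ : E →L[𝕜] 𝕜) :
    (fun w => φ w) ∈ hsFunctions (𝕜 := 𝕜) f :=
  IsHSFun.mem (P := Unit) (F := fun _ w => φ w)
    (fun r => isHSFamily_linear hf (κ := Unit) (φ := fun _ => φ)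
      (by simp [Summable.of_finite]) r) ()

theorem IsHSFamily.mul {u v : P → κ → E → 𝕜} {r : ℕ} (hu : IsHSFamily f r u)
    (hv : IsHSFamily f r v) : IsHSFamily f r (fun p k w => u p k w * v p k w) := by
  have hσ : Function.Injective (Prod.snd : Unit × κ → κ) := fun _ _ h => Prod.ext rfl h
  refine (((hu.reindex hσ).contract (hv.reindex hσ)).reindex (σ := fun k => (k, k))
    fun _ _ h => congrArg Prod.fst h).congr fun p k w => ?_
  simp

theorem IsHSFamily.pow {u : P → κ → E → 𝕜} {r : ℕ} (hu : IsHSFamily f r u) (n : ℕ) :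
    IsHSFamily f r (fun p k w => u p k w ^ (n + 1)) := by
  induction n with
  | zero => simpa using hu
  | succ n ih => simpa only [pow_succ _ (n + 1)] using ih.mul hu

end Linear

/-! ### Order of vanishing -/

section Vanishing

variable {𝕜 E F G K : Type*} [RCLike 𝕜] [NormedAddCommGroup E] [NormedSpace 𝕜 E]
  [NormedAddCommGroup F] [NormedSpace 𝕜 F] [NormedAddCommGroup G] [NormedSpace 𝕜 G]
  [NormedAddCommGroup K] [NormedSpace 𝕜 K]

/-- The derivatives of `Φ` at `w` of all orders below `n` are zero. -/
def VanishesToOrder (𝕜 : Type*) {E F : Type*} [RCLike 𝕜] [NormedAddCommGroup E] [NormedSpace 𝕜 E]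
    [NormedAddCommGroup F] [NormedSpace 𝕜 F] (n : ℕ) (Φ : E → F) (w : E) : Prop :=
  ∀ m < n, iteratedFDeriv 𝕜 m Φ w = 0

theorem VanishesToOrder.bilinear {Φ : E → F} {Ψ : E → G} {m n : ℕ} {w : E} (B : F →L[𝕜] G →L[𝕜] K)
    (hΦ : VanishesToOrder 𝕜 m Φ w) (hΨ : VanishesToOrder 𝕜 n Ψ w) (cΦ : ContDiff 𝕜 ∞ Φ)
    (cΨ : ContDiff 𝕜 ∞ Ψ) : VanishesToOrder 𝕜 (m + n) (fun x => B (Φ x) (Ψ x)) w := by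
  intro j hj
  refine norm_le_zero_iff.1 ((B.norm_iteratedFDeriv_le_of_bilinear cΦ cΨ w (n := j)
    (mod_cast le_top)).trans_eq ?_)
  rw [Finset.sum_eq_zero, mul_zero]
  intro i hi
  rcases lt_or_ge i m with h | h
  · simp [hΦ i h]
  · have hi' := Finset.mem_range.1 hi
    simp [hΨ (j - i) (by omega)]

theorem vanishesToOrder_one {Φ : E → F} {w : E} (h : Φ w = 0) : VanishesToOrder 𝕜 1 Φ w := by
  intro m hm
  obtain rfl : m = 0 := by omega
  ext
  simpa using h

theorem vanishesToOrder_zero {Φ : E → F} {w : E} : VanishesToOrder 𝕜 0 Φ w := fun _ h => by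
  simp at h

theorem exists_pointwise_mul (κ : Type) : ∃ B : L2 𝕜 κ →L[𝕜] L2 𝕜 κ →L[𝕜] L2 𝕜 κ,
    ∀ x y k, B x y k = x k * y k := by
  obtain ⟨B, hB⟩ := exists_contraction (𝕜 := 𝕜) Unit κ κ
  have hσ : Function.Injective (Prod.snd : Unit × κ → κ) := fun _ _ h => Prod.ext rfl h
  have hδ : Function.Injective (fun k : κ => (k, k)) := fun _ _ h => congrArg Prod.fst h
  refine ⟨(ContinuousLinearMap.compL 𝕜 _ _ _ (reindex _ hδ)).comp
    (B.bilinearComp (reindex _ hσ) (reindex _ hσ)), fun x y k => ?_⟩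
  have h := hB (reindex _ hσ x) (reindex _ hσ y) k k
  change reindex _ hδ (B (reindex _ hσ x) (reindex _ hσ y)) k = _
  rw [reindex_apply, ← h.tsum_eq]
  simp

/-- A series `∑ₖ φₖ^{m+1} Qₖ` vanishes to order `m + 1` wherever all the `φₖ` do: as a product in
`ℓ²` of `m + 1` factors that vanish there, the sequence `(φₖ^{m+1})ₖ` vanishes to this order. -/
theorem vanishesToOrder_tsum_pow_mul {κ : Type} {φ : κ → E →L[𝕜] 𝕜}
    (hφ : Summable fun k => ‖φ k‖ ^ 2) {w : E} (hw : ∀ k, φ k w = 0) {Q : E → L2 𝕜 κ}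
    (hQ : ContDiff 𝕜 ∞ Q) (m : ℕ) :
    VanishesToOrder 𝕜 (m + 1) (fun x => ∑' k, φ k x ^ (m + 1) * Q x k) w := by
  obtain ⟨L, hL⟩ := exists_clm_of_summable hφ
  obtain ⟨B, hB⟩ := exists_pointwise_mul (𝕜 := 𝕜) κ
  have key : ∀ m, ∃ Φ : E → L2 𝕜 κ, ContDiff 𝕜 ∞ Φ ∧ (∀ x k, Φ x k = φ k x ^ (m + 1)) ∧
      VanishesToOrder 𝕜 (m + 1) Φ w := fun m => by
    have h1 : VanishesToOrder 𝕜 1 L w :=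
      vanishesToOrder_one (lp.ext (funext fun k => by rw [hL, hw]; rfl))
    induction m with
    | zero => exact ⟨L, L.contDiff, fun x k => by simp [hL], h1⟩
    | succ m ih =>
      obtain ⟨Φ, c, h, h'⟩ := ih
      exact ⟨fun x => B (Φ x) (L x), B.isBoundedBilinearMap.contDiff.comp (c.prodMk L.contDiff),
        fun x k => by rw [hB, h, hL, ← pow_succ], h'.bilinear B h1 c L.contDiff⟩
  obtain ⟨Φ, c, h, h'⟩ := key m
  obtain ⟨β, hβ⟩ := exists_pairing (𝕜 := 𝕜) κ
  have e : (fun x => ∑' k, φ k x ^ (m + 1) * Q x k) = fun x => β (Φ x) (Q x) := funext fun x => by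
    rw [← (hβ _ _).tsum_eq]
    simp only [h]
  rw [e]
  exact h'.bilinear β vanishesToOrder_zero c hQ

/-- For some `m`, a differential operator maps functions that vanish to order `m + 1` at a point to
functions that vanish there. -/
theorem IsDifferentialOp.exists_order {𝓕 : Subalgebra 𝕜 (E → 𝕜)} {T : 𝓕 →ₗ[𝕜] 𝓕}
    (hT : IsDifferentialOp 𝓕 T) : ∃ m : ℕ, ∀ (F : 𝓕) (w : E),
      VanishesToOrder 𝕜 (m + 1) (F : E → 𝕜) w → (T F : E → 𝕜) w = 0 := by
  obtain ⟨S, a, h⟩ := hT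
  refine ⟨S.sup id, fun F w hF => ?_⟩
  rw [h]
  refine Finset.sum_eq_zero fun m hm => ?_
  rw [hF m (Nat.lt_succ_of_le (Finset.le_sup (f := id) hm)), map_zero]

end Vanishing

/-! ### Uniformly Hilbert-Schmidt quadratic forms -/

/-- For a divergent series `∑ aⱼ`, scaled finite partial sums can be large although their squares,
in the sense of the Hilbert-Schmidt norm, are small: with `N² = ∑_J aⱼ` large, take `τ = ε / N`. -/
theorem exists_finset_of_not_summable {a : ℕ → ℝ} (ha : ∀ j, 0 ≤ a j) (h : ¬Summable a) (k : ℕ)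
    {ε : ℝ} (hε : 0 < ε) (R : ℝ) : ∃ (J : Finset ℕ) (τ : ℝ), k ∉ J ∧
      τ ^ 2 * ∑ j ∈ J, a j ≤ ε ^ 2 ∧ R ≤ τ * ∑ j ∈ J, a j := by
  obtain ⟨s, hs⟩ : ∃ s : Finset ℕ, (|R| / ε + 1) ^ 2 + a k < ∑ j ∈ s, a j := by
    by_contra! hc
    exact h (summable_of_sum_le ha hc)
  have hN : (|R| / ε + 1) ^ 2 ≤ ∑ j ∈ s.erase k, a j := by
    have : ∑ j ∈ s, a j ≤ ∑ j ∈ s.erase k, a j + a k := by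
      by_cases hk : k ∈ s
      · rw [Finset.sum_erase_add _ _ hk]
      · rw [Finset.erase_eq_of_notMem hk]
        linarith [ha k]
    linarith
  have hN' := Real.le_sqrt_of_sq_le hN
  set N := Real.sqrt (∑ j ∈ s.erase k, a j) with hNdef
  have hR : 0 ≤ |R| / ε := by positivity
  have hN0 : 0 < N := by linarith
  have hsq : ∑ j ∈ s.erase k, a j = N ^ 2 :=
    (Real.sq_sqrt (Finset.sum_nonneg fun j _ => ha j)).symm
  refine ⟨s.erase k, ε / N, Finset.notMem_erase k s, ?_, ?_⟩
  · rw [hsq, div_pow, div_mul_cancel₀ _ (by positivity)]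
  · rw [hsq]
    have : ε / N * N ^ 2 = ε * N := by field_simp
    rw [this]
    calc R ≤ |R| := le_abs_self R
      _ = ε * (|R| / ε) := by field_simp
      _ ≤ _ := by gcongr; linarith

section QuadraticForms

variable {𝕜 E : Type*} [RCLike 𝕜] [NormedAddCommGroup E] [NormedSpace 𝕜 E]

/-- The quadratic form `τ ∑_{j ∈ J} ψⱼ ηⱼ`. -/
def quadForm (ψ η : ℕ → E →L[𝕜] 𝕜) (J : Finset ℕ) (τ : ℝ) (w : E) : 𝕜 :=
  (τ : 𝕜) * ∑ j ∈ J, ψ j w * η j w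

variable {ψ η : ℕ → E →L[𝕜] 𝕜}

theorem hasFDerivAt_quadForm (J : Finset ℕ) (τ : ℝ) (w : E) :
    HasFDerivAt (quadForm ψ η J τ) ((τ : 𝕜) • ∑ j ∈ J, (ψ j w • η j + η j w • ψ j)) w :=
  (HasFDerivAt.fun_sum fun j _ => (ψ j).hasFDerivAt.mul (η j).hasFDerivAt).const_mul _

theorem fderiv_quadForm_eq_zero {J : Finset ℕ} {τ : ℝ} {w : E} (hψ : ∀ j ∈ J, ψ j w = 0)
    (hη : ∀ j ∈ J, η j w = 0) : fderiv 𝕜 (quadForm ψ η J τ) w = 0 := by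
  rw [(hasFDerivAt_quadForm J τ w).fderiv, Finset.sum_eq_zero, smul_zero]
  intro j hj
  refine ContinuousLinearMap.ext fun x => ?_
  change ψ j w * η j x + η j w * ψ j x = 0
  rw [hψ j hj, hη j hj, zero_mul, zero_mul, add_zero]

theorem norm_sum_smul_le (hη : ∀ w (t : Finset ℕ), ∑ j ∈ t, ‖η j w‖ ^ 2 ≤ ‖w‖ ^ 2)
    (J : Finset ℕ) (c : ℕ → 𝕜) : ‖∑ j ∈ J, c j • η j‖ ^ 2 ≤ ∑ j ∈ J, ‖c j‖ ^ 2 := by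
  have h : ‖∑ j ∈ J, c j • η j‖ ≤ Real.sqrt (∑ j ∈ J, ‖c j‖ ^ 2) := by
    refine ContinuousLinearMap.opNorm_le_bound _ (Real.sqrt_nonneg _) fun w => ?_
    refine le_of_sq_le_sq ?_ (by positivity)
    rw [mul_pow, Real.sq_sqrt (by positivity)]
    calc ‖(∑ j ∈ J, c j • η j) w‖ ^ 2 ≤ (∑ j ∈ J, ‖c j‖ * ‖η j w‖) ^ 2 := by
          gcongr
          rw [sum_apply]
          exact (norm_sum_le _ _).trans_eq (Finset.sum_congr rfl fun j _ => norm_mul _ _)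
      _ ≤ (∑ j ∈ J, ‖c j‖ ^ 2) * ∑ j ∈ J, ‖η j w‖ ^ 2 :=
          Finset.sum_mul_sq_le_sq_mul_sq _ _ _
      _ ≤ _ := by gcongr; exact hη w J
  calc _ ≤ Real.sqrt (∑ j ∈ J, ‖c j‖ ^ 2) ^ 2 := by gcongr
    _ = _ := Real.sq_sqrt (by positivity)

/-- A family of directions, of which the second half is dual to the forms `η` and annihilated by the
forms `ψ`, the first half is annihilated by the forms `η`, and on which the Bessel inequality holds
for `ψⱼ` with bound `aⱼ`. -/
structure IsAdapted (f : ℕ ⊕ ℕ → E) (ψ η : ℕ → E →L[𝕜] 𝕜) (a : ℕ → ℝ) : Prop where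
  bessel : ∀ w (t : Finset ℕ), ∑ j ∈ t, ‖η j w‖ ^ 2 ≤ ‖w‖ ^ 2
  norm_le : ∀ j, ‖ψ j‖ ^ 2 ≤ a j
  bessel_inl : ∀ j (t : Finset ℕ), ∑ i ∈ t, ‖ψ j (f (Sum.inl i))‖ ^ 2 ≤ a j
  inl : ∀ i j, η j (f (Sum.inl i)) = 0
  inr : ∀ i j, ψ j (f (Sum.inr i)) = 0
  dual : ∀ i j, η j (f (Sum.inr i)) = if j = i then 1 else 0

/-- The derivatives of `quadForm ψ η J τ` in the directions `f i`, as linear forms. -/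
def quadDeriv (f : ℕ ⊕ ℕ → E) (ψ η : ℕ → E →L[𝕜] 𝕜) (J : Finset ℕ) (τ : ℝ) :
    ℕ ⊕ ℕ → E →L[𝕜] 𝕜 :=
  Sum.elim (fun i => (τ : 𝕜) • ∑ j ∈ J, ψ j (f (Sum.inl i)) • η j)
    (fun i => if i ∈ J then (τ : 𝕜) • ψ i else 0)

variable {f : ℕ ⊕ ℕ → E} {a : ℕ → ℝ}

theorem fderiv_quadForm (h : IsAdapted f ψ η a) (J : Finset ℕ) (τ : ℝ) (w : E) (i : ℕ ⊕ ℕ) :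
    fderiv 𝕜 (quadForm ψ η J τ) w (f i) = quadDeriv f ψ η J τ i w := by
  rw [(hasFDerivAt_quadForm J τ w).fderiv]
  rcases i with i | i
  · simp [quadDeriv, h.inl, mul_comm]
  · by_cases hi : i ∈ J <;> simp [quadDeriv, h.inr, h.dual, hi]

/-- The Hilbert-Schmidt norm of the Hessian of `quadForm ψ η J τ` is controlled by `τ² ∑_J aⱼ`. -/
theorem sum_sq_quadDeriv_le (h : IsAdapted f ψ η a) (J : Finset ℕ) (τ : ℝ) (s : Finset (ℕ ⊕ ℕ)) :
    ∑ i ∈ s, ‖quadDeriv f ψ η J τ i‖ ^ 2 ≤ 2 * (τ ^ 2 * ∑ j ∈ J, a j) := by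
  have ha : ∀ j, 0 ≤ a j := fun j => (sq_nonneg _).trans (h.norm_le j)
  rw [← Finset.toLeft_disjSum_toRight (u := s), Finset.sum_disjSum]
  have h1 : ∑ i ∈ s.toLeft, ‖quadDeriv f ψ η J τ (Sum.inl i)‖ ^ 2 ≤ τ ^ 2 * ∑ j ∈ J, a j := by
    calc _ ≤ ∑ i ∈ s.toLeft, τ ^ 2 * ∑ j ∈ J, ‖ψ j (f (Sum.inl i))‖ ^ 2 := by
          refine Finset.sum_le_sum fun i _ => ?_
          change ‖(τ : 𝕜) • ∑ j ∈ J, ψ j (f (Sum.inl i)) • η j‖ ^ 2 ≤ _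
          rw [norm_smul, mul_pow, RCLike.norm_ofReal, sq_abs]
          gcongr
          exact norm_sum_smul_le h.bessel J _
      _ ≤ _ := by
          rw [← Finset.mul_sum, Finset.sum_comm]
          gcongr with j
          exact h.bessel_inl j _
  have h2 : ∑ i ∈ s.toRight, ‖quadDeriv f ψ η J τ (Sum.inr i)‖ ^ 2 ≤ τ ^ 2 * ∑ j ∈ J, a j := by
    calc _ ≤ ∑ i ∈ s.toRight, if i ∈ J then τ ^ 2 * a i else 0 := by
          refine Finset.sum_le_sum fun i _ => ?_
          change ‖if i ∈ J then (τ : 𝕜) • ψ i else 0‖ ^ 2 ≤ _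
          split_ifs
          · rw [norm_smul, mul_pow, RCLike.norm_ofReal, sq_abs]
            gcongr
            exact h.norm_le i
          · simp
      _ ≤ _ := by
          rw [← Finset.sum_filter, Finset.mul_sum]
          exact Finset.sum_le_sum_of_subset_of_nonneg (fun i hi => (Finset.mem_filter.1 hi).2)
            fun j _ _ => mul_nonneg (sq_nonneg _) (ha j)
  linarith

/-- A sequence of quadratic forms `quadForm ψ η (J l) (τ l)` whose Hessians have square-summable
Hilbert-Schmidt norms is a family of Hilbert-Schmidt type, because its derivatives are linear
forms with square-summable norms. -/
theorem isHSFamily_quadForm (hf : IsBessel 𝕜 f) (h : IsAdapted f ψ η a) {J : ℕ → Finset ℕ}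
    {τ : ℕ → ℝ} (hs : Summable fun l => τ l ^ 2 * ∑ j ∈ J l, a j) (r : ℕ) :
    IsHSFamily f r (fun (_ : Unit) l w => quadForm ψ η (J l) (τ l) w) := by
  have h0 : IsL2Family (fun (_ : Unit) l w => quadForm ψ η (J l) (τ l) w) := by
    -- The forms `η` take `ℓ²`-values but do not have square-summable norms. So the scaling and the
    -- restriction to `J l` are attached to `ψ`, and the sum is a contraction in `ℓ²` only.
    let φ : ℕ × ℕ → E →L[𝕜] 𝕜 := fun q => if q.1 ∈ J q.2 then (τ q.2 : 𝕜) • ψ q.1 else 0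
    have hφ : Summable fun q => ‖φ q‖ ^ 2 := by
      refine summable_of_sum_prod_le (fun _ => by positivity) (hs.mul_left 2) fun s l => ?_
      refine le_trans ?_ (sum_sq_quadDeriv_le h (J l) (τ l) (s.map ⟨Sum.inr, Sum.inr_injective⟩))
      rw [Finset.sum_map]
      rfl
    obtain ⟨L, hL, -⟩ := exists_clm_l2 (𝕜 := 𝕜) (V := E) (κ := ℕ × Unit)
      (fun w q => η q.1 w) (fun _ _ _ => map_add _ _ _) (fun _ _ _ => map_smul _ _ _) 1
      zero_le_one fun w s => by
        obtain ⟨t, u, hs⟩ := sum_prod_le_of_nonneg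
          (a := fun q : ℕ × Unit => ‖η q.1 w‖ ^ 2) (fun _ => by positivity) s
        refine hs.trans ?_
        rw [Finset.sum_comm, one_mul]
        refine (Finset.sum_le_sum_of_subset_of_nonneg (Finset.subset_univ u)
          fun _ _ _ => by positivity).trans ?_
        simpa using h.bessel w t
    have hy : IsHSFamily f 0 (fun (_ : Unit) (q : ℕ × Unit) w => η q.1 w) := by
      have := isL2Family_clm (P := Unit) L
      simp only [hL] at this
      exact this
    have h1 := (isHSFamily_linear (P := Unit) hf hφ 0).contract hy
    refine IsHSFamily.congr (f := f) (r := 0) (h1.reindex (σ := fun l => (l, ()))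
      fun _ _ h => congrArg Prod.fst h) fun p l w => ?_
    rw [tsum_eq_sum (s := J l) fun j hj => by simp [φ, hj], quadForm, Finset.mul_sum]
    refine Finset.sum_congr rfl fun j hj => ?_
    simp [φ, hj, mul_assoc]
  cases r with
  | zero => exact h0
  | succ r =>
    refine ⟨h0, (isHSFamily_linear hf
      (φ := fun q : (ℕ ⊕ ℕ) × ℕ => quadDeriv f ψ η (J q.2) (τ q.2) q.1) ?_ r).congr
      fun p q w => (fderiv_quadForm h _ _ w q.1).symm⟩
    exact summable_of_sum_prod_le (fun _ => by positivity) (hs.mul_left 2) fun s l =>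
      sum_sq_quadDeriv_le h (J l) (τ l) s

end QuadraticForms

/-! ### Coordinates on the phase space -/

section Coordinates

variable {𝕜 H : Type*} [RCLike 𝕜] [NormedAddCommGroup H] [InnerProductSpace 𝕜 H]
  (e : HilbertBasis ℕ 𝕜 H) (S : H →L[𝕜] H)

/-- The linear form `(x, ξ) ↦ ⟨S eⱼ, x⟩`. -/
def imageForm (j : ℕ) : Phase 𝕜 H →L[𝕜] 𝕜 :=
  (innerSL 𝕜 (S (e j))).comp (ContinuousLinearMap.fst 𝕜 H (StrongDual 𝕜 H))

/-- The linear form `(x, ξ) ↦ ξ(eⱼ)`. -/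
def momentum (j : ℕ) : Phase 𝕜 H →L[𝕜] 𝕜 := coord e (Sum.inr j)

theorem imageForm_apply (j : ℕ) (w : Phase 𝕜 H) :
    imageForm e S j w = inner 𝕜 (S (e j)) w.1 := rfl

theorem momentum_dualVec (i j : ℕ) : momentum e j (0, dualVec e i) = if j = i then 1 else 0 := by
  change inner 𝕜 (e i) (e j) = _
  rw [orthonormal_iff_ite.1 e.orthonormal]
  simp [eq_comm]

theorem isAdapted_phaseBasis [CompleteSpace H] :
    IsAdapted (phaseBasis e) (imageForm e S) (momentum e) (fun j => ‖S (e j)‖ ^ 2) where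
  bessel w t := (sum_sq_apply_basis_le e w.2 t).trans (by gcongr; exact norm_snd_le w)
  norm_le j := by
    gcongr
    exact ContinuousLinearMap.opNorm_le_bound _ (norm_nonneg _) fun w =>
      (norm_inner_le_norm _ _).trans (by gcongr; exact norm_fst_le w)
  bessel_inl j t := by
    refine (Finset.sum_le_sum fun i _ => ?_).trans
      (e.orthonormal.sum_inner_products_le (S (e j)) (s := t))
    rw [norm_inner_symm]
    rfl
  inl i j := rfl
  inr i j := inner_zero_right _
  dual := momentum_dualVec e

end Coordinates

/-! ### Lacunary series of quadratic forms -/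

section Lacunary

variable {𝕜 E : Type*} [RCLike 𝕜] [NormedAddCommGroup E] [NormedSpace 𝕜 E]
  {ψ η : ℕ → E →L[𝕜] 𝕜} {f : ℕ ⊕ ℕ → E} {a : ℕ → ℝ} {J : ℕ → Finset ℕ} {τ : ℕ → ℝ} {c : ℕ → 𝕜}

/-- The function `∑ₗ (cₗ ηₗ)^{m+1} qₗ`, where `qₗ = quadForm ψ η (J l) (τ l)`. -/
def lacunarySeries (ψ η : ℕ → E →L[𝕜] 𝕜) (J : ℕ → Finset ℕ) (τ : ℕ → ℝ) (m : ℕ) (c : ℕ → 𝕜)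
    (w : E) : 𝕜 :=
  ∑' l, (c l • η l) w ^ (m + 1) * quadForm ψ η (J l) (τ l) w

theorem IsAdapted.summable_smul (h : IsAdapted f ψ η a) (hc : Summable fun l => ‖c l‖ ^ 2) :
    Summable fun l => ‖c l • η l‖ ^ 2 := by
  refine hc.of_nonneg_of_le (fun _ => by positivity) fun l => ?_
  have hη : ‖η l‖ ≤ 1 := ContinuousLinearMap.opNorm_le_bound _ zero_le_one fun w => by
    have := h.bessel w {l}
    rw [Finset.sum_singleton] at this
    rw [one_mul]
    exact le_of_sq_le_sq this (norm_nonneg _)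
  rw [norm_smul, mul_pow]
  exact mul_le_of_le_one_right (by positivity) (pow_le_one₀ (norm_nonneg _) hη)

theorem lacunarySeries_mem (hf : IsBessel 𝕜 f) (h : IsAdapted f ψ η a)
    (hs : Summable fun l => τ l ^ 2 * ∑ j ∈ J l, a j) (m : ℕ) (hc : Summable fun l => ‖c l‖ ^ 2) :
    lacunarySeries ψ η J τ m c ∈ hsFunctions (𝕜 := 𝕜) f := by
  refine IsHSFun.mem (P := Unit) (F := fun _ => lacunarySeries ψ η J τ m c) (fun r => ?_) ()
  have hσ : Function.Injective (Prod.fst : ℕ × Unit → ℕ) := fun _ _ h => Prod.ext h rfl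
  have h1 := ((isHSFamily_linear (P := Unit) hf (h.summable_smul hc) r).pow m).reindex hσ
  have h2 := (isHSFamily_quadForm hf h hs r).reindex hσ
  exact (h1.contract h2).reindex (σ := fun _ : Unit => ((), ())) (fun _ _ _ => rfl)

/-- The term of index `k` can be split off a lacunary series. -/
theorem lacunarySeries_eq_add (hf : IsBessel 𝕜 f) (h : IsAdapted f ψ η a)
    (hs : Summable fun l => τ l ^ 2 * ∑ j ∈ J l, a j) (m : ℕ) (hc : Summable fun l => ‖c l‖ ^ 2)
    (k : ℕ) (w : E) : lacunarySeries ψ η J τ m c w =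
      c k ^ (m + 1) * (η k w ^ (m + 1) * quadForm ψ η (J k) (τ k) w) +
        lacunarySeries ψ η J τ m (fun l => if l = k then 0 else c l) w := by
  obtain ⟨x, hx⟩ := ((isHSFamily_linear (P := Unit) hf (h.summable_smul hc) 0).pow
    m).isL2Family.exists_l2 () w
  obtain ⟨y, hy⟩ := (isHSFamily_quadForm hf h hs 0).isL2Family.exists_l2 () w
  have hsum := (hasSum_pairing x y).summable
  simp only [hx, hy] at hsum
  rw [lacunarySeries, hsum.tsum_eq_add_tsum_ite k]
  congr 1
  · simp [mul_pow, mul_assoc]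
  · refine tsum_congr fun l => ?_
    by_cases hl : l = k <;> simp [hl]

theorem vanishesToOrder_lacunarySeries (hf : IsBessel 𝕜 f) (h : IsAdapted f ψ η a)
    (hs : Summable fun l => τ l ^ 2 * ∑ j ∈ J l, a j) (m : ℕ) (hc : Summable fun l => ‖c l‖ ^ 2)
    {w : E} (hw : ∀ l, c l * η l w = 0) :
    VanishesToOrder 𝕜 (m + 1) (lacunarySeries ψ η J τ m c) w := by
  obtain ⟨Q, h1, -, h3⟩ := (isHSFamily_quadForm hf h hs 0).isL2Family
  have := vanishesToOrder_tsum_pow_mul (h.summable_smul hc) (w := w) hw (h1 ()) m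
  simp only [h3] at this
  exact this

theorem tendsto_half_pow_smul {v : ℕ → E} (hv : ∀ k, ‖v k‖ ≤ 1) :
    Filter.Tendsto (fun k => (((1 / 2 : ℝ) ^ k : ℝ) : 𝕜) • v k) Filter.atTop (nhds 0) := by
  refine squeeze_zero_norm (fun k => ?_)
    (tendsto_pow_atTop_nhds_zero_of_lt_one (r := (1 / 2 : ℝ)) (by norm_num) (by norm_num))
  rw [norm_smul, RCLike.norm_ofReal, abs_of_nonneg (by positivity)]
  exact mul_le_of_le_one_right (by positivity) (hv k)

end Lacunary

/-! ### Equivalent star-products differ by a Hilbert-Schmidt operator -/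

section Necessity

open Finset.HasAntidiagonal

variable {𝕜 H : Type*} [RCLike 𝕜] [NormedAddCommGroup H] [InnerProductSpace 𝕜 H]
  [CompleteSpace H] (e : HilbertBasis ℕ 𝕜 H) {A B S : H →L[𝕜] H}

/-- The first coefficient of an equivalence exhibits `E_{A-B}` as a Hochschild coboundary. -/
theorem exists_coboundary (h : (starProduct e A).Equivalent (starProduct e B)) :
    ∃ T : FHS e →ₗ[𝕜] FHS e, IsDifferentialOp (FHS e) T ∧
      ∀ (F G : FHS e) (w : Phase 𝕜 H), (T (F * G) : Phase 𝕜 H → 𝕜) w =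
        (T F : Phase 𝕜 H → 𝕜) w * (G : Phase 𝕜 H → 𝕜) w +
        (F : Phase 𝕜 H → 𝕜) w * (T G : Phase 𝕜 H → 𝕜) w +
        cocycleE (A - B) (F : Phase 𝕜 H → 𝕜) G w := by
  obtain ⟨T, h0, hT, h⟩ := h
  refine ⟨T 1, (hT 1 le_rfl).1, fun F G w => ?_⟩
  have h1 := (intertwine_iff _ _ _ F G).1 (h F G) 1
  have a0 : antidiagonal 0 = {((0, 0) : ℕ × ℕ)} := rfl
  have a1 : antidiagonal 1 = {((0, 1) : ℕ × ℕ), (1, 0)} := rfl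
  have h01 : ((0, 1) : ℕ × ℕ) ≠ (1, 0) := by decide
  simp only [a1, Finset.sum_pair h01, a0, Finset.sum_singleton, h0, LinearMap.id_apply,
    (starProduct e A).zeroth, (starProduct e B).zeroth] at h1
  have h2 := congrArg (fun F : FHS e => (F : Phase 𝕜 H → 𝕜) w) h1
  change (F : Phase 𝕜 H → 𝕜) w * (T 1 G : Phase 𝕜 H → 𝕜) w +
    (T 1 F : Phase 𝕜 H → 𝕜) w * (G : Phase 𝕜 H → 𝕜) w +
    (starCoeff e A 1 F G : Phase 𝕜 H → 𝕜) w =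
    (starCoeff e B 1 F G : Phase 𝕜 H → 𝕜) w + (T 1 (F * G) : Phase 𝕜 H → 𝕜) w at h2
  rw [starCoeff_one_eq, starCoeff_one_eq] at h2
  have h3 : cocycleE (A - B) (F : Phase 𝕜 H → 𝕜) G w =
      cocycleE A (F : Phase 𝕜 H → 𝕜) G w - cocycleE B (F : Phase 𝕜 H → 𝕜) G w := by
    simp only [cocycleE, sub_apply, map_sub]
    ring
  rw [h3]
  linear_combination -h2

theorem cocycleE_eq_zero {F G : Phase 𝕜 H → 𝕜} {w : Phase 𝕜 H}
    (hF : ∀ x, fderiv 𝕜 F w (x, 0) = 0) (hG : ∀ x, fderiv 𝕜 G w (x, 0) = 0) :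
    cocycleE S F G w = 0 := by
  have hF' : ∀ x, D₁ F w x = 0 := hF
  have hG' : ∀ x, D₁ G w x = 0 := hG
  rw [cocycleE, hF', hG', add_zero]

theorem cocycleE_imageForm_momentum (j : ℕ) (w : Phase 𝕜 H) :
    cocycleE S (imageForm e S j) (momentum e j) w = ((‖S (e j)‖ ^ 2 : ℝ) : 𝕜) := by
  have h1 : ∀ x, D₁ (momentum e j) w x = 0 := fun x => by
    change fderiv 𝕜 (momentum e j) w (x, 0) = 0
    rw [ContinuousLinearMap.fderiv]
    rfl
  have h2 : D₂ (momentum e j) w = e j := bidual_eq fun ξ => by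
    rw [ContinuousLinearMap.fderiv]
    rfl
  rw [cocycleE, h1, h2, add_zero]
  change fderiv 𝕜 (imageForm e S j) w (S (e j), 0) = _
  rw [ContinuousLinearMap.fderiv, imageForm_apply, inner_self_eq_norm_sq_to_K]
  norm_cast

/-- Evaluation at a point. -/
def evalAt (w : Phase 𝕜 H) : FHS e →ₐ[𝕜] 𝕜 := (Pi.evalAlgHom 𝕜 (fun _ => 𝕜) w).comp (FHS e).val

/-- A bounded linear form, as an element of the algebra. -/
def linearFun (φ : Phase 𝕜 H →L[𝕜] 𝕜) : FHS e :=
  ⟨fun w => φ w, linear_mem (isBessel_phaseBasis e) φ⟩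

/-- `E_S` is the coboundary of a differential operator `T` only if `S` is Hilbert-Schmidt.
Otherwise, for `ψⱼ = ⟨S eⱼ, x⟩` and `ηⱼ = ξ(eⱼ)`, there is a function `F = ∑ₗ (2⁻ˡ ηₗ)^{m+1} qₗ` of
Hilbert-Schmidt type, with `qₗ` a multiple of `∑_{j ∈ J l} ψⱼ ηⱼ`, that vanishes to such an order at
`0` that `T F (0) = 0`, whereas `|T F| ≥ 1` at the points `2⁻ᵏ (0, eₖ*)`, which converge to `0`. -/
theorem mem_hilbertSchmidt_of_coboundary {T : FHS e →ₗ[𝕜] FHS e} (hT : IsDifferentialOp (FHS e) T)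
    (h : ∀ (F G : FHS e) (w : Phase 𝕜 H), (T (F * G) : Phase 𝕜 H → 𝕜) w =
      (T F : Phase 𝕜 H → 𝕜) w * (G : Phase 𝕜 H → 𝕜) w +
      (F : Phase 𝕜 H → 𝕜) w * (T G : Phase 𝕜 H → 𝕜) w +
      cocycleE S (F : Phase 𝕜 H → 𝕜) G w) : S ∈ hilbertSchmidt e := by
  by_contra hS
  have hS' : ¬Summable fun j => ‖S (e j)‖ ^ 2 := hS
  obtain ⟨m, hm⟩ := hT.exists_order
  -- `τ l ^ 2 * ∑ ≤ 4⁻ˡ` makes the Hilbert-Schmidt norms of the `qₗ` summable, and the lower bound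
  -- `4^{l(m+1)}` compensates the factors `2^{-l(m+1)}` from the coefficient and from `ηₗ` at `w l`.
  choose J τ hJ hτ hR using fun l : ℕ => exists_finset_of_not_summable
    (fun j => sq_nonneg ‖S (e j)‖) hS' l (ε := (1 / 2) ^ l) (by positivity) ((4 ^ l) ^ (m + 1))
  have hf := isBessel_phaseBasis e
  have hA := isAdapted_phaseBasis e S
  let c : ℕ → 𝕜 := fun l => (((1 / 2 : ℝ) ^ l : ℝ) : 𝕜)
  have hgeo : Summable fun l : ℕ => ((1 / 2 : ℝ) ^ l) ^ 2 := by
    simp only [← pow_mul, mul_comm _ 2]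
    simp only [pow_mul]
    exact summable_geometric_of_lt_one (by norm_num) (by norm_num)
  have hc : Summable fun l => ‖c l‖ ^ 2 := by
    simpa only [c, RCLike.norm_ofReal, sq_abs] using hgeo
  have hs : Summable fun l => τ l ^ 2 * ∑ j ∈ J l, ‖S (e j)‖ ^ 2 :=
    hgeo.of_nonneg_of_le (fun l => by positivity) hτ
  let F : FHS e := ⟨_, lacunarySeries_mem hf hA hs m hc⟩
  let v : ℕ → Phase 𝕜 H := fun k => (0, dualVec e k)
  let w : ℕ → Phase 𝕜 H := fun k => c k • v k
  have hηw : ∀ k j, momentum e j (w k) = if j = k then c k else 0 := fun k j => by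
    simp only [w, v, map_smul, momentum_dualVec]
    simp
  have hψw : ∀ k j, imageForm e S j (w k) = 0 := fun k j => by
    simp only [w, v, map_smul, imageForm_apply, inner_zero_right, smul_zero]
  let ψ : ℕ → FHS e := fun j => linearFun e (imageForm e S j)
  let η : ℕ → FHS e := fun j => linearFun e (momentum e j)
  let q : ℕ → FHS e := fun k => (τ k : 𝕜) • ∑ j ∈ J k, ψ j * η j
  have hq : ∀ k, (q k : Phase 𝕜 H → 𝕜) = quadForm (imageForm e S) (momentum e) (J k) (τ k) :=
    fun k => funext fun x => by
      change evalAt e x (q k) = _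
      simp only [q, map_smul, map_sum, map_mul]
      rfl
  have hηJ : ∀ k, ∀ j ∈ J k, momentum e j (w k) = 0 := fun k j hj => by
    rw [hηw, if_neg]
    rintro rfl
    exact hJ _ hj
  -- At `w k` all `ψⱼ` and all `ηⱼ` with `j ∈ J k` are zero, so that only the values of `E_S`
  -- remain.
  have hTq : ∀ k, (T (q k) : Phase 𝕜 H → 𝕜) (w k) =
      ((τ k * ∑ j ∈ J k, ‖S (e j)‖ ^ 2 : ℝ) : 𝕜) := fun k => by
    change evalAt e (w k) (T (q k)) = _
    simp only [q, map_smul, map_sum]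
    have : ∀ j ∈ J k, evalAt e (w k) (T (ψ j * η j)) = ((‖S (e j)‖ ^ 2 : ℝ) : 𝕜) := fun j hj => by
      refine (h (ψ j) (η j) (w k)).trans ?_
      change _ * momentum e j (w k) + imageForm e S j (w k) * _ +
        cocycleE S (imageForm e S j) (momentum e j) (w k) = _
      rw [hηJ k j hj, hψw, cocycleE_imageForm_momentum]
      ring
    rw [Finset.sum_congr rfl this, smul_eq_mul]
    push_cast
    rfl
  have hTF : ∀ k, (T F : Phase 𝕜 H → 𝕜) (w k) =
      (((1 / 2) ^ k) ^ (m + 1) * (((1 / 2) ^ k) ^ (m + 1) *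
        (τ k * ∑ j ∈ J k, ‖S (e j)‖ ^ 2)) : ℝ) := fun k => by
    have hc' : Summable fun l => ‖if l = k then 0 else c l‖ ^ 2 :=
      hc.of_nonneg_of_le (fun _ => by positivity) fun l => by split_ifs <;> simp
    -- The other terms of the series vanish to order `m + 1` at `w k`, as `ηₗ (w k) = 0` for
    -- `l ≠ k`.
    let R : FHS e := ⟨_, lacunarySeries_mem hf hA hs m hc'⟩
    have hF : F = c k ^ (m + 1) • (η k ^ (m + 1) * q k) + R := Subtype.ext <| funext fun x => by
      refine (lacunarySeries_eq_add hf hA hs m hc k x).trans ?_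
      change _ = c k ^ (m + 1) * (momentum e k x ^ (m + 1) * (q k : Phase 𝕜 H → 𝕜) x) + _
      rw [hq]
    have hR0 : (T R : Phase 𝕜 H → 𝕜) (w k) = 0 :=
      hm R (w k) (vanishesToOrder_lacunarySeries hf hA hs m hc' fun l => by
        rw [hηw]
        split_ifs <;> simp)
    have hq0 : (q k : Phase 𝕜 H → 𝕜) (w k) = 0 := by
      rw [hq, quadForm, Finset.sum_eq_zero, mul_zero]
      intro j _
      rw [hψw, zero_mul]
    have hE : cocycleE S ((η k ^ (m + 1) : FHS e) : Phase 𝕜 H → 𝕜) (q k) (w k) = 0 := by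
      refine cocycleE_eq_zero (fun x => ?_) fun x => ?_
      · change fderiv 𝕜 (fun y => momentum e k y ^ (m + 1)) (w k) (x, 0) = 0
        rw [((momentum e k).hasFDerivAt.pow (m + 1)).fderiv]
        exact mul_zero (_ : 𝕜)
      · rw [hq, fderiv_quadForm_eq_zero (fun j _ => hψw k j) (hηJ k)]
        rfl
    rw [hF]
    change evalAt e (w k) (T (c k ^ (m + 1) • (η k ^ (m + 1) * q k) + R)) = _
    rw [map_add, map_add, map_smul, map_smul]
    change c k ^ (m + 1) * (T (η k ^ (m + 1) * q k) : Phase 𝕜 H → 𝕜) (w k) +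
      (T R : Phase 𝕜 H → 𝕜) (w k) = _
    rw [hR0, h, hE, hq0, hTq]
    change _ * (_ + momentum e k (w k) ^ (m + 1) * _ + _) + _ = _
    rw [hηw, if_pos rfl]
    simp only [c]
    push_cast
    ring
  have h1 : ∀ k, 1 ≤ ‖(T F : Phase 𝕜 H → 𝕜) (w k)‖ := fun k => by
    rw [hTF, RCLike.norm_ofReal]
    refine le_trans ?_ (le_abs_self _)
    rw [← mul_assoc, ← mul_pow, ← mul_pow]
    calc (1 : ℝ) = ((1 / 2 * (1 / 2)) ^ k) ^ (m + 1) * (4 ^ k) ^ (m + 1) := by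
          rw [← mul_pow, ← mul_pow]; norm_num
      _ ≤ _ := by gcongr; exact hR k
  have h0 : (T F : Phase 𝕜 H → 𝕜) 0 = 0 :=
    hm F 0 (vanishesToOrder_lacunarySeries hf hA hs m hc fun l => by rw [map_zero, mul_zero])
  have hv : ∀ k, ‖v k‖ ≤ 1 := fun k => by
    simp only [v, dualVec, Prod.norm_def, innerSL_apply_norm, e.orthonormal.1 k, norm_zero]
    simp
  have hw : Filter.Tendsto w Filter.atTop (nhds 0) := tendsto_half_pow_smul hv
  have hcont : Continuous (T F : Phase 𝕜 H → 𝕜) := (T F).2.1.continuous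
  have hlim := ((hcont.tendsto 0).comp hw).norm
  rw [h0, norm_zero] at hlim
  exact absurd (ge_of_tendsto' hlim h1) (by norm_num)

theorem equivalent_iff : (starProduct e A).Equivalent (starProduct e B) ↔
    A - B ∈ hilbertSchmidt e := by
  refine ⟨fun h => ?_, equivalent_of_mem e A B⟩
  obtain ⟨T, hT, h⟩ := exists_coboundary e h
  exact mem_hilbertSchmidt_of_coboundary e hT h

end Necessity

end HilbertStar

end

open HilbertStar in
theorem theorem2 {𝕜 H : Type*} [RCLike 𝕜] [NormedAddCommGroup H] [InnerProductSpace 𝕜 H]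
    [CompleteSpace H] (e : HilbertBasis ℕ 𝕜 H) :
    ∃ br : FHS e →ₗ[𝕜] FHS e →ₗ[𝕜] FHS e,
      (∀ (F G : FHS e) (w : Phase 𝕜 H),
        (br F G : Phase 𝕜 H → 𝕜) w = canonicalBracket (F : Phase 𝕜 H → 𝕜) G w) ∧
      IsPoissonBracket (FHS e) br ∧
      ∃ star : (H →L[𝕜] H) → StarProduct (FHS e) br,
        (∀ A, IsExponential e A (star A)) ∧
        (∀ A B, (star A).Equivalent (star B) ↔ A - B ∈ hilbertSchmidt e) ∧
        ∃ h : Equivalence (fun s t : Set.range star => s.1.Equivalent t.1),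
          ∃ Ψ : ((H →L[𝕜] H) ⧸ hilbertSchmidt e) ≃ Quotient (Setoid.mk _ h),
            ∀ A, Ψ (Submodule.Quotient.mk A) =
              Quotient.mk (Setoid.mk _ h) ⟨star A, Set.mem_range_self A⟩ := by
  have hiff : ∀ A B, (starProduct e A).Equivalent (starProduct e B) ↔ A - B ∈ hilbertSchmidt e :=
    fun A B => equivalent_iff e
  have h : Equivalence (fun s t : Set.range (starProduct e) => s.1.Equivalent t.1) := by
    refine ⟨?_, ?_, ?_⟩
    · rintro ⟨_, A, rfl⟩
      exact (hiff A A).2 (by rw [sub_self]; exact zero_mem _)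
    · rintro ⟨_, A, rfl⟩ ⟨_, B, rfl⟩ hAB
      exact (hiff B A).2 (by rw [← neg_sub]; exact neg_mem ((hiff A B).1 hAB))
    · rintro ⟨_, A, rfl⟩ ⟨_, B, rfl⟩ ⟨_, C, rfl⟩ hAB hBC
      exact (hiff A C).2 (by
        rw [← sub_add_sub_cancel A B C]
        exact add_mem ((hiff A B).1 hAB) ((hiff B C).1 hBC))
  refine ⟨bracket e, bracket_apply e, isPoissonBracket_bracket e, starProduct e,
    isExponential_starProduct e, hiff, h, ?_⟩
  let ψ : ((H →L[𝕜] H) ⧸ hilbertSchmidt e) → Quotient (Setoid.mk _ h) := fun x =>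
    Quotient.liftOn' x (fun A => Quotient.mk (Setoid.mk _ h) ⟨starProduct e A, A, rfl⟩)
      fun A B hAB => Quotient.sound ((hiff A B).2 ((Submodule.quotientRel_def _).1 hAB))
  refine ⟨Equiv.ofBijective ψ ⟨?_, ?_⟩, fun A => rfl⟩
  · intro x y
    induction x using Submodule.Quotient.induction_on with | _ A
    induction y using Submodule.Quotient.induction_on with | _ B
    exact fun hAB => (Submodule.Quotient.eq _).2 ((hiff A B).1 (Quotient.exact hAB))
  · intro y
    induction y using Quotient.inductionOn with | _ s
    obtain ⟨_, A, rfl⟩ := s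
    exact ⟨Submodule.Quotient.mk A, rfl⟩
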